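/- **Setting.** Let $p\in\mathbb N\cup\{\infty\}$ and let $x=(x_k)_{k=1}^p$ be a random vector with law $\mu$ on $\mathbb R^p$ and $\mathbb E[xx^\top]=\Sigma=\mathrm{diag}(\lambda_1,\lambda_2,\dots)$, $\lambda_1\ge\lambda_2\ge\dots>0$; put $z=\Sigma^{-1/2}x$. Let $X\in\mathbb R^{n\times p}$ have $n$ i.i.d. rows $x_i\sim\mu$. For a target $\theta^*\in\mathbb R^p$ and a ridge $\lambda>0$ let $\hat\theta(y)=X^\top(XX^\top+n\lambda I_n)^{-1}y$ and let the bias be $$\mathcal B=\mathbb E_{x}\big[(x^\top\hat\theta(X\theta^*)-x^\top\theta^*)^2\big],$$ where $x$ is a fresh draw from $\mu$; $x^\top\theta^*=\sum_k\theta^*_kx_k$ is understood as a series in $L^2(\mu)$. Write $v_{\le k}$ and $v_{>k}$ for the coordinates of a vector $v$ with index $\le k$ and $>k$, $\Sigma_{>k}=\mathrm{diag}(\lambda_{k+1},\lambda_{k+2},\dots)$, and $\|v\|_M^2=v^\top Mv$. *Generic features (GF), with constants $c,C$:* for all integers $0\le k<p$ the numbers $$\alpha_k=\operatorname*{ess\,inf}_z\frac{\|z_{>k}\|^2_{\Sigma_{>k}}}{\operatorname{tr}\Sigma_{>k}},\qquad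 \beta_k=\operatorname*{ess\,sup}_z\max\Big\{\frac{\|z_{\le k}\|_2^2}{k},\frac{\|z_{>k}\|^2_{\Sigma_{>k}}}{\operatorname{tr}\Sigma_{>k}},\frac{\|z_{>k}\|^2_{\Sigma^2_{>k}}}{\operatorname{tr}\Sigma^2_{>k}}\Big\}$$ lie in $[c,C]$ (for $k=0$ the first ratio in $\beta_0$ is omitted). *Independent features (IF), with constants $G>0$, $\eta>1$:* $p\in\mathbb N$, $p>\eta n$, the coordinates $z_k$ are independent, and $\|z_k\|_{\psi_2}\le G$ for all $k$, where $\|Y\|_{\psi_2}=\inf\{t>0:\mathbb E\,e^{Y^2/t^2}\le2\}$. **Proposition.** Let $a,r>0$, $b\in(0,1+a]$, $\delta\in(0,1)$, and $s=\frac{2r+a}{1+a}$. Suppose $\lambda_k=\Theta(k^{-1-a})$, $|\theta_k^*|=O(k^{-r})$ and $\lambda=\lambda(n)=\Theta(n^{-b})$, with implicit constants $c,C>0$, that is, $ck^{-1-a}\le\lambda_k\le Ck^{-1-a}$ and $|\theta^*_k|\le Ck^{-r}$ for all $k\le p$, and $cn^{-b}\le\lambda\le Cn^{-b}$. 1. If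 (GF) holds with constants $c,C$, then with probability at least $1-\delta-o(1/n)$, $$\mathcal B=\tilde O\big(n^{-\min\{s,2\}\,b}\big).$$ 2. If (IF) holds, then the same bound holds with probability at least $1-\delta-3e^{-c_1n}$, for some constant $c_1>0$. Here $\mathcal B=\tilde O(g(n))$ means $\mathcal B\le K(\log n)^\gamma g(n)$ for all sufficiently large $n$. The constants $K,\gamma,c_1$, the $o(1/n)$ sequence and the threshold on $n$ depend only on $a,r,b,\delta,c,C$ (and, in 2., on $G,\eta$), so that in particular $p$, the law of $x$ and $\theta^*$ may vary with $n$. -/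

import Mathlib

open MeasureTheory ProbabilityTheory Filter Topology Asymptotics
open scoped ENNReal Matrix

noncomputable section

namespace RidgeBias

/-- Index set `{1, …, p}` of the features, for `p ∈ ℕ ∪ {∞}`.  Indices are stored 0-based:
`⟨l, _⟩` stands for the `(l + 1)`-st feature. -/
abbrev Idx (p : ℕ∞) : Type := {l : ℕ // (l : ℕ∞) < p}

/-- `μ` is the law of a feature vector `x ∈ ℝ^p` with second moment operator
`E[x xᵀ] = diag (lam 1, lam 2, …)`, where `lam` is decreasing and positive. -/
structure IsFeatureLaw {p : ℕ∞} (μ : Measure (Idx p → ℝ)) (lam : Idx p → ℝ) : Prop where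
  isProb : IsProbabilityMeasure μ
  pos : ∀ k, 0 < lam k
  anti : Antitone lam
  memLp : ∀ k, MemLp (fun x : Idx p → ℝ => x k) 2 μ
  diag : ∀ k, ∫ x, x k * x k ∂μ = lam k
  offDiag : ∀ k l, k ≠ l → ∫ x, x k * x l ∂μ = 0

/-- The whitened coordinate `z_k = x_k / √λ_k` of `z = Σ^{-1/2} x`. -/
def whiten {p : ℕ∞} (lam : Idx p → ℝ) (x : Idx p → ℝ) (k : Idx p) : ℝ :=
  x k / Real.sqrt (lam k)

open Classical in
/-- The coordinate `x ↦ x_k` as an element of `L²(μ)`. -/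
def coordL2 {p : ℕ∞} (μ : Measure (Idx p → ℝ)) (k : Idx p) : Lp ℝ 2 μ :=
  if h : MemLp (fun x : Idx p → ℝ => x k) 2 μ then h.toLp _ else 0

/-- The linear functional `x ↦ xᵀ v = ∑_k v_k x_k`, the series being taken in `L²(μ)`: for `p = ∞`
and `v ∉ ℓ²` it need not converge absolutely at a fixed `x`.  It converges in `L²(μ)` as soon as
`‖v‖_Σ² = ∑_k lam_k v_k² < ∞`, see `summable_coordL2`. -/
def featureDot {p : ℕ∞} (μ : Measure (Idx p → ℝ)) (v : Idx p → ℝ) : (Idx p → ℝ) → ℝ :=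
  ((∑' k, v k • coordL2 μ k : Lp ℝ 2 μ) : (Idx p → ℝ) → ℝ)

/-- The matrix `X Xᵀ` of an input matrix `X ∈ ℝ^{n × p}` with rows `X i`. -/
def gram {p : ℕ∞} {n : ℕ} (X : Fin n → Idx p → ℝ) : Matrix (Fin n) (Fin n) ℝ :=
  Matrix.of fun i j => ∑' k, X i k * X j k

/-- The ridge regressor `θ̂(y) = Xᵀ (X Xᵀ + n ridge I_n)⁻¹ y ∈ ℝ^p`. -/
def ridgeRegressor {p : ℕ∞} {n : ℕ} (X : Fin n → Idx p → ℝ) (ridge : ℝ) (y : Fin n → ℝ) :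
    Idx p → ℝ :=
  fun k => ∑ i, X i k * (((gram X + ((n : ℝ) * ridge) • (1 : Matrix (Fin n) (Fin n) ℝ))⁻¹) *ᵥ y) i

/-- The bias `E_x (xᵀ θ̂(X θ) - xᵀ θ)²` for the sample `X`, as a number in `[0, ∞]`. -/
def bias {p : ℕ∞} {n : ℕ} (μ : Measure (Idx p → ℝ)) (θ : Idx p → ℝ) (ridge : ℝ)
    (X : Fin n → Idx p → ℝ) : ℝ≥0∞ :=
  ∫⁻ x, ENNReal.ofReal
    ((featureDot μ (ridgeRegressor X ridge (fun i => featureDot μ θ (X i))) x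
      - featureDot μ θ x) ^ 2) ∂μ

/-- `‖z_{≤k}‖²`. -/
def headSq {p : ℕ∞} (lam : Idx p → ℝ) (k : ℕ) (x : Idx p → ℝ) : ℝ≥0∞ :=
  ∑' l : Idx p, if l.1 < k then ENNReal.ofReal (whiten lam x l ^ 2) else 0

/-- `‖z_{>k}‖²` in the norm given by `Σ_{>k}^q`. -/
def tailSq {p : ℕ∞} (lam : Idx p → ℝ) (q : ℕ) (k : ℕ) (x : Idx p → ℝ) : ℝ≥0∞ :=
  ∑' l : Idx p, if k ≤ l.1 then ENNReal.ofReal (lam l ^ q * whiten lam x l ^ 2) else 0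

/-- `tr (Σ_{>k}^q)`. -/
def tailTrace {p : ℕ∞} (lam : Idx p → ℝ) (q : ℕ) (k : ℕ) : ℝ≥0∞ :=
  ∑' l : Idx p, if k ≤ l.1 then ENNReal.ofReal (lam l ^ q) else 0

/-- `α_k = ess inf ‖z_{>k}‖²_{Σ_{>k}} / tr Σ_{>k}`. -/
def alpha {p : ℕ∞} (μ : Measure (Idx p → ℝ)) (lam : Idx p → ℝ) (k : ℕ) : ℝ≥0∞ :=
  essInf (fun x => tailSq lam 1 k x / tailTrace lam 1 k) μ

/-- `β_k = ess sup max {‖z_{≤k}‖² / k, ‖z_{>k}‖²_{Σ_{>k}} / tr Σ_{>k},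
‖z_{>k}‖²_{Σ_{>k}²} / tr Σ_{>k}²}`.  For `k = 0` the first ratio is `0 / 0 = 0`, i.e. it is
omitted. -/
def beta {p : ℕ∞} (μ : Measure (Idx p → ℝ)) (lam : Idx p → ℝ) (k : ℕ) : ℝ≥0∞ :=
  essSup (fun x => max (headSq lam k x / (k : ℝ≥0∞))
    (max (tailSq lam 1 k x / tailTrace lam 1 k) (tailSq lam 2 k x / tailTrace lam 2 k))) μ

/-- Generic features: `α_k = Θ(1)` and `β_k = Θ(1)`, with constants `c, C` that do not depend on
the truncation level `k ∈ {0, 1, 2, …}`, `k < p`. -/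
def GenericFeatures {p : ℕ∞} (μ : Measure (Idx p → ℝ)) (lam : Idx p → ℝ) (c C : ℝ) : Prop :=
  ∀ k : ℕ, (k : ℕ∞) < p →
    (ENNReal.ofReal c ≤ alpha μ lam k ∧ alpha μ lam k ≤ ENNReal.ofReal C) ∧
    (ENNReal.ofReal c ≤ beta μ lam k ∧ beta μ lam k ≤ ENNReal.ofReal C)

/-- The sub-Gaussian norm `‖Y‖_{ψ₂} = inf {t > 0 : E exp (Y² / t²) ≤ 2} ∈ [0, ∞]`. -/
def psiTwoNorm {Ω : Type*} [MeasurableSpace Ω] (P : Measure Ω) (Y : Ω → ℝ) : ℝ≥0∞ :=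
  ⨅ (t : ℝ) (_ : 0 < t) (_ : ∫⁻ ω, ENNReal.ofReal (Real.exp (Y ω ^ 2 / t ^ 2)) ∂P ≤ 2),
    ENNReal.ofReal t

/-- Independent features: the coordinates of `z` are independent, with sub-Gaussian norms at
most `G`. -/
def IndependentFeatures {p : ℕ∞} (μ : Measure (Idx p → ℝ)) (lam : Idx p → ℝ) (G : ℝ) : Prop :=
  iIndepFun (fun (k : Idx p) (x : Idx p → ℝ) => whiten lam x k) μ ∧
    ∀ k, psiTwoNorm μ (fun x => whiten lam x k) ≤ ENNReal.ofReal G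

/-- `lam_k = Θ(k^{-1-a})` with constants `c, C`. -/
def PolyEigenDecay {p : ℕ∞} (lam : Idx p → ℝ) (a c C : ℝ) : Prop :=
  ∀ k : Idx p, c * ((k.1 : ℝ) + 1) ^ (-1 - a) ≤ lam k ∧ lam k ≤ C * ((k.1 : ℝ) + 1) ^ (-1 - a)

/-- `|θ_k| = O(k^{-r})` with constant `C`. -/
def PolyTarget {p : ℕ∞} (θ : Idx p → ℝ) (r C : ℝ) : Prop :=
  ∀ k : Idx p, |θ k| ≤ C * ((k.1 : ℝ) + 1) ^ (-r)

/-- `ridge = Θ(n^{-b})` with constants `c, C`. -/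
def PolyRidge (n : ℕ) (ridge b c C : ℝ) : Prop :=
  c * (n : ℝ) ^ (-b) ≤ ridge ∧ ridge ≤ C * (n : ℝ) ^ (-b)

/-- The law of `n` i.i.d. draws of the feature vector. -/
def sampleLaw {p : ℕ∞} (μ : Measure (Idx p → ℝ)) (n : ℕ) : Measure (Fin n → Idx p → ℝ) :=
  Measure.pi fun _ => μ

/-- The series defining `featureDot μ v` converges in `L²(μ)` whenever `‖v‖_Σ² < ∞`. -/
theorem summable_coordL2 {p : ℕ∞} {μ : Measure (Idx p → ℝ)} {lam : Idx p → ℝ}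
    (h : IsFeatureLaw μ lam) {v : Idx p → ℝ} (hv : Summable fun k => lam k * v k ^ 2) :
    Summable fun k => v k • coordL2 μ k := by
  have hin : ∀ k l, inner ℝ (coordL2 μ k) (coordL2 μ l) = ∫ x, x k * x l ∂μ := by
    intro k l
    rw [MeasureTheory.L2.inner_def]
    apply integral_congr_ae
    simp only [coordL2, h.memLp, dif_pos]
    filter_upwards [(h.memLp k).coeFn_toLp, (h.memLp l).coeFn_toLp] with x h1 h2
    rw [h1, h2]
    simp [mul_comm]
  have hs : ∀ k, Real.sqrt (lam k) ≠ 0 := fun k => (Real.sqrt_pos.2 (h.pos k)).ne'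
  have ho : Orthonormal ℝ fun k => (Real.sqrt (lam k))⁻¹ • coordL2 μ k := by
    classical
    rw [orthonormal_iff_ite]
    intro k l
    rw [inner_smul_left, inner_smul_right, hin]
    split_ifs with hkl
    · subst hkl
      rw [h.diag]
      have := Real.mul_self_sqrt (h.pos k).le
      have h3 := hs k
      simp only [conj_trivial]
      field_simp
      nlinarith
    · rw [h.offDiag k l hkl]; simp
  have := (ho.orthogonalFamily.summable_iff_norm_sq_summable
    (fun k => v k * Real.sqrt (lam k))).2 (by
      refine hv.congr fun k => ?_
      rw [Real.norm_eq_abs, sq_abs, mul_pow, Real.sq_sqrt (h.pos k).le, mul_comm])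
  refine this.congr fun k => ?_
  simp only [LinearIsometry.toSpanSingleton_apply, smul_smul]
  congr 1
  have h3 := hs k
  field_simp

end RidgeBias

end

/-!
Both parts follow from one finite-sample bound whose failure probability is at most `δ`, so that the
additional terms of the two probabilities are not needed.

Write `ρ = n * ridge`, let `R = (XᵀX + ρ)⁻¹` be the resolvent of the sample, and split the features
at the level `k ≈ n ^ (b / (1 + a))` at which `λ_k` is of the order of the ridge, up to logarithms.
The target splits into a head `t` in the span of the first `k` coordinates and a tail of variance
`V`.

*Leave-one-out.* Enlarge the sample by the fresh input `x`.  Up to sign and the factor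
`ρ (1 + xᵀ R x)`, the prediction error at `x` is the dual coefficient of `x` in the regression on
all `n + 1` inputs (`ridgeGram_inv_succ`).  All inputs are exchangeable, so the expected squared
error is an average of the squared dual coefficients.  These sum to at most `tᵀ R t` for the
linear labels given by `t` (`sum_sq_ridgeGram_inv_inner_le`) and to at most `ρ⁻²` times the
squared labels in general (`sum_sq_ridgeGram_inv_le`).  Hence the expected squared error is of the
order `ρ² tᵀ R t / n + V` as long as the leverage `xᵀ R x` is at most of the order of a power of
`log n` (`FeatureModel.lintegral_ridgeResid_le`).

*Control of the resolvent.* Let `B` be the head block of `Σ^{1/2} R Σ^{1/2}`.  The quantities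
`xᵀ R x` and `tᵀ R t` are bounded by the largest eigenvalue of `B`, which is bounded through
`tr (B ^ q)` with `q ≈ log n`.  Adding one sample is a rank-one update of `R`, and in expectation
it contracts `tr (B ^ q)` by a factor `1 - κ`, `κ` at least of order `log³ n / n`, down to the level
`τ₀ ^ q`, `τ₀ ≈ 1 / n` up to logarithms (`FeatureModel.integral_trace_succ_le`).  After `n`
samples the initial value, which is only polynomial to the power `q`, has been forgotten, so that
`B` is of the order `1 / n` with high probability.  This replaces a matrix concentration
inequality.

All of this is carried out on a set of typical inputs, where the whitened head has squared norm at
most of the order `k log n` and the tail squared norm at most of the order of `log n` times its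
mean.  It remains to see that such inputs have probability close to one, and that restricting to
them loses at most half of the second moment of a linear functional (`RetainsHalf`).  Generic
features are almost surely typical.  For independent features the probability is bounded by
convexity of the exponential (`measure_sum_mul_sq_gt_le`), and the second moments are retained
because linear functionals have fourth moments comparable to their squared second moments
(`fourth_moment_sum_le`).  Inserting the polynomial decay of `λ` and `θ` gives the rate
(`exists_bias_bound`).
-/

noncomputable section

namespace RidgeBias

/-! ### Traces of powers of positive semidefinite matrices -/

section Trace

variable {ι : Type*} [Fintype ι] [DecidableEq ι]

/-- The spectral theorem in terms of an orthonormal system `v` of eigenvectors. -/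
theorem exists_eigensystem {B : Matrix ι ι ℝ} (hB : B.PosSemidef) :
    ∃ (v : ι → ι → ℝ) (b : ι → ℝ), (∀ j, 0 ≤ b j) ∧ (∀ j, v j ⬝ᵥ v j = 1) ∧
      (∀ j, B *ᵥ v j = b j • v j) ∧
      (∀ m x, x ⬝ᵥ (B ^ m) *ᵥ x = ∑ j, b j ^ m * (v j ⬝ᵥ x) ^ 2) ∧
      (∀ A : Matrix ι ι ℝ, A.trace = ∑ j, v j ⬝ᵥ A *ᵥ v j) := by
  set U : Matrix ι ι ℝ := (hB.1.eigenvectorUnitary : Matrix ι ι ℝ) with hU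
  have h1 : Uᵀ * U = 1 := by
    have := (Matrix.mem_unitaryGroup_iff' (A := U)).1 hB.1.eigenvectorUnitary.2
    simpa [Matrix.star_eq_conjTranspose, Matrix.conjTranspose_eq_transpose_of_trivial] using this
  have h2 : U * Uᵀ = 1 := mul_eq_one_comm.1 h1
  set b := hB.1.eigenvalues with hb
  have h3 : B = U * Matrix.diagonal b * Uᵀ := by
    have := hB.1.spectral_theorem
    rw [Unitary.conjStarAlgAut_apply] at this
    simpa [Matrix.star_eq_conjTranspose, Matrix.conjTranspose_eq_transpose_of_trivial,
      Function.comp_def] using this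
  have hpow : ∀ m, B ^ m = U * Matrix.diagonal (fun j => b j ^ m) * Uᵀ := by
    intro m
    induction m with
    | zero => simp [h2]
    | succ m ih =>
      rw [pow_succ, ih]
      conv_lhs => rw [h3]
      calc U * Matrix.diagonal (fun j => b j ^ m) * Uᵀ * (U * Matrix.diagonal b * Uᵀ)
          = U * Matrix.diagonal (fun j => b j ^ m) * (Uᵀ * U) * Matrix.diagonal b * Uᵀ := by
            simp only [Matrix.mul_assoc]
        _ = _ := by
            rw [h1, Matrix.mul_one, Matrix.mul_assoc U, Matrix.diagonal_mul_diagonal]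
            simp only [pow_succ]
  refine ⟨fun j => Uᵀ j, b, hB.eigenvalues_nonneg, fun j => ?_, fun j => ?_, fun m x => ?_,
    fun A => ?_⟩
  · have := congrFun (congrFun h1 j) j
    simpa [Matrix.mul_apply, dotProduct] using this
  · have h4 : B * U = U * Matrix.diagonal b := by
      rw [h3, Matrix.mul_assoc, h1, Matrix.mul_one]
    ext i
    have := congrFun (congrFun h4 i) j
    rw [Matrix.mul_diagonal] at this
    simpa [Matrix.mul_apply, Matrix.mulVec, dotProduct, mul_comm] using this
  · rw [hpow, ← Matrix.mulVec_mulVec, ← Matrix.mulVec_mulVec, Matrix.dotProduct_mulVec,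
      ← Matrix.mulVec_transpose]
    simp only [dotProduct, Matrix.mulVec_diagonal]
    refine Finset.sum_congr rfl fun j _ => ?_
    simp only [Matrix.mulVec, dotProduct]
    ring
  · have : A.trace = (Uᵀ * A * U).trace := by
      rw [Matrix.trace_mul_comm, ← Matrix.mul_assoc, h2, Matrix.one_mul]
    rw [this]
    refine Finset.sum_congr rfl fun j _ => ?_
    rw [Matrix.diag_apply, Matrix.mul_assoc, Matrix.mul_apply]
    simp [Matrix.mulVec, dotProduct, Matrix.mul_apply]

/-- Jensen's inequality for the spectral measure of `B` at `x`. -/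
theorem dotProduct_pow_le {B : Matrix ι ι ℝ} (hB : B.PosSemidef) (m : ℕ) {x : ι → ℝ}
    (hx : x ⬝ᵥ x = 1) : (x ⬝ᵥ B *ᵥ x) ^ m ≤ x ⬝ᵥ (B ^ m) *ᵥ x := by
  obtain ⟨v, b, hb, -, -, hq, -⟩ := exists_eigensystem hB
  have h0 := hq 0 x
  have h1 := hq 1 x
  simp only [pow_zero, Matrix.one_mulVec, one_mul, pow_one, hx] at h0 h1
  rw [hq m, h1]
  have := Real.pow_arith_mean_le_arith_mean_pow Finset.univ (fun j => (v j ⬝ᵥ x) ^ 2) b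
    (fun _ _ => sq_nonneg _) h0.symm (fun j _ => hb j) m
  simpa only [mul_comm] using this

theorem trace_pow_eq_sum {B : Matrix ι ι ℝ} (hB : B.PosSemidef) :
    ∃ b : ι → ℝ, (∀ j, 0 ≤ b j) ∧ ∀ m, (B ^ m).trace = ∑ j, b j ^ m := by
  obtain ⟨v, b, hb, hv, he, -, ht⟩ := exists_eigensystem hB
  refine ⟨b, hb, fun m => ?_⟩
  rw [ht]
  refine Finset.sum_congr rfl fun j _ => ?_
  have : (B ^ m) *ᵥ v j = b j ^ m • v j := by
    induction m with
    | zero => simp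
    | succ m ih => rw [pow_succ, ← Matrix.mulVec_mulVec, he, Matrix.mulVec_smul, ih, smul_smul,
        pow_succ, mul_comm]
  rw [this, dotProduct_smul, hv, smul_eq_mul, mul_one]

theorem trace_pow_nonneg {B : Matrix ι ι ℝ} (hB : B.PosSemidef) (m : ℕ) : 0 ≤ (B ^ m).trace :=
  (hB.pow m).trace_nonneg

theorem trace_pow_le_pow_trace {B : Matrix ι ι ℝ} (hB : B.PosSemidef) {m : ℕ} (hm : 1 ≤ m) :
    (B ^ m).trace ≤ B.trace ^ m := by
  obtain ⟨b, hb, ht⟩ := trace_pow_eq_sum hB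
  have h1 := ht 1
  simp only [pow_one] at h1
  rw [ht, h1]
  obtain ⟨m, rfl⟩ := Nat.exists_eq_add_of_le' hm
  simp only [pow_succ, Finset.mul_sum]
  refine Finset.sum_le_sum fun j _ => mul_le_mul_of_nonneg_right ?_ (hb j)
  exact pow_le_pow_left₀ (hb j) (Finset.single_le_sum (fun i _ => hb i) (Finset.mem_univ j)) m

/-- Trace monotonicity of powers: test `C ^ q` on the eigenvectors of `C` and use Jensen's
inequality for `B`. -/
theorem trace_pow_succ_le {B C : Matrix ι ι ℝ} (hB : B.PosSemidef) (hC : C.PosSemidef)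
    (hBC : (B - C).PosSemidef) (q : ℕ) : (C ^ (q + 1)).trace ≤ (B ^ q * C).trace := by
  obtain ⟨v, c, hc, hv, he, hq, ht⟩ := exists_eigensystem hC
  rw [ht, ht (B ^ q * C)]
  refine Finset.sum_le_sum fun j _ => ?_
  have h1 : (C ^ (q + 1)) *ᵥ v j = c j ^ (q + 1) • v j := by
    induction q with
    | zero => simp [he]
    | succ q ih => rw [pow_succ, ← Matrix.mulVec_mulVec, he, Matrix.mulVec_smul, ih, smul_smul,
        pow_succ _ (q + 1), mul_comm]
  rw [h1, ← Matrix.mulVec_mulVec, he, Matrix.mulVec_smul, dotProduct_smul, dotProduct_smul, hv,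
    smul_eq_mul, smul_eq_mul, mul_one, pow_succ, mul_comm]
  refine mul_le_mul_of_nonneg_left (le_trans ?_ (dotProduct_pow_le hB q (hv j))) (hc j)
  refine pow_le_pow_left₀ (hc j) ?_ q
  have h2 := hBC.dotProduct_mulVec_nonneg (v j)
  rw [Matrix.sub_mulVec, dotProduct_sub, he, dotProduct_smul, star_trivial, hv] at h2
  simpa using h2

/-- The quadratic form of `B` is at most `(tr B ^ q) ^ (1 / q)` times the squared norm. -/
theorem dotProduct_mulVec_le_of_trace_pow_le {B : Matrix ι ι ℝ} (hB : B.PosSemidef) {q : ℕ}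
    (hq : q ≠ 0) {t : ℝ} (ht : 0 ≤ t) (h : (B ^ q).trace ≤ t ^ q) (x : ι → ℝ) :
    x ⬝ᵥ B *ᵥ x ≤ t * (x ⬝ᵥ x) := by
  obtain ⟨v, b, hb, hv, he, hqq, htr⟩ := exists_eigensystem hB
  have h0 := hqq 0 x
  have h1 := hqq 1 x
  simp only [pow_zero, Matrix.one_mulVec, one_mul, pow_one] at h0 h1
  rw [h0, h1, Finset.mul_sum]
  refine Finset.sum_le_sum fun j _ => mul_le_mul_of_nonneg_right ?_ (sq_nonneg _)
  refine le_of_pow_le_pow_left₀ hq ht (le_trans ?_ h)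
  rw [htr]
  have h2 : (B ^ q) *ᵥ v j = b j ^ q • v j := by
    clear hq h
    induction q with
    | zero => simp
    | succ m ih => rw [pow_succ, ← Matrix.mulVec_mulVec, he, Matrix.mulVec_smul, ih, smul_smul,
        pow_succ, mul_comm]
  have h3 : b j ^ q = v j ⬝ᵥ (B ^ q) *ᵥ v j := by
    rw [h2, dotProduct_smul, hv, smul_eq_mul, mul_one]
  rw [h3]
  exact Finset.single_le_sum (f := fun j => v j ⬝ᵥ (B ^ q) *ᵥ v j)
    (fun i _ => by simpa using (hB.pow q).dotProduct_mulVec_nonneg (v i)) (Finset.mem_univ j)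

/-- If `t ^ q = tr B ^ q` with `2 ^ q` at least twice the dimension, then the eigenvalues above
`t / 2` carry half of the trace of `B ^ q`. -/
theorem trace_pow_succ_ge {B : Matrix ι ι ℝ} (hB : B.PosSemidef) {q : ℕ}
    (hq : 2 * Fintype.card ι ≤ 2 ^ q) {t : ℝ} (ht : 0 ≤ t) (h : (B ^ q).trace = t ^ q) :
    t / 4 * (B ^ q).trace ≤ (B ^ (q + 1)).trace := by
  obtain ⟨b, hb, htr⟩ := trace_pow_eq_sum hB
  have h1 : ∀ j, t / 2 * b j ^ q - (t / 2) * (t / 2) ^ q ≤ b j ^ (q + 1) := by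
    intro j
    rw [pow_succ]
    rcases le_total (t / 2) (b j) with h' | h'
    · have h3 := mul_le_mul_of_nonneg_right h' (pow_nonneg (hb j) q)
      have h4 : 0 ≤ (t / 2) * (t / 2) ^ q := by positivity
      linarith
    · have h3 := mul_le_mul_of_nonneg_left (pow_le_pow_left₀ (hb j) h' q)
        (by positivity : 0 ≤ t / 2)
      have h4 := mul_nonneg (pow_nonneg (hb j) q) (hb j)
      linarith
  have h2 := Finset.sum_le_sum fun j (_ : j ∈ Finset.univ) => h1 j
  rw [Finset.sum_sub_distrib, ← Finset.mul_sum, ← htr, ← htr, Finset.sum_const, nsmul_eq_mul,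
    Finset.card_univ] at h2
  have h3 : (Fintype.card ι : ℝ) * (t / 2) ^ q ≤ (B ^ q).trace / 2 := by
    rw [h, div_pow]
    have h5 : (2 : ℝ) * Fintype.card ι ≤ 2 ^ q := by exact_mod_cast hq
    have h6 : (0 : ℝ) < 2 ^ q := by positivity
    have h7 : 0 ≤ t ^ q := pow_nonneg ht q
    rw [mul_div_assoc', div_le_div_iff₀ h6 two_pos]
    nlinarith
  have h4 := mul_le_mul_of_nonneg_left h3 (by positivity : 0 ≤ t / 2)
  linarith

end Trace

/-! ### The resolvent of the empirical second moment operator -/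

section Resolvent

variable {E : Type*} [NormedAddCommGroup E] [InnerProductSpace ℝ E]

/-- The inverse of the operator `ρ + ∑ i, x i (x i)ᵀ`, built one rank-one update at a time by the
Sherman–Morrison formula. -/
def ridgeRes (ρ : ℝ) : (n : ℕ) → (Fin n → E) → E →ₗ[ℝ] E
  | 0, _ => ρ⁻¹ • LinearMap.id
  | n + 1, x =>
    ridgeRes ρ n (Fin.tail x) -
      (1 + inner ℝ (x 0) (ridgeRes ρ n (Fin.tail x) (x 0)))⁻¹ •
        ((innerₗ E (x 0)).comp (ridgeRes ρ n (Fin.tail x))).smulRight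
          (ridgeRes ρ n (Fin.tail x) (x 0))

theorem ridgeRes_succ (ρ : ℝ) {n : ℕ} (x : Fin (n + 1) → E) (u : E) :
    ridgeRes ρ (n + 1) x u = ridgeRes ρ n (Fin.tail x) u -
      ((1 + inner ℝ (x 0) (ridgeRes ρ n (Fin.tail x) (x 0)))⁻¹ *
        inner ℝ (x 0) (ridgeRes ρ n (Fin.tail x) u)) • ridgeRes ρ n (Fin.tail x) (x 0) := by
  simp [ridgeRes, smul_smul]

theorem inner_ridgeOp (ρ : ℝ) {n : ℕ} (x : Fin n → E) (u v : E) :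
    inner ℝ u (ρ • v + ∑ i, inner ℝ (x i) v • x i)
      = ρ * inner ℝ u v + ∑ i, inner ℝ (x i) u * inner ℝ (x i) v := by
  rw [inner_add_right, inner_smul_right, inner_sum]
  congr 1
  refine Finset.sum_congr rfl fun i _ => ?_
  rw [inner_smul_right, real_inner_comm (x i) u, mul_comm]

/-- The Sherman–Morrison recursion inverts `ρ + ∑ i, x i (x i)ᵀ`; `E` need not be complete. -/
theorem ridgeOp_ridgeRes {ρ : ℝ} (hρ : 0 < ρ) {n : ℕ} (x : Fin n → E) (u : E) :
    ρ • ridgeRes ρ n x u + ∑ i, inner ℝ (x i) (ridgeRes ρ n x u) • x i = u := by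
  induction n generalizing u with
  | zero => simp [ridgeRes, smul_smul, hρ.ne']
  | succ n ih =>
    set R := ridgeRes ρ n (Fin.tail x) with hR
    have hnn : 0 ≤ inner ℝ (x 0) (R (x 0)) := by
      have h1 := inner_ridgeOp ρ (Fin.tail x) (R (x 0)) (R (x 0))
      rw [ih, real_inner_comm, real_inner_self_eq_norm_sq] at h1
      rw [h1]
      have : 0 ≤ ∑ i, inner ℝ (Fin.tail x i) (R (x 0)) * inner ℝ (Fin.tail x i) (R (x 0)) :=
        Finset.sum_nonneg fun i _ => mul_self_nonneg _
      positivity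
    set h := inner ℝ (x 0) (R (x 0)) with hh
    set s := inner ℝ (x 0) (R u) with hs
    have h0 : (1 + h) ≠ 0 := by positivity
    have e1 := ih (Fin.tail x) u
    have e2 := ih (Fin.tail x) (x 0)
    rw [← hR] at e1 e2
    have e3 : ridgeRes ρ (n + 1) x u = R u - ((1 + h)⁻¹ * s) • R (x 0) := ridgeRes_succ ρ x u
    have e4 : ∀ i, inner ℝ (Fin.tail x i) (ridgeRes ρ (n + 1) x u) • Fin.tail x i
        = inner ℝ (Fin.tail x i) (R u) • Fin.tail x i
          - ((1 + h)⁻¹ * s) • (inner ℝ (Fin.tail x i) (R (x 0)) • Fin.tail x i) := by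
      intro i
      rw [e3, inner_sub_right, inner_smul_right, sub_smul, smul_smul]
    rw [Fin.sum_univ_succ]
    have e5 : ∑ i : Fin n, inner ℝ (x i.succ) (ridgeRes ρ (n + 1) x u) • x i.succ
        = (u - ρ • R u) - ((1 + h)⁻¹ * s) • (x 0 - ρ • R (x 0)) := by
      rw [← eq_sub_iff_add_eq'] at e1 e2
      rw [← e1, ← e2, Finset.smul_sum, ← Finset.sum_sub_distrib]
      exact Finset.sum_congr rfl fun i _ => e4 i
    have e6 : inner ℝ (x 0) (ridgeRes ρ (n + 1) x u) = (1 + h)⁻¹ * s := by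
      rw [e3, inner_sub_right, inner_smul_right, ← hs, ← hh]
      field_simp
      ring
    rw [e5, e6, e3]
    module

theorem ridgeRes_symm {ρ : ℝ} (hρ : 0 < ρ) {n : ℕ} (x : Fin n → E) (u v : E) :
    inner ℝ u (ridgeRes ρ n x v) = inner ℝ v (ridgeRes ρ n x u) := by
  have h1 := inner_ridgeOp ρ x (ridgeRes ρ n x v) (ridgeRes ρ n x u)
  have h2 := inner_ridgeOp ρ x (ridgeRes ρ n x u) (ridgeRes ρ n x v)
  rw [ridgeOp_ridgeRes hρ] at h1 h2
  rw [real_inner_comm, h1, real_inner_comm _ v, h2, real_inner_comm]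
  congr 1
  exact Finset.sum_congr rfl fun i _ => mul_comm _ _

theorem inner_ridgeRes_self {ρ : ℝ} (hρ : 0 < ρ) {n : ℕ} (x : Fin n → E) (u : E) :
    inner ℝ u (ridgeRes ρ n x u)
      = ρ * ‖ridgeRes ρ n x u‖ ^ 2 + ∑ i, inner ℝ (x i) (ridgeRes ρ n x u) ^ 2 := by
  have h1 := inner_ridgeOp ρ x (ridgeRes ρ n x u) (ridgeRes ρ n x u)
  rw [ridgeOp_ridgeRes hρ, real_inner_self_eq_norm_sq] at h1
  rw [real_inner_comm, h1]
  congr 1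
  exact Finset.sum_congr rfl fun i _ => (sq _).symm

theorem inner_ridgeRes_nonneg {ρ : ℝ} (hρ : 0 < ρ) {n : ℕ} (x : Fin n → E) (u : E) :
    0 ≤ inner ℝ u (ridgeRes ρ n x u) := by
  rw [inner_ridgeRes_self hρ]
  positivity

theorem inner_ridgeRes_le {ρ : ℝ} (hρ : 0 < ρ) {n : ℕ} (x : Fin n → E) (u : E) :
    inner ℝ u (ridgeRes ρ n x u) ≤ ‖u‖ ^ 2 / ρ := by
  have h1 := inner_ridgeRes_self hρ x u
  have h2 : 0 ≤ ∑ i, inner ℝ (x i) (ridgeRes ρ n x u) ^ 2 := by positivity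
  have h3 := real_inner_le_norm u (ridgeRes ρ n x u)
  rw [le_div_iff₀ hρ]
  nlinarith [sq_nonneg (‖u‖ - ρ * ‖ridgeRes ρ n x u‖)]

theorem inner_ridgeRes_add_le {ρ : ℝ} (hρ : 0 < ρ) {n : ℕ} (x : Fin n → E) (u v : E) :
    inner ℝ (u + v) (ridgeRes ρ n x (u + v))
      ≤ 2 * inner ℝ u (ridgeRes ρ n x u) + 2 * inner ℝ v (ridgeRes ρ n x v) := by
  have h := inner_ridgeRes_nonneg hρ x (u - v)
  rw [map_sub, inner_sub_left, inner_sub_right, inner_sub_right] at h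
  rw [map_add, inner_add_left, inner_add_right, inner_add_right]
  linarith

theorem inner_ridgeRes_succ {ρ : ℝ} (hρ : 0 < ρ) {n : ℕ} (x : Fin (n + 1) → E) (u v : E) :
    inner ℝ u (ridgeRes ρ (n + 1) x v) = inner ℝ u (ridgeRes ρ n (Fin.tail x) v) -
      inner ℝ (x 0) (ridgeRes ρ n (Fin.tail x) u) * inner ℝ (x 0) (ridgeRes ρ n (Fin.tail x) v) /
        (1 + inner ℝ (x 0) (ridgeRes ρ n (Fin.tail x) (x 0))) := by
  rw [ridgeRes_succ, inner_sub_right, inner_smul_right, ridgeRes_symm hρ _ u (x 0)]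
  ring

theorem inner_ridgeRes_succ_le {ρ : ℝ} (hρ : 0 < ρ) {n : ℕ} (x : Fin (n + 1) → E) (u : E) :
    inner ℝ u (ridgeRes ρ (n + 1) x u) ≤ inner ℝ u (ridgeRes ρ n (Fin.tail x) u) := by
  rw [inner_ridgeRes_succ hρ]
  have h1 := inner_ridgeRes_nonneg hρ (Fin.tail x) (x 0)
  have : 0 ≤ inner ℝ (x 0) (ridgeRes ρ n (Fin.tail x) u) *
    inner ℝ (x 0) (ridgeRes ρ n (Fin.tail x) u) /
        (1 + inner ℝ (x 0) (ridgeRes ρ n (Fin.tail x) (x 0))) :=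
    div_nonneg (mul_self_nonneg _) (by positivity)
  linarith

/-- Measurability of the resolvent's bilinear form only needs that of the inner products of the
vectors involved; no measurable structure on `E` is required. -/
theorem measurable_inner_ridgeRes {α : Type*} [MeasurableSpace α] (ρ : ℝ) {n : ℕ}
    {x : α → Fin n → E} {u v : α → E}
    (hxx : ∀ i j, Measurable fun a => inner ℝ (x a i) (x a j))
    (hux : ∀ i, Measurable fun a => inner ℝ (u a) (x a i))
    (hxv : ∀ i, Measurable fun a => inner ℝ (x a i) (v a))
    (huv : Measurable fun a => inner ℝ (u a) (v a)) :
    Measurable fun a => inner ℝ (u a) (ridgeRes ρ n (x a) (v a)) := by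
  induction n generalizing u v with
  | zero =>
    simp only [ridgeRes, LinearMap.smul_apply, LinearMap.id_apply, inner_smul_right]
    exact huv.const_mul _
  | succ n ih =>
    simp only [ridgeRes_succ, inner_sub_right, inner_smul_right]
    have hx : ∀ i j, Measurable fun a => inner ℝ (Fin.tail (x a) i) (Fin.tail (x a) j) :=
      fun i j => hxx i.succ j.succ
    have h1 := ih hx (fun i => hux i.succ) (fun i => hxv i.succ) huv
    have h2 := ih hx (fun i => hxx 0 i.succ) (fun i => hxx i.succ 0) (hxx 0 0)
    have h3 := ih hx (fun i => hxx 0 i.succ) (fun i => hxv i.succ) (hxv 0)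
    have h4 := ih hx (fun i => hux i.succ) (fun i => hxx i.succ 0) (hux 0)
    exact h1.sub ((((h2.const_add 1).inv).mul h3).mul h4)

/-! ### The regularised Gram matrix and the leave-one-out formula -/

/-- The matrix `K + ρ I` with `K` the Gram matrix of `x`. -/
def ridgeGram (ρ : ℝ) {n : ℕ} (x : Fin n → E) : Matrix (Fin n) (Fin n) ℝ :=
  Matrix.of (fun i j => inner ℝ (x i) (x j)) + ρ • (1 : Matrix (Fin n) (Fin n) ℝ)

theorem ridgeGram_mulVec (ρ : ℝ) {n : ℕ} (x : Fin n → E) (a : Fin n → ℝ) (i : Fin n) :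
    (ridgeGram ρ x *ᵥ a) i = inner ℝ (x i) (∑ j, a j • x j) + ρ * a i := by
  rw [ridgeGram, Matrix.add_mulVec, Matrix.smul_mulVec, Matrix.one_mulVec, inner_sum]
  simp [Matrix.mulVec, dotProduct, inner_smul_right, mul_comm]

theorem dotProduct_ridgeGram_mulVec (ρ : ℝ) {n : ℕ} (x : Fin n → E) (a : Fin n → ℝ) :
    a ⬝ᵥ ridgeGram ρ x *ᵥ a = ‖∑ j, a j • x j‖ ^ 2 + ρ * ∑ i, a i ^ 2 := by
  simp only [dotProduct, ridgeGram_mulVec, mul_add, Finset.sum_add_distrib]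
  rw [← real_inner_self_eq_norm_sq, sum_inner, Finset.mul_sum]
  congr 1
  · exact Finset.sum_congr rfl fun i _ => by rw [inner_smul_left]; simp
  · exact Finset.sum_congr rfl fun i _ => by ring

theorem isUnit_det_ridgeGram {ρ : ℝ} (hρ : 0 < ρ) {n : ℕ} (x : Fin n → E) :
    IsUnit (ridgeGram ρ x).det := by
  rw [← Matrix.isUnit_iff_isUnit_det, ← Matrix.mulVec_injective_iff_isUnit]
  refine (injective_iff_map_eq_zero (Matrix.mulVecLin (ridgeGram ρ x))).2 fun a ha => ?_
  have h := dotProduct_ridgeGram_mulVec ρ x a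
  rw [Matrix.mulVecLin_apply] at ha
  rw [ha, dotProduct_zero] at h
  have h2 : 0 ≤ ∑ i, a i ^ 2 := by positivity
  have h1 : ∑ i, a i ^ 2 = 0 := by nlinarith [sq_nonneg ‖∑ j, a j • x j‖]
  rw [Finset.sum_eq_zero_iff_of_nonneg fun i _ => sq_nonneg _] at h1
  ext i
  exact pow_eq_zero_iff two_ne_zero |>.1 (h1 i (Finset.mem_univ i))

theorem ridgeGram_mulVec_inv {ρ : ℝ} (hρ : 0 < ρ) {n : ℕ} (x : Fin n → E) (y : Fin n → ℝ) :
    ridgeGram ρ x *ᵥ ((ridgeGram ρ x)⁻¹ *ᵥ y) = y := by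
  rw [Matrix.mulVec_mulVec, Matrix.mul_nonsing_inv _ (isUnit_det_ridgeGram hρ x),
    Matrix.one_mulVec]

theorem eq_ridgeGram_inv {ρ : ℝ} (hρ : 0 < ρ) {n : ℕ} {x : Fin n → E} {y a : Fin n → ℝ}
    (h : ridgeGram ρ x *ᵥ a = y) : (ridgeGram ρ x)⁻¹ *ᵥ y = a := by
  rw [← h, Matrix.mulVec_mulVec, Matrix.nonsing_inv_mul _ (isUnit_det_ridgeGram hρ x),
    Matrix.one_mulVec]

/-- The push-through identity `(X Xᵀ + ρ)⁻¹ X u = X (XᵀX + ρ)⁻¹ u`. -/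
theorem ridgeGram_inv_mulVec_inner {ρ : ℝ} (hρ : 0 < ρ) {n : ℕ} (x : Fin n → E) (u : E) :
    (ridgeGram ρ x)⁻¹ *ᵥ (fun i => inner ℝ (x i) u)
      = fun i => inner ℝ (x i) (ridgeRes ρ n x u) := by
  refine eq_ridgeGram_inv hρ ?_
  ext i
  rw [ridgeGram_mulVec]
  conv_rhs => rw [← ridgeOp_ridgeRes hρ x u]
  rw [inner_add_right, inner_smul_right, add_comm]

/-- For labels that are linear in the input, the dual coefficients are controlled by the resolvent:
this is the gain over the trivial bound `sum_sq_ridgeGram_inv_le`. -/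
theorem sum_sq_ridgeGram_inv_inner_le {ρ : ℝ} (hρ : 0 < ρ) {n : ℕ} (x : Fin n → E) (u : E) :
    ∑ i, ((ridgeGram ρ x)⁻¹ *ᵥ (fun i => inner ℝ (x i) u)) i ^ 2
      ≤ inner ℝ u (ridgeRes ρ n x u) := by
  rw [ridgeGram_inv_mulVec_inner hρ, inner_ridgeRes_self hρ]
  have : 0 ≤ ρ * ‖ridgeRes ρ n x u‖ ^ 2 := by positivity
  linarith

/-- The bound for arbitrary labels: the matrix `(X Xᵀ + ρ)⁻¹` has norm at most `ρ⁻¹`. -/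
theorem sum_sq_ridgeGram_inv_le {ρ : ℝ} (hρ : 0 < ρ) {n : ℕ} (x : Fin n → E) (y : Fin n → ℝ) :
    ρ ^ 2 * ∑ i, ((ridgeGram ρ x)⁻¹ *ᵥ y) i ^ 2 ≤ ∑ i, y i ^ 2 := by
  set a := (ridgeGram ρ x)⁻¹ *ᵥ y with ha
  have h := dotProduct_ridgeGram_mulVec ρ x a
  rw [ha, ridgeGram_mulVec_inv hρ, ← ha, dotProduct] at h
  have h2 : 0 ≤ ∑ i, (ρ * a i - y i) ^ 2 := by positivity
  have h3 : ∑ i, (ρ * a i - y i) ^ 2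
      = ρ ^ 2 * ∑ i, a i ^ 2 - 2 * ρ * ∑ i, a i * y i + ∑ i, y i ^ 2 := by
    rw [Finset.mul_sum, Finset.mul_sum, ← Finset.sum_sub_distrib, ← Finset.sum_add_distrib]
    exact Finset.sum_congr rfl fun i _ => by ring
  nlinarith [sq_nonneg ‖∑ j, a j • x j‖]

/-- The leave-one-out formula: the residual at `x 0` of the regression on the remaining samples is a
multiple of the dual coefficient of `x 0` in the regression on all samples. -/
theorem ridgeGram_inv_succ {ρ : ℝ} (hρ : 0 < ρ) {n : ℕ} (x : Fin (n + 1) → E)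
    (y : Fin (n + 1) → ℝ) :
    y 0 - ∑ i, ((ridgeGram ρ (Fin.tail x))⁻¹ *ᵥ Fin.tail y) i * inner ℝ (x 0) (Fin.tail x i)
      = ((ridgeGram ρ x)⁻¹ *ᵥ y) 0 *
        (ρ * (1 + inner ℝ (x 0) (ridgeRes ρ n (Fin.tail x) (x 0)))) := by
  set a := (ridgeGram ρ x)⁻¹ *ᵥ y with ha
  set R := ridgeRes ρ n (Fin.tail x) with hR
  have h1 : ∀ i, inner ℝ (x i) (∑ j, a j • x j) + ρ * a i = y i := fun i => by
    rw [← ridgeGram_mulVec, ha, ridgeGram_mulVec_inv hρ]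
  have h2 : (ridgeGram ρ (Fin.tail x))⁻¹ *ᵥ Fin.tail y
      = fun i => Fin.tail a i + a 0 * inner ℝ (Fin.tail x i) (R (x 0)) := by
    have h3 : (ridgeGram ρ (Fin.tail x))⁻¹ *ᵥ (fun i => Fin.tail y i - a 0 * inner ℝ (Fin.tail x i)
        (x 0)) = Fin.tail a := by
      refine eq_ridgeGram_inv hρ ?_
      ext i
      rw [ridgeGram_mulVec]
      have := h1 i.succ
      rw [Fin.sum_univ_succ, inner_add_right, inner_smul_right] at this
      simp only [Fin.tail] at *
      linarith
    have h5 := ridgeGram_inv_mulVec_inner hρ (Fin.tail x) (x 0)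
    ext i
    have h6 := congrFun h5 i
    rw [← h3, hR, ← h6]
    have h4 : Fin.tail y = (fun i => Fin.tail y i - a 0 * inner ℝ (Fin.tail x i) (x 0))
        + a 0 • fun i => inner ℝ (Fin.tail x i) (x 0) := by
      ext i; simp
    conv_lhs => rw [h4]
    rw [Matrix.mulVec_add, Matrix.mulVec_smul]
    rfl
  have h5 := h1 0
  have h6 := congrArg (inner ℝ (x 0)) (ridgeOp_ridgeRes hρ (Fin.tail x) (x 0))
  rw [inner_add_right, inner_smul_right, inner_sum] at h6
  rw [Fin.sum_univ_succ, inner_add_right, inner_smul_right, inner_sum] at h5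
  rw [h2]
  simp only [add_mul, Finset.sum_add_distrib, inner_smul_right] at h5 h6 ⊢
  have h7 : ∑ i, a 0 * inner ℝ (Fin.tail x i) (R (x 0)) * inner ℝ (x 0) (Fin.tail x i)
      = a 0 * ∑ i, inner ℝ (Fin.tail x i) (R (x 0)) * inner ℝ (x 0) (Fin.tail x i) := by
    rw [Finset.mul_sum]; exact Finset.sum_congr rfl fun i _ => by ring
  have h8 : ∑ i, Fin.tail a i * inner ℝ (x 0) (Fin.tail x i)
      = ∑ i : Fin n, a i.succ * inner ℝ (x 0) (x i.succ) := rfl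
  rw [h7, h8]
  linear_combination -h5 - a 0 * h6

theorem ridgeGram_inv_zero_zero {ρ : ℝ} (hρ : 0 < ρ) {n : ℕ} (x : Fin (n + 1) → E) :
    (ridgeGram ρ x)⁻¹ 0 0
      = (ρ * (1 + inner ℝ (x 0) (ridgeRes ρ n (Fin.tail x) (x 0))))⁻¹ := by
  have h := ridgeGram_inv_succ hρ x (Pi.single 0 1)
  have h1 : Fin.tail (α := fun _ => ℝ) (Pi.single (0 : Fin (n + 1)) (1 : ℝ)) = 0 := by
    ext i; simp [Fin.tail, Fin.succ_ne_zero]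
  rw [h1, Matrix.mulVec_zero, Matrix.mulVec_single_one] at h
  simp at h
  exact eq_inv_of_mul_eq_one_left h.symm

theorem ridgeGram_inv_comp_perm (ρ : ℝ) {n : ℕ} (x : Fin n → E) (σ : Equiv.Perm (Fin n)) :
    (ridgeGram ρ (x ∘ σ))⁻¹ = ((ridgeGram ρ x)⁻¹).submatrix σ σ := by
  rw [← Matrix.inv_submatrix_equiv]
  congr 1
  ext i j
  simp [ridgeGram, Matrix.one_apply]

end Resolvent

/-! ### Decay of the head block of the resolvent -/

section HeadBlock

variable {Ω E ι : Type*} [MeasurableSpace Ω] [NormedAddCommGroup E] [InnerProductSpace ℝ E]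
  [Fintype ι] [DecidableEq ι]

/-- The matrix of the resolvent in the vectors `b`.  For `b l = √λ_l e_l` this is
`Σ^{1/2} (XᵀX + ρ)⁻¹ Σ^{1/2}` restricted to the head coordinates. -/
def resMat (ρ : ℝ) (b : ι → E) {n : ℕ} (x : Fin n → E) : Matrix ι ι ℝ :=
  Matrix.of fun l m => inner ℝ (b l) (ridgeRes ρ n x (b m))

omit [DecidableEq ι] in
theorem resMat_mulVec (ρ : ℝ) (b : ι → E) {n : ℕ} (x : Fin n → E) (a : ι → ℝ) (l : ι) :
    (resMat ρ b x *ᵥ a) l = inner ℝ (b l) (ridgeRes ρ n x (∑ m, a m • b m)) := by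
  simp [resMat, Matrix.mulVec, dotProduct, inner_sum, inner_smul_right, mul_comm]

omit [DecidableEq ι] in
theorem dotProduct_resMat_mulVec (ρ : ℝ) (b : ι → E) {n : ℕ} (x : Fin n → E) (a : ι → ℝ) :
    a ⬝ᵥ resMat ρ b x *ᵥ a
      = inner ℝ (∑ l, a l • b l) (ridgeRes ρ n x (∑ m, a m • b m)) := by
  simp only [dotProduct, resMat_mulVec, sum_inner, inner_smul_left]
  simp

omit [DecidableEq ι] in
theorem resMat_posSemidef {ρ : ℝ} (hρ : 0 < ρ) (b : ι → E) {n : ℕ} (x : Fin n → E) :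
    (resMat ρ b x).PosSemidef := by
  refine Matrix.PosSemidef.of_dotProduct_mulVec_nonneg ?_ fun a => ?_
  · ext l m
    simp only [Matrix.conjTranspose_apply, resMat, Matrix.of_apply, star_trivial]
    exact ridgeRes_symm hρ x _ _
  · rw [star_trivial, dotProduct_resMat_mulVec]
    exact inner_ridgeRes_nonneg hρ x _

omit [Fintype ι] [DecidableEq ι] in
theorem resMat_succ {ρ : ℝ} (hρ : 0 < ρ) (b : ι → E) {n : ℕ} (x : Fin (n + 1) → E) :
    resMat ρ b x = resMat ρ b (Fin.tail x) -
      (1 + inner ℝ (x 0) (ridgeRes ρ n (Fin.tail x) (x 0)))⁻¹ •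
        Matrix.vecMulVec (fun l => inner ℝ (x 0) (ridgeRes ρ n (Fin.tail x) (b l)))
          (fun l => inner ℝ (x 0) (ridgeRes ρ n (Fin.tail x) (b l))) := by
  ext l m
  simp only [resMat, Matrix.of_apply, inner_ridgeRes_succ hρ, Matrix.sub_apply, Matrix.smul_apply,
    Matrix.vecMulVec_apply, smul_eq_mul]
  ring

/-- The drop of `tr B ^ q` caused by one more sample. -/
theorem trace_resMat_succ_pow_le {ρ : ℝ} (hρ : 0 < ρ) (b : ι → E) {n : ℕ} (x : Fin (n + 1) → E)
    (m : ℕ) :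
    (resMat ρ b x ^ (m + 1)).trace ≤ (resMat ρ b (Fin.tail x) ^ (m + 1)).trace -
      (1 + inner ℝ (x 0) (ridgeRes ρ n (Fin.tail x) (x 0)))⁻¹ *
        ((fun l => inner ℝ (x 0) (ridgeRes ρ n (Fin.tail x) (b l))) ⬝ᵥ
          (resMat ρ b (Fin.tail x) ^ m) *ᵥ
            fun l => inner ℝ (x 0) (ridgeRes ρ n (Fin.tail x) (b l))) := by
  have hh := inner_ridgeRes_nonneg hρ (Fin.tail x) (x 0)
  set w : ι → ℝ := fun l => inner ℝ (x 0) (ridgeRes ρ n (Fin.tail x) (b l)) with hw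
  have hs := resMat_succ hρ b x
  rw [← hw] at hs
  have h1 := trace_pow_succ_le (resMat_posSemidef hρ b (Fin.tail x)) (resMat_posSemidef hρ b x)
    (by
      rw [hs, sub_sub_cancel]
      have := Matrix.posSemidef_vecMulVec_self_star (R := ℝ) w
      rw [star_trivial] at this
      exact this.smul (inv_nonneg.2 (by positivity))) m
  refine h1.trans (le_of_eq ?_)
  rw [hs, Matrix.mul_sub, Matrix.trace_sub, ← pow_succ, Matrix.mul_smul, Matrix.trace_smul,
    smul_eq_mul, Matrix.mul_vecMulVec, Matrix.trace_vecMulVec, dotProduct_comm]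

theorem trace_resMat_succ_pow_le' {ρ : ℝ} (hρ : 0 < ρ) (b : ι → E) {n : ℕ}
    (x : Fin (n + 1) → E) (m : ℕ) :
    (resMat ρ b x ^ (m + 1)).trace ≤ (resMat ρ b (Fin.tail x) ^ (m + 1)).trace := by
  refine (trace_resMat_succ_pow_le hρ b x m).trans (sub_le_self _ (mul_nonneg ?_ ?_))
  · have hh := inner_ridgeRes_nonneg hρ (Fin.tail x) (x 0)
    exact inv_nonneg.2 (by positivity)
  · simpa using ((resMat_posSemidef hρ b (Fin.tail x)).pow m).dotProduct_mulVec_nonneg _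

/-- The value from which the contraction starts: the resolvent has norm at most `ρ⁻¹`. -/
theorem trace_resMat_pow_le {ρ : ℝ} (hρ : 0 < ρ) (b : ι → E) {n : ℕ} (x : Fin n → E) (m : ℕ) :
    (resMat ρ b x ^ (m + 1)).trace ≤ ((∑ l, ‖b l‖ ^ 2) / ρ) ^ (m + 1) := by
  refine (trace_pow_le_pow_trace (resMat_posSemidef hρ b x) (Nat.succ_pos m)).trans ?_
  refine pow_le_pow_left₀ (resMat_posSemidef hρ b x).trace_nonneg ?_ _
  rw [Finset.sum_div]
  exact Finset.sum_le_sum fun l _ => inner_ridgeRes_le hρ x (b l)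

theorem measurable_trace_pow {α : Type*} [MeasurableSpace α] {A : α → Matrix ι ι ℝ}
    (hA : ∀ i j, Measurable fun a => A a i j) (m : ℕ) : Measurable fun a => (A a ^ m).trace := by
  have h : ∀ i j, Measurable fun a => (A a ^ m) i j := by
    induction m with
    | zero => intro i j; simp only [pow_zero]; exact measurable_const
    | succ m ih =>
      intro i j
      simp only [pow_succ, Matrix.mul_apply]
      exact Finset.measurable_sum _ fun k _ => (ih i k).mul (hA k j)
  simp only [Matrix.trace, Matrix.diag_apply]
  exact Finset.measurable_sum _ fun k _ => h k k

/-- A feature map `Z : Ω → E` together with scaled head directions `b l = √λ_l e_l` and a set `S` of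
typical inputs: on `S` the whitened head of the feature has squared norm at most `d`
and the tail has squared norm at most `ρ H`, and restricting to `S` loses at most half of the second
moment of a linear functional. -/
structure FeatureModel (μ : Measure Ω) (Z : Ω → E) (b : ι → E) (S : Set Ω) (ρ d H : ℝ) :
    Prop where
  measurableSet : MeasurableSet S
  measurable_kernel : Measurable fun p : Ω × Ω => inner ℝ (Z p.1) (Z p.2)
  measurable_head : ∀ l, Measurable fun ω => inner ℝ (Z ω) (b l)
  memLp : ∀ v, MemLp (fun ω => inner ℝ (Z ω) v) 2 μ
  lower : ∀ v, (∑ l, inner ℝ (b l) v ^ 2) / 2 ≤ ∫ ω in S, inner ℝ (Z ω) v ^ 2 ∂μ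
  decomp : ∀ ω ∈ S, ∃ z : ι → ℝ, z ⬝ᵥ z ≤ d ∧ ‖Z ω - ∑ l, z l • b l‖ ^ 2 ≤ ρ * H

variable {μ : Measure Ω} {Z : Ω → E} {b : ι → E} {S : Set Ω} {ρ d H : ℝ}

namespace FeatureModel

omit [DecidableEq ι] in
theorem measurable_inner (hM : FeatureModel μ Z b S ρ d H) {α : Type*} [MeasurableSpace α]
    {f g : α → Ω} (hf : Measurable f) (hg : Measurable g) :
    Measurable fun a => inner ℝ (Z (f a)) (Z (g a)) :=
  hM.measurable_kernel.comp (hf.prodMk hg)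

omit [DecidableEq ι] in
theorem measurable_inner' (hM : FeatureModel μ Z b S ρ d H) (l : ι) :
    Measurable fun ω => inner ℝ (b l) (Z ω) := by
  simp only [real_inner_comm (Z _) (b l)]
  exact hM.measurable_head l

omit [DecidableEq ι] in
theorem measurable_resMat (hM : FeatureModel μ Z b S ρ d H) {n : ℕ} (l m : ι) :
    Measurable fun X : Fin n → Ω => resMat ρ b (Z ∘ X) l m := by
  refine measurable_inner_ridgeRes ρ (fun i j => ?_) (fun i => ?_) (fun i => ?_) measurable_const
  · exact hM.measurable_inner (measurable_pi_apply i) (measurable_pi_apply j)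
  · exact (hM.measurable_inner' l).comp (measurable_pi_apply i)
  · exact (hM.measurable_head m).comp (measurable_pi_apply i)

/-- On the typical set the leverage is controlled by the head block of the resolvent. -/
theorem leverage_le (hM : FeatureModel μ Z b S ρ d H) (hρ : 0 < ρ) {n : ℕ} (x : Fin n → E)
    {q : ℕ} (hq : q ≠ 0) {t : ℝ} (ht : 0 ≤ t) (h : (resMat ρ b x ^ q).trace ≤ t ^ q)
    {ω : Ω} (hω : ω ∈ S) :
    inner ℝ (Z ω) (ridgeRes ρ n x (Z ω)) ≤ 2 * H + 2 * d * t := by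
  obtain ⟨z, hz, hv⟩ := hM.decomp ω hω
  have h1 := inner_ridgeRes_add_le hρ x (∑ l, z l • b l) (Z ω - ∑ l, z l • b l)
  rw [add_sub_cancel] at h1
  have h2 := dotProduct_mulVec_le_of_trace_pow_le (resMat_posSemidef hρ b x) hq ht h z
  rw [dotProduct_resMat_mulVec] at h2
  have h3 := inner_ridgeRes_le hρ x (Z ω - ∑ l, z l • b l)
  have h4 : ‖Z ω - ∑ l, z l • b l‖ ^ 2 / ρ ≤ H := by
    rw [div_le_iff₀ hρ, mul_comm]; exact hv
  have h5 := mul_le_mul_of_nonneg_left hz ht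
  linarith

/-- The drift inequality: in expectation one more typical sample contracts `tr B ^ q` towards
`τ ^ q` by the factor `1 - κ`. -/
theorem integral_trace_succ_le [IsProbabilityMeasure μ] (hM : FeatureModel μ Z b S ρ d H)
    (hρ : 0 < ρ) (hd : 0 ≤ d) (hH : 0 ≤ H) {τ : ℝ} (hτ : 0 < τ) {n : ℕ} (X : Fin n → Ω) (m : ℕ)
    (hm : 2 * Fintype.card ι ≤ 2 ^ (m + 1)) :
    ∫ ω in S, (resMat ρ b (Z ∘ (Fin.cons ω X : Fin (n + 1) → Ω)) ^ (m + 1)).trace ∂μ ≤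
      (1 - (8 * ((1 + 2 * H) / τ + 2 * d))⁻¹) * (resMat ρ b (Z ∘ X) ^ (m + 1)).trace
        + (8 * ((1 + 2 * H) / τ + 2 * d))⁻¹ * τ ^ (m + 1) := by
  set B := resMat ρ b (Z ∘ X) with hB
  set κ := (8 * ((1 + 2 * H) / τ + 2 * d))⁻¹ with hκ
  have hκ0 : 0 < κ := by positivity
  have hBp : B.PosSemidef := resMat_posSemidef hρ b _
  have hφ : 0 ≤ (B ^ (m + 1)).trace := trace_pow_nonneg hBp _
  have hcomp : ∀ ω, Z ∘ (Fin.cons ω X : Fin (n + 1) → Ω) = Fin.cons (Z ω) (Z ∘ X) := by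
    intro ω
    ext i
    refine Fin.cases ?_ (fun j => ?_) i <;> simp
  simp only [hcomp]
  set φ : Ω → ℝ := fun ω =>
    (resMat ρ b (Fin.cons (Z ω) (Z ∘ X) : Fin (n + 1) → E) ^ (m + 1)).trace with hφd
  have hφle : ∀ ω, φ ω ≤ (B ^ (m + 1)).trace := by
    intro ω
    have := trace_resMat_succ_pow_le' hρ b (Fin.cons (Z ω) (Z ∘ X) : Fin (n + 1) → E) m
    rwa [Fin.tail_cons] at this
  have hφ0 : ∀ ω, 0 ≤ φ ω := fun ω => trace_pow_nonneg (resMat_posSemidef hρ b _) _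
  have hφm : Measurable φ := by
    have := measurable_trace_pow (fun l m => hM.measurable_resMat (n := n + 1) l m) (m + 1)
    have hc : Measurable fun ω => (Fin.cons ω X : Fin (n + 1) → Ω) := by
      refine measurable_pi_lambda _ fun i => ?_
      refine Fin.cases ?_ (fun j => ?_) i
      · exact measurable_id
      · exact measurable_const
    have h2 : φ = (fun Y : Fin (n + 1) → Ω => (resMat ρ b (Z ∘ Y) ^ (m + 1)).trace) ∘
        fun ω => (Fin.cons ω X : Fin (n + 1) → Ω) := by
      ext ω
      simp only [hφd, Function.comp_apply, hcomp]
    rw [h2]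
    exact this.comp hc
  have hφi : Integrable φ μ := by
    refine Integrable.of_bound hφm.aestronglyMeasurable ((B ^ (m + 1)).trace)
      (Eventually.of_forall fun ω => ?_)
    rw [Real.norm_of_nonneg (hφ0 ω)]
    exact hφle ω
  have hμS : μ.real S ≤ 1 := measureReal_le_one
  have hconst : ∫ _ω in S, (B ^ (m + 1)).trace ∂μ ≤ (B ^ (m + 1)).trace := by
    rw [setIntegral_const, smul_eq_mul]
    exact mul_le_of_le_one_left hφ hμS
  -- below the level `τ ^ q` the trace need not contract, and it suffices that it does not grow
  rcases lt_or_ge ((B ^ (m + 1)).trace) (τ ^ (m + 1)) with hlt | hge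
  · have h1 : ∫ ω in S, φ ω ∂μ ≤ (B ^ (m + 1)).trace :=
      (setIntegral_mono hφi.integrableOn (integrable_const _).integrableOn hφle).trans hconst
    nlinarith
  · -- `t` is the `q`-norm of the eigenvalues of `B`
    obtain ⟨t, ht0, ht⟩ : ∃ t : ℝ, 0 ≤ t ∧ (B ^ (m + 1)).trace = t ^ (m + 1) :=
      ⟨(B ^ (m + 1)).trace ^ ((m + 1 : ℕ) : ℝ)⁻¹, Real.rpow_nonneg hφ _,
        (Real.rpow_inv_natCast_pow hφ (Nat.succ_ne_zero m)).symm⟩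
    have hτt : τ ≤ t := by
      rw [ht] at hge
      exact le_of_pow_le_pow_left₀ (Nat.succ_ne_zero m) ht0 hge
    have htp : 0 < t := hτ.trans_le hτt
    obtain ⟨v, β, hβ, hv, he, hqf, htr⟩ := exists_eigensystem hBp
    set N := 1 + 2 * H + 2 * d * t with hN
    have hN0 : 0 < N := by positivity
    set V : ι → E := fun j => ridgeRes ρ n (Z ∘ X) (∑ l, v j l • b l) with hV
    -- the drop of the trace as a sum of squares of linear functionals of the new feature
    have hpt : ∀ ω ∈ S, φ ω ≤ (B ^ (m + 1)).trace
        - N⁻¹ * ∑ j, β j ^ m * inner ℝ (Z ω) (V j) ^ 2 := by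
      intro ω hω
      have h1 := trace_resMat_succ_pow_le hρ b (Fin.cons (Z ω) (Z ∘ X) : Fin (n + 1) → E) m
      rw [Fin.tail_cons, Fin.cons_zero, ← hB, hqf m] at h1
      have h2 : ∀ j, v j ⬝ᵥ (fun l => inner ℝ (Z ω) (ridgeRes ρ n (Z ∘ X) (b l)))
          = inner ℝ (Z ω) (V j) := by
        intro j
        simp [hV, dotProduct, map_sum, inner_sum, inner_smul_right]
      simp only [h2] at h1
      refine h1.trans (sub_le_sub_left (mul_le_mul_of_nonneg_right ?_ ?_) _)
      · have h3 := hM.leverage_le hρ (Z ∘ X) (Nat.succ_ne_zero m) ht0 ht.le hω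
        have h4 := inner_ridgeRes_nonneg hρ (Z ∘ X) (Z ω)
        exact inv_anti₀ (by positivity) (by rw [hN]; linarith)
      · exact Finset.sum_nonneg fun j _ => mul_nonneg (pow_nonneg (hβ j) m) (sq_nonneg _)
    have hsqi : ∀ j, Integrable (fun ω => inner ℝ (Z ω) (V j) ^ 2) μ :=
      fun j => (hM.memLp (V j)).integrable_sq
    have hI : Integrable (fun ω => ∑ j, β j ^ m * inner ℝ (Z ω) (V j) ^ 2) μ :=
      integrable_finsetSum _ fun j _ => (hsqi j).const_mul _
    have hmono : ∫ ω in S, φ ω ∂μ ≤ ∫ ω in S, ((B ^ (m + 1)).trace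
        - N⁻¹ * ∑ j, β j ^ m * inner ℝ (Z ω) (V j) ^ 2) ∂μ :=
      setIntegral_mono_on hφi.integrableOn
        ((integrable_const _).sub (hI.const_mul _)).integrableOn hM.measurableSet hpt
    have hlow : (B ^ (m + 2)).trace / 2
        ≤ ∫ ω in S, ∑ j, β j ^ m * inner ℝ (Z ω) (V j) ^ 2 ∂μ := by
      rw [integral_finsetSum _ fun j _ => ((hsqi j).const_mul _).integrableOn, htr,
        Finset.sum_div]
      refine Finset.sum_le_sum fun j _ => ?_
      rw [integral_const_mul]
      have h1 : v j ⬝ᵥ (B ^ (m + 2)) *ᵥ v j = β j ^ m * ((β j • v j) ⬝ᵥ (β j • v j)) := by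
        have h5 : ∀ k, (B ^ k) *ᵥ v j = β j ^ k • v j := by
          intro k
          induction k with
          | zero => simp
          | succ k ih => rw [pow_succ, ← Matrix.mulVec_mulVec, he, Matrix.mulVec_smul, ih,
              smul_smul, pow_succ, mul_comm]
        rw [h5, dotProduct_smul, smul_dotProduct, dotProduct_smul, hv]
        simp only [smul_eq_mul]
        ring
      rw [h1, ← he j, mul_div_assoc]
      refine mul_le_mul_of_nonneg_left (le_trans (le_of_eq ?_) (hM.lower (V j)))
        (pow_nonneg (hβ j) m)
      simp only [dotProduct, resMat_mulVec, hB, hV, sq]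
    rw [integral_sub (integrable_const _).integrableOn (hI.const_mul _).integrableOn,
      integral_const_mul] at hmono
    have hge2 := trace_pow_succ_ge hBp hm ht0 ht
    have hκN : κ ≤ t / (8 * N) := by
      rw [hκ, inv_le_comm₀ (by positivity) (by positivity), inv_div, hN,
        div_le_iff₀ htp]
      have : (1 + 2 * H) ≤ (1 + 2 * H) / τ * t := by
        rw [div_mul_eq_mul_div, le_div_iff₀ hτ]
        exact mul_le_mul_of_nonneg_left hτt (by positivity)
      nlinarith
    have h6 : κ * (B ^ (m + 1)).trace ≤ N⁻¹ * ((B ^ (m + 2)).trace / 2) := by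
      calc κ * (B ^ (m + 1)).trace ≤ t / (8 * N) * (B ^ (m + 1)).trace :=
            mul_le_mul_of_nonneg_right hκN hφ
        _ = N⁻¹ * ((t / 4 * (B ^ (m + 1)).trace) / 2) := by field_simp; ring
        _ ≤ _ := mul_le_mul_of_nonneg_left (by linarith) (by positivity)
    have h7 := mul_le_mul_of_nonneg_left hlow (inv_nonneg.2 hN0.le)
    have h8 : 0 ≤ κ * τ ^ (m + 1) := by positivity
    linarith

/-- All samples are typical. -/
def allIn (S : Set Ω) (n : ℕ) : Set (Fin n → Ω) := {X | ∀ i, X i ∈ S}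

omit [DecidableEq ι] in
theorem measurableSet_allIn (hM : FeatureModel μ Z b S ρ d H) (n : ℕ) :
    MeasurableSet (allIn S n) := by
  have : allIn S n = ⋂ i, (fun X : Fin n → Ω => X i) ⁻¹' S := by
    ext X; simp [allIn]
  rw [this]
  exact MeasurableSet.iInter fun i => measurable_pi_apply i hM.measurableSet

/-- The drift inequality iterated over all samples, on the event that all of them are typical; the
newest sample is the first coordinate. -/
theorem integral_trace_le [IsProbabilityMeasure μ] (hM : FeatureModel μ Z b S ρ d H)
    (hρ : 0 < ρ) (hd : 0 ≤ d) (hH : 0 ≤ H) {τ : ℝ} (hτ : 0 < τ) (m : ℕ)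
    (hm : 2 * Fintype.card ι ≤ 2 ^ (m + 1))
    (hκ : (8 * ((1 + 2 * H) / τ + 2 * d))⁻¹ ≤ 1) (n : ℕ) :
    ∫ X in allIn S n, (resMat ρ b (Z ∘ X) ^ (m + 1)).trace ∂(Measure.pi fun _ : Fin n => μ) ≤
      (1 - (8 * ((1 + 2 * H) / τ + 2 * d))⁻¹) ^ n * ((∑ l, ‖b l‖ ^ 2) / ρ) ^ (m + 1)
        + τ ^ (m + 1) := by
  set κ := (8 * ((1 + 2 * H) / τ + 2 * d))⁻¹ with hκd
  have hκ0 : 0 < κ := by positivity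
  have hint : ∀ n, Integrable (fun X : Fin n → Ω => (resMat ρ b (Z ∘ X) ^ (m + 1)).trace)
      (Measure.pi fun _ : Fin n => μ) := by
    intro n
    refine Integrable.of_bound
      (measurable_trace_pow (fun l m => hM.measurable_resMat l m) _).aestronglyMeasurable
      (((∑ l, ‖b l‖ ^ 2) / ρ) ^ (m + 1)) (Eventually.of_forall fun X => ?_)
    rw [Real.norm_of_nonneg (trace_pow_nonneg (resMat_posSemidef hρ b _) _)]
    exact trace_resMat_pow_le hρ b _ m
  induction n with
  | zero =>
    refine (setIntegral_mono (hint 0).integrableOn (integrable_const _).integrableOn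
      fun X => trace_resMat_pow_le hρ b _ m).trans ?_
    rw [setIntegral_const, smul_eq_mul, pow_zero, one_mul]
    have h0 : 0 ≤ ((∑ l, ‖b l‖ ^ 2) / ρ) ^ (m + 1) := by positivity
    have := mul_le_of_le_one_left h0
      (measureReal_le_one (μ := Measure.pi fun _ : Fin 0 => μ) (s := allIn S 0))
    have : 0 ≤ τ ^ (m + 1) := by positivity
    linarith
  | succ n ih =>
    set P := Measure.pi fun _ : Fin n => μ with hP
    have hmp := measurePreserving_piFinSuccAbove (fun _ : Fin (n + 1) => μ) 0
    have hmp' := hmp.symm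
    set f : (Fin (n + 1) → Ω) → ℝ := (allIn S (n + 1)).indicator
      fun X => (resMat ρ b (Z ∘ X) ^ (m + 1)).trace with hf
    have hfi : Integrable f (Measure.pi fun _ : Fin (n + 1) => μ) :=
      (hint (n + 1)).indicator (hM.measurableSet_allIn _)
    rw [← integral_indicator (hM.measurableSet_allIn _), ← hf,
      ← hmp'.integral_comp' (g := f)]
    have hfi' := (hmp'.integrable_comp_emb (MeasurableEquiv.measurableEmbedding _)).2 hfi
    change ∫ z, (f ∘ (MeasurableEquiv.piFinSuccAbove (fun _ => Ω) 0).symm) z ∂_ ≤ _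
    rw [integral_prod_symm _ hfi']
    simp only [Function.comp_apply]
    have hfe : ∀ (X : Fin n → Ω) (ω : Ω),
        f ((MeasurableEquiv.piFinSuccAbove (fun _ => Ω) 0).symm (ω, X))
          = (allIn S n).indicator (fun X => S.indicator (fun ω =>
            (resMat ρ b (Z ∘ (Fin.cons ω X : Fin (n + 1) → Ω)) ^ (m + 1)).trace) ω) X := by
      intro X ω
      have h1 : (MeasurableEquiv.piFinSuccAbove (fun _ : Fin (n + 1) => Ω) 0).symm (ω, X)
          = (Fin.cons ω X : Fin (n + 1) → Ω) := by
        ext i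
        simp [MeasurableEquiv.piFinSuccAbove]
      rw [h1, hf]
      have h2 : (Fin.cons ω X : Fin (n + 1) → Ω) ∈ allIn S (n + 1) ↔ ω ∈ S ∧ X ∈ allIn S n := by
        simp [allIn, Fin.forall_fin_succ]
      by_cases h3 : ω ∈ S <;> by_cases h4 : X ∈ allIn S n <;> simp [Set.indicator, h2, h3, h4]
    have hstep : ∀ X, ∫ ω, f ((MeasurableEquiv.piFinSuccAbove (fun _ => Ω) 0).symm (ω, X)) ∂μ
        ≤ (allIn S n).indicator (fun X =>
          (1 - κ) * (resMat ρ b (Z ∘ X) ^ (m + 1)).trace + κ * τ ^ (m + 1)) X := by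
      intro X
      simp only [hfe]
      by_cases h4 : X ∈ allIn S n
      · simp only [Set.indicator_of_mem h4]
        rw [integral_indicator hM.measurableSet]
        exact hM.integral_trace_succ_le hρ hd hH hτ X m hm
      · simp [Set.indicator_of_notMem h4]
    have hri : Integrable (fun X : Fin n → Ω =>
        (1 - κ) * (resMat ρ b (Z ∘ X) ^ (m + 1)).trace + κ * τ ^ (m + 1)) P :=
      ((hint n).const_mul _).add (integrable_const _)
    refine (integral_mono hfi'.integral_prod_right (hri.indicator (hM.measurableSet_allIn n))
      hstep).trans ?_
    rw [integral_indicator (hM.measurableSet_allIn n),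
      integral_add ((hint n).const_mul _).integrableOn (integrable_const _).integrableOn,
      integral_const_mul, setIntegral_const, smul_eq_mul]
    have h5 : P.real (allIn S n) * (κ * τ ^ (m + 1)) ≤ κ * τ ^ (m + 1) :=
      mul_le_of_le_one_left (by positivity) measureReal_le_one
    have h6 := mul_le_mul_of_nonneg_left ih (sub_nonneg.2 hκ)
    rw [pow_succ (1 - κ) n]
    linarith

end FeatureModel

end HeadBlock

/-! ### Exchangeability and the expected leave-one-out residual -/

section LeaveOneOut

theorem measurable_matrix_inv {α : Type*} [MeasurableSpace α] {n : ℕ}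
    {A : α → Matrix (Fin n) (Fin n) ℝ} (hA : ∀ i j, Measurable fun a => A a i j) (i j : Fin n) :
    Measurable fun a => (A a)⁻¹ i j := by
  have hdet : ∀ {A : α → Matrix (Fin n) (Fin n) ℝ}, (∀ i j, Measurable fun a => A a i j) →
      Measurable fun a => (A a).det := by
    intro A hA
    simp only [Matrix.det_apply']
    exact Finset.measurable_sum _ fun σ _ =>
      (Finset.measurable_prod _ fun k _ => hA (σ k) k).const_mul _
  simp only [Matrix.inv_def, Matrix.smul_apply, smul_eq_mul, Ring.inverse_eq_inv',
    Matrix.adjugate_apply]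
  refine (hdet hA).inv.mul (hdet fun k l => ?_)
  by_cases hk : k = j
  · subst hk
    simp only [Matrix.updateRow_self]
    exact measurable_const
  · simp only [Matrix.updateRow_ne hk]
    exact hA k l

/-- Exchangeability of an i.i.d. sample. -/
theorem lintegral_comp_perm {Ω : Type*} [MeasurableSpace Ω] {μ : Measure Ω} [SigmaFinite μ]
    {n : ℕ} (σ : Equiv.Perm (Fin n)) (f : (Fin n → Ω) → ℝ≥0∞) :
    ∫⁻ Y, f (Y ∘ σ) ∂(Measure.pi fun _ : Fin n => μ) = ∫⁻ Y, f Y ∂(Measure.pi fun _ => μ) := by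
  have h := measurePreserving_piCongrLeft (fun _ : Fin n => μ) σ.symm
  rw [← h.lintegral_comp_emb (MeasurableEquiv.measurableEmbedding _) f]
  refine lintegral_congr fun Y => ?_
  congr 1
  ext i
  have := MeasurableEquiv.piCongrLeft_apply_apply (β := fun _ => Ω) σ.symm Y (σ i)
  rw [Equiv.symm_apply_apply] at this
  exact this.symm

variable {Ω E ι : Type*} [MeasurableSpace Ω] [NormedAddCommGroup E] [InnerProductSpace ℝ E]
  [Fintype ι] [DecidableEq ι]

/-- The error at `ω` of the kernel ridge regressor fitted to the labels `g` on the sample `X`. -/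
def ridgeResid (Z : Ω → E) (ρ : ℝ) (g : Ω → ℝ) {n : ℕ} (X : Fin n → Ω) (ω : Ω) : ℝ :=
  ∑ i, ((ridgeGram ρ (Z ∘ X))⁻¹ *ᵥ (g ∘ X)) i * inner ℝ (Z ω) (Z (X i)) - g ω

variable {μ : Measure Ω} {Z : Ω → E} {b : ι → E} {S : Set Ω} {ρ d H : ℝ}

namespace FeatureModel

omit [DecidableEq ι] in
theorem measurable_ridgeGram_inv (hM : FeatureModel μ Z b S ρ d H) {n : ℕ} (i j : Fin n) :
    Measurable fun X : Fin n → Ω => (ridgeGram ρ (Z ∘ X))⁻¹ i j := by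
  refine measurable_matrix_inv (fun i j => ?_) i j
  simp only [ridgeGram, Matrix.add_apply, Matrix.of_apply, Function.comp_apply]
  exact (hM.measurable_inner (measurable_pi_apply i) (measurable_pi_apply j)).add_const _

omit [DecidableEq ι] in
theorem measurable_ridgeGram_inv_mulVec (hM : FeatureModel μ Z b S ρ d H) {n : ℕ} {g : Ω → ℝ}
    (hg : Measurable g) (i : Fin n) :
    Measurable fun X : Fin n → Ω => ((ridgeGram ρ (Z ∘ X))⁻¹ *ᵥ (g ∘ X)) i := by
  simp only [Matrix.mulVec, dotProduct]
  exact Finset.measurable_sum _ fun j _ => (hM.measurable_ridgeGram_inv i j).mul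
    (hg.comp (measurable_pi_apply j))

omit [DecidableEq ι] in
theorem measurable_ridgeResid (hM : FeatureModel μ Z b S ρ d H) {n : ℕ} {g : Ω → ℝ}
    (hg : Measurable g) :
    Measurable fun p : (Fin n → Ω) × Ω => ridgeResid Z ρ g p.1 p.2 := by
  refine (Finset.measurable_sum _ fun i _ => ?_).sub (hg.comp measurable_snd)
  exact ((hM.measurable_ridgeGram_inv_mulVec hg i).comp measurable_fst).mul
    (hM.measurable_inner measurable_snd ((measurable_pi_apply i).comp measurable_fst))

omit [DecidableEq ι] in
theorem measurable_inner_vec (hM : FeatureModel μ Z b S ρ d H) (u : ι → ℝ) :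
    Measurable fun ω => inner ℝ (Z ω) (∑ l, u l • b l) := by
  simp only [inner_sum, inner_smul_right]
  exact Finset.measurable_sum _ fun l _ => (hM.measurable_head l).const_mul _

omit [DecidableEq ι] in
theorem measurable_quad (hM : FeatureModel μ Z b S ρ d H) (u : ι → ℝ) {n : ℕ} :
    Measurable fun X : Fin n → Ω =>
      inner ℝ (∑ l, u l • b l) (ridgeRes ρ n (Z ∘ X) (∑ l, u l • b l)) := by
  simp only [← dotProduct_resMat_mulVec, dotProduct, Matrix.mulVec]
  exact Finset.measurable_sum _ fun i _ => (Finset.measurable_sum _ fun j _ =>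
    (hM.measurable_resMat i j).mul_const _).const_mul _

omit [DecidableEq ι] in
theorem measurable_leverage (hM : FeatureModel μ Z b S ρ d H) {n : ℕ} :
    Measurable fun p : (Fin n → Ω) × Ω =>
      inner ℝ (Z p.2) (ridgeRes ρ n (Z ∘ p.1) (Z p.2)) := by
  have h : ∀ i, Measurable fun p : (Fin n → Ω) × Ω => p.1 i :=
    fun i => (measurable_pi_apply i).comp measurable_fst
  exact measurable_inner_ridgeRes ρ (fun i j => hM.measurable_inner (h i) (h j))
    (fun i => hM.measurable_inner measurable_snd (h i))
    (fun i => hM.measurable_inner (h i) measurable_snd)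
    (hM.measurable_inner measurable_snd measurable_snd)

omit [DecidableEq ι] in
/-- The expected squared error at a fresh input, on the event that the leverage is at most `h` and
the resolvent at the head `∑ l, u l • b l` of the target is at most `F`.  A fresh input is
exchangeable with the sample, the leave-one-out error is an explicit multiple of a dual coefficient
of the enlarged sample, and the sum of the squared dual coefficients is controlled. -/
theorem lintegral_ridgeResid_le [IsProbabilityMeasure μ] (hM : FeatureModel μ Z b S ρ d H)
    (hρ : 0 < ρ) (n : ℕ) {h F V : ℝ} (hh : 0 ≤ h) (hF : 0 ≤ F) (hV : 0 ≤ V) {g : Ω → ℝ}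
    (hg : Measurable g) (u : ι → ℝ)
    (hgV : ∫⁻ ω, ENNReal.ofReal ((g ω - inner ℝ (Z ω) (∑ l, u l • b l)) ^ 2) ∂μ
      ≤ ENNReal.ofReal V) :
    ∫⁻ X : Fin n → Ω, ∫⁻ ω, {p : (Fin n → Ω) × Ω |
        inner ℝ (Z p.2) (ridgeRes ρ n (Z ∘ p.1) (Z p.2)) ≤ h ∧
        inner ℝ (∑ l, u l • b l) (ridgeRes ρ n (Z ∘ p.1) (∑ l, u l • b l)) ≤ F}.indicator
        (fun p => ENNReal.ofReal (ridgeResid Z ρ g p.1 p.2 ^ 2)) (X, ω) ∂μ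
          ∂(Measure.pi fun _ : Fin n => μ)
      ≤ ENNReal.ofReal (2 * (1 + h) ^ 2 * (ρ ^ 2 * F / (n + 1) + V)) := by
  classical
  set t : E := ∑ l, u l • b l with ht
  set Q := Measure.pi fun _ : Fin (n + 1) => μ with hQ
  set A : (Fin (n + 1) → Ω) → Matrix (Fin (n + 1)) (Fin (n + 1)) ℝ :=
    fun Y => (ridgeGram ρ (Z ∘ Y))⁻¹ with hA
  set g1 : Ω → ℝ := fun ω => inner ℝ (Z ω) t with hg1
  have hg1m : Measurable g1 := hM.measurable_inner_vec u
  -- the squared leave-one-out error of the `i`-th input; by `ridgeGram_inv_zero_zero` the inverse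
  -- of the `i`-th diagonal entry is `ρ` times one plus the leverage
  set term : Fin (n + 1) → (Fin (n + 1) → Ω) → ℝ≥0∞ := fun i Y =>
    if 0 ≤ (A Y i i)⁻¹ ∧ (A Y i i)⁻¹ ≤ ρ * (1 + h) ∧ ∑ j, (A Y *ᵥ (g1 ∘ Y)) j ^ 2 ≤ F
    then ENNReal.ofReal (((A Y *ᵥ (g ∘ Y)) i * (A Y i i)⁻¹) ^ 2) else 0 with hterm
  have hAm : ∀ i j, Measurable fun Y => A Y i j := fun i j => hM.measurable_ridgeGram_inv i j
  have hterm_meas : ∀ i, Measurable (term i) := by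
    intro i
    refine Measurable.ite ?_ ?_ measurable_const
    · refine MeasurableSet.inter (measurableSet_le measurable_const (hAm i i).inv)
        (MeasurableSet.inter (measurableSet_le (hAm i i).inv measurable_const)
          (measurableSet_le (Finset.measurable_sum _ fun j _ =>
            (hM.measurable_ridgeGram_inv_mulVec hg1m j).pow_const 2) measurable_const))
    · exact (((hM.measurable_ridgeGram_inv_mulVec hg i).mul (hAm i i).inv).pow_const
        2).ennreal_ofReal
  have hperm : ∀ i, ∫⁻ Y, term i Y ∂Q = ∫⁻ Y, term 0 Y ∂Q := by
    intro i
    rw [hQ, ← lintegral_comp_perm (Equiv.swap 0 i) (term 0)]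
    refine lintegral_congr fun Y => ?_
    have h1 : A (Y ∘ Equiv.swap 0 i) = (A Y).submatrix (Equiv.swap 0 i) (Equiv.swap 0 i) :=
      ridgeGram_inv_comp_perm ρ (Z ∘ Y) _
    have h2 : ∀ (f : Ω → ℝ), A (Y ∘ Equiv.swap 0 i) *ᵥ (f ∘ Y ∘ Equiv.swap 0 i)
        = (A Y *ᵥ (f ∘ Y)) ∘ Equiv.swap 0 i := by
      intro f
      rw [h1, Matrix.submatrix_mulVec_equiv]
      congr 2
      ext k
      simp
    have h3 : A (Y ∘ Equiv.swap 0 i) 0 0 = A Y i i := by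
      rw [h1, Matrix.submatrix_apply, Equiv.swap_apply_left]
    have h4 : ∑ j, (A (Y ∘ Equiv.swap 0 i) *ᵥ (g1 ∘ Y ∘ Equiv.swap 0 i)) j ^ 2
        = ∑ j, (A Y *ᵥ (g1 ∘ Y)) j ^ 2 := by
      rw [h2]
      exact Equiv.sum_comp (Equiv.swap 0 i) fun j => (A Y *ᵥ (g1 ∘ Y)) j ^ 2
    simp only [hterm, h3, h4]
    rw [h2 g, Function.comp_apply, Equiv.swap_apply_left]
  have hsum : ∀ Y, ∑ i, term i Y ≤ ENNReal.ofReal (2 * (1 + h) ^ 2 * (ρ ^ 2 * F))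
      + ENNReal.ofReal (2 * (1 + h) ^ 2) * ∑ i, ENNReal.ofReal ((g (Y i) - g1 (Y i)) ^ 2) := by
    intro Y
    by_cases hFY : ∑ j, (A Y *ᵥ (g1 ∘ Y)) j ^ 2 ≤ F
    · have h1 : ∀ i, term i Y ≤ ENNReal.ofReal ((ρ * (1 + h)) ^ 2 * (A Y *ᵥ (g ∘ Y)) i ^ 2) := by
        intro i
        simp only [hterm]
        split_ifs with hc
        · refine ENNReal.ofReal_le_ofReal ?_
          rw [mul_pow, mul_comm]
          exact mul_le_mul_of_nonneg_right (pow_le_pow_left₀ hc.1 hc.2.1 2) (sq_nonneg _)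
        · exact zero_le
      refine (Finset.sum_le_sum fun i _ => h1 i).trans ?_
      rw [← ENNReal.ofReal_sum_of_nonneg fun i _ => by positivity,
        ← ENNReal.ofReal_sum_of_nonneg fun i _ => sq_nonneg _,
        ← ENNReal.ofReal_mul (by positivity), ← ENNReal.ofReal_add (by positivity)
          (mul_nonneg (by positivity) (Finset.sum_nonneg fun i _ => sq_nonneg _))]
      refine ENNReal.ofReal_le_ofReal ?_
      rw [← Finset.mul_sum]
      set y2 : Fin (n + 1) → ℝ := fun i => g (Y i) - g1 (Y i) with hy2
      have h2 : A Y *ᵥ (g ∘ Y) = A Y *ᵥ (g1 ∘ Y) + A Y *ᵥ y2 := by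
        rw [← Matrix.mulVec_add]
        congr 1
        ext i
        simp [hy2]
      have h3 : ∑ i, (A Y *ᵥ (g ∘ Y)) i ^ 2
          ≤ 2 * ∑ i, (A Y *ᵥ (g1 ∘ Y)) i ^ 2 + 2 * ∑ i, (A Y *ᵥ y2) i ^ 2 := by
        rw [Finset.mul_sum, Finset.mul_sum, ← Finset.sum_add_distrib, h2]
        refine Finset.sum_le_sum fun i _ => ?_
        rw [Pi.add_apply]
        nlinarith [sq_nonneg ((A Y *ᵥ (g1 ∘ Y)) i - (A Y *ᵥ y2) i)]
      have h4 : ρ ^ 2 * ∑ i, (A Y *ᵥ y2) i ^ 2 ≤ ∑ i, y2 i ^ 2 :=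
        sum_sq_ridgeGram_inv_le hρ (Z ∘ Y) y2
      calc (ρ * (1 + h)) ^ 2 * ∑ i, (A Y *ᵥ (g ∘ Y)) i ^ 2
          ≤ (ρ * (1 + h)) ^ 2 * (2 * F + 2 * ∑ i, (A Y *ᵥ y2) i ^ 2) :=
            mul_le_mul_of_nonneg_left (by linarith) (by positivity)
        _ = 2 * (1 + h) ^ 2 * (ρ ^ 2 * F)
            + 2 * (1 + h) ^ 2 * (ρ ^ 2 * ∑ i, (A Y *ᵥ y2) i ^ 2) := by ring
        _ ≤ _ := by
            have := mul_le_mul_of_nonneg_left h4 (by positivity : 0 ≤ 2 * (1 + h) ^ 2)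
            linarith
    · have h1 : ∀ i, term i Y = 0 := fun i => if_neg fun hc => hFY hc.2.2
      simp [h1]
  have hg2m : Measurable fun ω => ENNReal.ofReal ((g ω - g1 ω) ^ 2) :=
    ((hg.sub hg1m).pow_const 2).ennreal_ofReal
  have htot : ((n : ℝ≥0∞) + 1) * ∫⁻ Y, term 0 Y ∂Q ≤
      ((n : ℝ≥0∞) + 1) * ENNReal.ofReal (2 * (1 + h) ^ 2 * (ρ ^ 2 * F / (n + 1) + V)) := by
    calc ((n : ℝ≥0∞) + 1) * ∫⁻ Y, term 0 Y ∂Q = ∑ i, ∫⁻ Y, term i Y ∂Q := by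
          simp [hperm]
      _ = ∫⁻ Y, ∑ i, term i Y ∂Q := (lintegral_finsetSum _ fun i _ => hterm_meas i).symm
      _ ≤ ∫⁻ Y, (ENNReal.ofReal (2 * (1 + h) ^ 2 * (ρ ^ 2 * F))
          + ENNReal.ofReal (2 * (1 + h) ^ 2)
            * ∑ i, ENNReal.ofReal ((g (Y i) - g1 (Y i)) ^ 2)) ∂Q := lintegral_mono hsum
      _ = ENNReal.ofReal (2 * (1 + h) ^ 2 * (ρ ^ 2 * F)) + ENNReal.ofReal (2 * (1 + h) ^ 2)
            * ∑ i : Fin (n + 1), ∫⁻ ω, ENNReal.ofReal ((g ω - g1 ω) ^ 2) ∂μ := by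
          have hm : ∀ i : Fin (n + 1), Measurable fun Y : Fin (n + 1) → Ω =>
              ENNReal.ofReal ((g (Y i) - g1 (Y i)) ^ 2) :=
            fun i => hg2m.comp (measurable_pi_apply i)
          rw [lintegral_add_left measurable_const, lintegral_const, measure_univ, mul_one,
            lintegral_const_mul _ (Finset.measurable_sum _ fun i _ => hm i),
            lintegral_finsetSum _ fun i _ => hm i]
          congr 2
          refine Finset.sum_congr rfl fun i _ => ?_
          exact (measurePreserving_eval (fun _ : Fin (n + 1) => μ) i).lintegral_comp hg2m
      _ ≤ ENNReal.ofReal (2 * (1 + h) ^ 2 * (ρ ^ 2 * F)) + ENNReal.ofReal (2 * (1 + h) ^ 2)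
            * ∑ i : Fin (n + 1), ENNReal.ofReal V := by gcongr
      _ = _ := by
          have h1 : ((n : ℝ≥0∞) + 1) = ENNReal.ofReal ((n : ℝ) + 1) := by
            rw [ENNReal.ofReal_add (Nat.cast_nonneg n) zero_le_one]; simp
          rw [Finset.sum_const, Finset.card_univ, Fintype.card_fin, nsmul_eq_mul, Nat.cast_add,
            Nat.cast_one, h1, ← ENNReal.ofReal_mul (by positivity),
            ← ENNReal.ofReal_mul (by positivity), ← ENNReal.ofReal_mul (by positivity),
            ← ENNReal.ofReal_add (by positivity) (by positivity)]
          congr 1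
          field_simp
  have hfin : ∫⁻ Y, term 0 Y ∂Q ≤
      ENNReal.ofReal (2 * (1 + h) ^ 2 * (ρ ^ 2 * F / (n + 1) + V)) := by
    refine (ENNReal.mul_le_mul_iff_right ?_ ?_).1 htot
    · simp
    · exact ENNReal.add_ne_top.2 ⟨ENNReal.natCast_ne_top n, ENNReal.one_ne_top⟩
  -- the fresh input becomes the input with index `0` of the enlarged sample
  refine le_trans ?_ hfin
  have hmp := (measurePreserving_piFinSuccAbove (fun _ : Fin (n + 1) => μ) 0).symm
  rw [← hmp.lintegral_comp_emb (MeasurableEquiv.measurableEmbedding _) (term 0),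
    lintegral_prod_symm' (fun z => term 0 ((MeasurableEquiv.piFinSuccAbove (fun _ => Ω) 0).symm z))
      ((hterm_meas 0).comp (MeasurableEquiv.measurable _))]
  refine lintegral_mono fun X => lintegral_mono fun ω => ?_
  rw [Set.indicator_apply]
  split_ifs with hp
  swap
  · exact zero_le
  obtain ⟨hp1, hp2⟩ := hp
  have h1 : (MeasurableEquiv.piFinSuccAbove (fun _ : Fin (n + 1) => Ω) 0).symm (ω, X)
      = (Fin.cons ω X : Fin (n + 1) → Ω) := by
    ext i
    simp [MeasurableEquiv.piFinSuccAbove]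
  simp only [h1] at *
  set Y : Fin (n + 1) → Ω := Fin.cons ω X with hY
  have htail : Fin.tail (Z ∘ Y) = Z ∘ X := by
    ext i; simp [Fin.tail, hY]
  have hY0 : (Z ∘ Y) 0 = Z ω := by simp [hY]
  have hl := inner_ridgeRes_nonneg hρ (Z ∘ X) (Z ω)
  have h00 := ridgeGram_inv_zero_zero hρ (Z ∘ Y)
  rw [htail, hY0] at h00
  have h00' : (A Y 0 0)⁻¹ = ρ * (1 + inner ℝ (Z ω) (ridgeRes ρ n (Z ∘ X) (Z ω))) := by
    rw [hA]
    simp only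
    rw [h00, inv_inv]
  have hcond : 0 ≤ (A Y 0 0)⁻¹ ∧ (A Y 0 0)⁻¹ ≤ ρ * (1 + h) ∧
      ∑ j, (A Y *ᵥ (g1 ∘ Y)) j ^ 2 ≤ F := by
    rw [h00']
    refine ⟨by positivity, mul_le_mul_of_nonneg_left (by linarith) hρ.le, ?_⟩
    have h5 := sum_sq_ridgeGram_inv_inner_le hρ (Z ∘ Y) t
    have h6 := inner_ridgeRes_succ_le hρ (Z ∘ Y) t
    rw [htail] at h6
    exact h5.trans (h6.trans hp2)
  simp only [hterm, if_pos hcond]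
  refine ENNReal.ofReal_le_ofReal (le_of_eq ?_)
  have h7 := ridgeGram_inv_succ hρ (Z ∘ Y) (g ∘ Y)
  have htail' : Fin.tail (g ∘ Y) = g ∘ X := by
    ext i; simp [Fin.tail, hY]
  rw [htail, hY0, htail'] at h7
  rw [h00', ← h7, ridgeResid]
  have h8 : (g ∘ Y) 0 = g ω := by simp [hY]
  rw [h8]
  simp only [Function.comp_apply]
  ring

/-- High-probability bound for the squared error restricted to typical inputs.  It fails only if
some sample is not typical, if the trace of `B ^ (m + 1)` is large, or if the squared error is large
although the resolvent is under control; each of these has probability at most `δ / 3`. -/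
theorem measure_lintegral_ridgeResid_le [IsProbabilityMeasure μ]
    (hM : FeatureModel μ Z b S ρ d H) (hρ : 0 < ρ) (hd : 0 ≤ d) (hH : 0 ≤ H) {n : ℕ} {τ : ℝ}
    (hτ : 0 < τ) {V : ℝ} (hV : 0 < V) {g : Ω → ℝ} (hg : Measurable g) (u : ι → ℝ)
    (hgV : ∫⁻ ω, ENNReal.ofReal ((g ω - inner ℝ (Z ω) (∑ l, u l • b l)) ^ 2) ∂μ
      ≤ ENNReal.ofReal V) {δ : ℝ} (hδ : 0 < δ) (hS : n * μ Sᶜ ≤ ENNReal.ofReal (δ / 3)) (m : ℕ)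
    (hφ : ∫ X in allIn S n, (resMat ρ b (Z ∘ X) ^ (m + 1)).trace ∂(Measure.pi fun _ : Fin n => μ)
      ≤ δ / 3 * τ ^ (m + 1)) :
    (Measure.pi fun _ : Fin n => μ) {X | ¬ ∫⁻ ω in S, ENNReal.ofReal (ridgeResid Z ρ g X ω ^ 2) ∂μ
      ≤ ENNReal.ofReal (3 / δ * (2 * (1 + (2 * H + 2 * d * τ)) ^ 2 *
          (ρ ^ 2 * (τ * (u ⬝ᵥ u)) / (n + 1) + V)))} ≤ ENNReal.ofReal δ := by
  classical
  set P := Measure.pi fun _ : Fin n => μ with hP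
  have huu : 0 ≤ u ⬝ᵥ u := Finset.sum_nonneg fun i _ => mul_self_nonneg _
  set h := 2 * H + 2 * d * τ with hh
  have hh0 : 0 ≤ h := by positivity
  set F := τ * (u ⬝ᵥ u) with hF
  have hF0 : 0 ≤ F := mul_nonneg hτ.le huu
  set D := 2 * (1 + h) ^ 2 * (ρ ^ 2 * F / (n + 1) + V) with hD
  have hD0 : 0 < D := by positivity
  set φ : (Fin n → Ω) → ℝ := fun X => (resMat ρ b (Z ∘ X) ^ (m + 1)).trace with hφd
  have hφm : Measurable φ := measurable_trace_pow (fun l m => hM.measurable_resMat l m) _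
  have hφ0 : ∀ X, 0 ≤ φ X := fun X => trace_pow_nonneg (resMat_posSemidef hρ b _) _
  set W : Set ((Fin n → Ω) × Ω) := {p | inner ℝ (Z p.2) (ridgeRes ρ n (Z ∘ p.1) (Z p.2)) ≤ h ∧
        inner ℝ (∑ l, u l • b l) (ridgeRes ρ n (Z ∘ p.1) (∑ l, u l • b l)) ≤ F} with hW
  have hWm : MeasurableSet W :=
    MeasurableSet.inter (measurableSet_le hM.measurable_leverage measurable_const)
      (measurableSet_le ((hM.measurable_quad u).comp measurable_fst) measurable_const)
  set I : (Fin n → Ω) → ℝ≥0∞ := fun X => ∫⁻ ω, W.indicator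
    (fun p => ENNReal.ofReal (ridgeResid Z ρ g p.1 p.2 ^ 2)) (X, ω) ∂μ with hI
  have hIm : Measurable I :=
    Measurable.lintegral_prod_right'
      (((hM.measurable_ridgeResid hg).pow_const 2).ennreal_ofReal.indicator hWm)
  have hIle : ∫⁻ X, I X ∂P ≤ ENNReal.ofReal D :=
    hM.lintegral_ridgeResid_le hρ n hh0 hF0 hV.le hg u hgV
  have hsub : {X | ¬ ∫⁻ ω in S, ENNReal.ofReal (ridgeResid Z ρ g X ω ^ 2) ∂μ
      ≤ ENNReal.ofReal (3 / δ * D)} ⊆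
      (⋃ i : Fin n, (fun X : Fin n → Ω => X i) ⁻¹' Sᶜ) ∪
        ({X | X ∈ allIn S n ∧ τ ^ (m + 1) ≤ φ X} ∪ {X | ENNReal.ofReal (3 / δ * D) ≤ I X}) := by
    intro X hX
    by_cases h1 : X ∈ allIn S n
    · right
      by_cases h2 : τ ^ (m + 1) ≤ φ X
      · exact Or.inl ⟨h1, h2⟩
      · right
        push Not at h2
        refine (not_le.1 hX).le.trans ?_
        rw [← lintegral_indicator hM.measurableSet]
        refine lintegral_mono fun ω => ?_
        rw [Set.indicator_apply]
        split_ifs with hω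
        swap
        · exact zero_le
        have h3 : (X, ω) ∈ W := by
          refine ⟨hM.leverage_le hρ (Z ∘ X) (Nat.succ_ne_zero m) hτ.le h2.le hω, ?_⟩
          rw [← dotProduct_resMat_mulVec]
          exact dotProduct_mulVec_le_of_trace_pow_le (resMat_posSemidef hρ b _)
            (Nat.succ_ne_zero m) hτ.le h2.le u
        rw [Set.indicator_of_mem h3]
    · left
      rw [allIn, Set.mem_ofPred_eq, not_forall] at h1
      obtain ⟨i, hi⟩ := h1
      exact Set.mem_iUnion.2 ⟨i, hi⟩
  refine (measure_mono hsub).trans ((measure_union_le _ _).trans ?_)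
  have e1 : P (⋃ i : Fin n, (fun X : Fin n → Ω => X i) ⁻¹' Sᶜ) ≤ ENNReal.ofReal (δ / 3) := by
    refine (measure_iUnion_fintype_le _ _).trans (le_trans (le_of_eq ?_) hS)
    have : ∀ i : Fin n, P ((fun X : Fin n → Ω => X i) ⁻¹' Sᶜ) = μ Sᶜ := fun i =>
      (measurePreserving_eval (fun _ : Fin n => μ) i).measure_preimage
        hM.measurableSet.compl.nullMeasurableSet
    rw [Finset.sum_congr rfl fun i _ => this i]
    simp
  have e2 : P {X | X ∈ allIn S n ∧ τ ^ (m + 1) ≤ φ X} ≤ ENNReal.ofReal (δ / 3) := by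
    have hφi : Integrable φ P := by
      refine Integrable.of_bound hφm.aestronglyMeasurable (((∑ l, ‖b l‖ ^ 2) / ρ) ^ (m + 1))
        (Eventually.of_forall fun X => ?_)
      rw [Real.norm_of_nonneg (hφ0 X)]
      exact trace_resMat_pow_le hρ b _ m
    have h1 := mul_meas_ge_le_integral_of_nonneg (μ := P.restrict (allIn S n))
      (Eventually.of_forall hφ0) hφi.integrableOn (τ ^ (m + 1))
    have h2 : (P.restrict (allIn S n)).real {X | τ ^ (m + 1) ≤ φ X} ≤ δ / 3 := by
      have h3 := h1.trans hφ
      have h4 : 0 < τ ^ (m + 1) := by positivity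
      nlinarith
    rw [measureReal_restrict_apply (measurableSet_le measurable_const hφm)] at h2
    have h5 : {X | X ∈ allIn S n ∧ τ ^ (m + 1) ≤ φ X} = {X | τ ^ (m + 1) ≤ φ X} ∩ allIn S n := by
      ext X; simp [and_comm]
    rw [h5, ← ofReal_measureReal]
    exact ENNReal.ofReal_le_ofReal h2
  have e3 : P {X | ENNReal.ofReal (3 / δ * D) ≤ I X} ≤ ENNReal.ofReal (δ / 3) := by
    have h0 : 0 < 3 / δ * D := by positivity
    refine (meas_ge_le_lintegral_div hIm.aemeasurable (by simpa using h0)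
      ENNReal.ofReal_ne_top).trans ?_
    refine ENNReal.div_le_of_le_mul (hIle.trans (le_of_eq ?_))
    rw [← ENNReal.ofReal_mul (by positivity)]
    congr 1
    field_simp
  calc _ ≤ ENNReal.ofReal (δ / 3) + (ENNReal.ofReal (δ / 3) + ENNReal.ofReal (δ / 3)) :=
        add_le_add e1 ((measure_union_le _ _).trans (add_le_add e2 e3))
    _ = ENNReal.ofReal δ := by
        rw [← ENNReal.ofReal_add (by positivity) (by positivity),
          ← ENNReal.ofReal_add (by positivity) (by positivity)]
        congr 1
        ring

end FeatureModel

end LeaveOneOut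

/-! ### The linear functionals `featureDot` -/

section FeatureDot

variable {p : ℕ∞} {μ : Measure (Idx p → ℝ)} {lam : Idx p → ℝ}

theorem inner_coordL2 (h : IsFeatureLaw μ lam) (k l : Idx p) :
    inner ℝ (coordL2 μ k) (coordL2 μ l) = ∫ x, x k * x l ∂μ := by
  rw [MeasureTheory.L2.inner_def]
  apply integral_congr_ae
  simp only [coordL2, h.memLp, dif_pos]
  filter_upwards [(h.memLp k).coeFn_toLp, (h.memLp l).coeFn_toLp] with x h1 h2
  rw [h1, h2]
  simp [mul_comm]

theorem coeFn_coordL2 (h : IsFeatureLaw μ lam) (k : Idx p) :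
    (coordL2 μ k : (Idx p → ℝ) → ℝ) =ᵐ[μ] fun x => x k := by
  simp only [coordL2, h.memLp, dif_pos]
  exact (h.memLp k).coeFn_toLp

theorem inner_tsum_coordL2 (h : IsFeatureLaw μ lam) {v : Idx p → ℝ}
    (hv : Summable fun k => lam k * v k ^ 2) (k : Idx p) :
    inner ℝ (coordL2 μ k) (∑' l, v l • coordL2 μ l) = lam k * v k := by
  have h1 := ((summable_coordL2 h hv).hasSum).mapL (innerSL ℝ (coordL2 μ k))
  have h2 : HasSum (fun l => innerSL ℝ (coordL2 μ k) (v l • coordL2 μ l)) (lam k * v k) := by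
    have h3 := hasSum_single (f := fun l => innerSL ℝ (coordL2 μ k) (v l • coordL2 μ l)) k
      (fun l hl => by
        rw [innerSL_apply_apply, inner_smul_right, inner_coordL2 h, h.offDiag k l hl.symm,
          mul_zero])
    simpa only [innerSL_apply_apply, inner_smul_right, inner_coordL2 h, h.diag,
      mul_comm (v k)] using h3
  exact h1.unique h2

theorem hasSum_norm_sq_tsum_coordL2 (h : IsFeatureLaw μ lam) {v : Idx p → ℝ}
    (hv : Summable fun k => lam k * v k ^ 2) :
    HasSum (fun k => lam k * v k ^ 2) (‖∑' l, v l • coordL2 μ l‖ ^ 2) := by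
  have h1 := ((summable_coordL2 h hv).hasSum).mapL (innerSL ℝ (∑' l, v l • coordL2 μ l))
  rw [innerSL_apply_apply, real_inner_self_eq_norm_sq] at h1
  refine h1.congr_fun fun k => ?_
  rw [innerSL_apply_apply, inner_smul_right, real_inner_comm, inner_tsum_coordL2 h hv]
  ring

theorem memLp_featureDot (v : Idx p → ℝ) : MemLp (featureDot μ v) 2 μ := Lp.memLp _

theorem measurable_featureDot (v : Idx p → ℝ) : Measurable (featureDot μ v) :=
  (Lp.stronglyMeasurable _).measurable

theorem integral_featureDot_sq (h : IsFeatureLaw μ lam) {v : Idx p → ℝ}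
    (hv : Summable fun k => lam k * v k ^ 2) :
    ∫ x, featureDot μ v x ^ 2 ∂μ = ∑' k, lam k * v k ^ 2 := by
  rw [(hasSum_norm_sq_tsum_coordL2 h hv).tsum_eq, ← real_inner_self_eq_norm_sq, L2.inner_def]
  refine integral_congr_ae (Eventually.of_forall fun x => ?_)
  simp [featureDot, sq]

theorem featureDot_sub (h : IsFeatureLaw μ lam) {v w : Idx p → ℝ}
    (hv : Summable fun k => lam k * v k ^ 2) (hw : Summable fun k => lam k * w k ^ 2) :
    featureDot μ (v - w) =ᵐ[μ] fun x => featureDot μ v x - featureDot μ w x := by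
  have h1 : ∑' k, (v - w) k • coordL2 μ k
      = ∑' k, v k • coordL2 μ k - ∑' k, w k • coordL2 μ k := by
    rw [← (summable_coordL2 h hv).tsum_sub (summable_coordL2 h hw)]
    exact tsum_congr fun k => by rw [Pi.sub_apply, sub_smul]
  rw [featureDot, h1]
  exact Lp.coeFn_sub _ _

theorem summable_lam_mul_sub_sq (h : IsFeatureLaw μ lam) {v w : Idx p → ℝ}
    (hv : Summable fun k => lam k * v k ^ 2) (hw : Summable fun k => lam k * w k ^ 2) :
    Summable fun k => lam k * (v - w) k ^ 2 := by
  refine Summable.of_nonneg_of_le (fun k => mul_nonneg (h.pos k).le (sq_nonneg _)) (fun k => ?_)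
    ((hv.mul_left 2).add (hw.mul_left 2))
  have h1 := (h.pos k).le
  rw [Pi.sub_apply]
  nlinarith [mul_nonneg h1 (sq_nonneg (v k + w k))]

theorem lintegral_featureDot_sq (v : Idx p → ℝ) :
    ∫⁻ x, ENNReal.ofReal (featureDot μ v x ^ 2) ∂μ
      = ENNReal.ofReal (∫ x, featureDot μ v x ^ 2 ∂μ) :=
  (ofReal_integral_eq_lintegral_ofReal (memLp_featureDot v).integrable_sq
    (Eventually.of_forall fun _ => sq_nonneg _)).symm

end FeatureDot

/-! ### Feature vectors as elements of `ℓ²` -/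

section FeatureVec

variable {p : ℕ∞} {μ : Measure (Idx p → ℝ)} {lam : Idx p → ℝ}

/-- The Hilbert space `ℓ²` on the index set of the features. -/
abbrev SeqSpace (p : ℕ∞) : Type := lp (fun _ : Idx p => ℝ) 2

open Classical in
/-- The feature vector `x` as an element of `ℓ²`; vectors of infinite norm, a null event under a
feature law of finite trace, are sent to `0`. -/
def featureVec {p : ℕ∞} (x : Idx p → ℝ) : SeqSpace p :=
  if h : Memℓp x 2 then ⟨x, h⟩ else 0

theorem memℓp_two_iff {x : Idx p → ℝ} : Memℓp x 2 ↔ Summable fun l => x l ^ 2 := by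
  rw [memℓp_gen_iff (by norm_num)]
  simp

theorem memℓp_two_iff_tsum {x : Idx p → ℝ} :
    Memℓp x 2 ↔ ∑' l, ENNReal.ofReal (x l ^ 2) < ∞ := by
  rw [memℓp_two_iff]
  refine ⟨fun h => h.tsum_ofReal_lt_top, fun h => ?_⟩
  have := ENNReal.summable_toReal h.ne
  simpa only [ENNReal.toReal_ofReal (sq_nonneg _)] using this

theorem featureVec_apply {x : Idx p → ℝ} (h : Memℓp x 2) (l : Idx p) : featureVec x l = x l := by
  simp [featureVec, h]

theorem measurable_tsum_sq :
    Measurable fun x : Idx p → ℝ => ∑' l, ENNReal.ofReal (x l ^ 2) :=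
  Measurable.tsum fun l => ((measurable_pi_apply l).pow_const 2).ennreal_ofReal

theorem measurableSet_memℓp : MeasurableSet {x : Idx p → ℝ | Memℓp x 2} := by
  simp only [memℓp_two_iff_tsum]
  exact measurableSet_lt measurable_tsum_sq measurable_const

theorem measurable_featureVec_apply (l : Idx p) :
    Measurable fun x : Idx p → ℝ => featureVec x l := by
  classical
  have : (fun x : Idx p → ℝ => featureVec x l) = fun x => if Memℓp x 2 then x l else 0 := by
    ext x
    by_cases h : Memℓp x 2
    · rw [featureVec_apply h, if_pos h]
    · simp [featureVec, h]
  rw [this]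
  exact Measurable.ite measurableSet_memℓp (measurable_pi_apply l) measurable_const

theorem inner_seqSpace (f g : SeqSpace p) : inner ℝ f g = ∑' l, f l * g l := by
  rw [lp.inner_eq_tsum]
  exact tsum_congr fun l => by simp [mul_comm]

theorem norm_sq_seqSpace (f : SeqSpace p) : ‖f‖ ^ 2 = ∑' l, f l ^ 2 := by
  rw [← real_inner_self_eq_norm_sq, inner_seqSpace]
  exact tsum_congr fun l => (sq _).symm

theorem summable_seqSpace (f : SeqSpace p) : Summable fun l => f l ^ 2 :=
  memℓp_two_iff.1 (lp.memℓp f)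

/-- A feature vector has finite norm, since `E ‖x‖² = tr Σ`. -/
theorem ae_memℓp (h : IsFeatureLaw μ lam) (hs : Summable lam) : ∀ᵐ x ∂μ, Memℓp x 2 := by
  have h1 : ∫⁻ x, ∑' l, ENNReal.ofReal (x l ^ 2) ∂μ = ∑' l, ENNReal.ofReal (lam l) := by
    rw [lintegral_tsum fun l => ((measurable_pi_apply l).pow_const 2).ennreal_ofReal.aemeasurable]
    refine tsum_congr fun l => ?_
    rw [← ofReal_integral_eq_lintegral_ofReal (h.memLp l).integrable_sq
      (Eventually.of_forall fun _ => sq_nonneg _), ← h.diag l]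
    simp only [sq]
  have h2 := ae_lt_top measurable_tsum_sq (by rw [h1]; exact hs.tsum_ofReal_ne_top)
  filter_upwards [h2] with x hx
  exact memℓp_two_iff_tsum.2 hx

theorem summable_lam_mul_sq (h : IsFeatureLaw μ lam) (hs : Summable lam) (f : SeqSpace p) :
    Summable fun l => lam l * f l ^ 2 := by
  refine Summable.of_nonneg_of_le (fun l => mul_nonneg (h.pos l).le (sq_nonneg _)) (fun l => ?_)
    ((summable_seqSpace f).mul_left (∑' l, lam l))
  exact mul_le_mul_of_nonneg_right (hs.le_tsum l fun k _ => (h.pos k).le) (sq_nonneg _)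

/-- For coefficients in `ℓ²` the `L²`-series `featureDot` converges pointwise almost everywhere. -/
theorem featureDot_ae_eq_inner (h : IsFeatureLaw μ lam) (hs : Summable lam) (f : SeqSpace p) :
    featureDot μ (fun l => f l) =ᵐ[μ] fun x => inner ℝ (featureVec x) f := by
  have h1 := (summable_coordL2 h (summable_lam_mul_sq h hs f)).hasSum
  obtain ⟨ns, hns, hlim⟩ := (tendstoInMeasure_of_tendsto_Lp h1).exists_seq_tendsto_ae'
  have h2 : ∀ᵐ x ∂μ, ∀ i, (∑ l ∈ ns i, f l • coordL2 μ l : Lp ℝ 2 μ) x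
      = ∑ l ∈ ns i, f l * x l := by
    rw [ae_all_iff]
    intro i
    have h3 : ∀ᵐ x ∂μ, ∀ l : Idx p, (f l • coordL2 μ l : Lp ℝ 2 μ) x = f l * x l := by
      rw [ae_all_iff]
      intro l
      filter_upwards [Lp.coeFn_smul (f l) (coordL2 μ l), coeFn_coordL2 h l] with x hx1 hx2
      rw [hx1, Pi.smul_apply, hx2, smul_eq_mul]
    filter_upwards [Lp.coeFn_finsetSum (ns i) fun l => f l • coordL2 μ l, h3] with x hx1 hx2
    rw [hx1, Finset.sum_apply]
    exact Finset.sum_congr rfl fun l _ => hx2 l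
  filter_upwards [hlim, h2, ae_memℓp h hs] with x hx1 hx2 hx3
  have h4 : HasSum (fun l => f l * x l) (inner ℝ (featureVec x) f) := by
    refine (lp.hasSum_inner (𝕜 := ℝ) (featureVec x) f).congr_fun fun l => ?_
    rw [featureVec_apply hx3]
    simp
  have h5 : Tendsto (fun i => ∑ l ∈ ns i, f l * x l) atTop
      (𝓝 (inner ℝ (featureVec x) f)) := by
    have h6 : Tendsto (fun s : Finset (Idx p) => ∑ l ∈ s, f l * x l) atTop
      (𝓝 (inner ℝ (featureVec x) f)) := h4
    exact h6.comp hns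
  refine tendsto_nhds_unique hx1 (h5.congr fun i => ?_)
  exact (hx2 i).symm

open Classical in
/-- The indices of the first `k` features. -/
def headIdx (p : ℕ∞) (k : ℕ) : Finset (Idx p) :=
  (Finset.range k).subtype fun l : ℕ => (l : ℕ∞) < p

theorem mem_headIdx {k : ℕ} {l : Idx p} : l ∈ headIdx p k ↔ l.1 < k := by
  simp [headIdx]

theorem card_headIdx_le (p : ℕ∞) (k : ℕ) : (headIdx p k).card ≤ k := by
  have h := Finset.card_le_card_of_injOn (s := headIdx p k) (t := Finset.range k)
    (fun l => l.1) (fun l hl => by simpa using mem_headIdx.1 hl)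
    (fun a _ b _ hab => Subtype.ext hab)
  simpa using h

open Classical in
/-- The scaled coordinate vectors `√λ_l e_l`, for the first `k` features. -/
def headVec (lam : Idx p → ℝ) (k : ℕ) (l : headIdx p k) : SeqSpace p :=
  Real.sqrt (lam l) • lp.single 2 (l : Idx p) (1 : ℝ)

theorem inner_headVec_left (k : ℕ) (l : headIdx p k) (f : SeqSpace p) :
    inner ℝ (headVec lam k l) f = Real.sqrt (lam l) * f l := by
  classical
  rw [headVec, inner_smul_left, lp.inner_single_left]
  simp

theorem norm_sq_headVec (h : IsFeatureLaw μ lam) (k : ℕ) (l : headIdx p k) :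
    ‖headVec lam k l‖ ^ 2 = lam l := by
  classical
  rw [← real_inner_self_eq_norm_sq, inner_headVec_left, headVec]
  simp [Real.mul_self_sqrt (h.pos l).le]

theorem sum_headVec_apply (k : ℕ) (u : headIdx p k → ℝ) (m : Idx p) :
    (∑ l, u l • headVec lam k l : SeqSpace p) m
      = if h : m ∈ headIdx p k then u ⟨m, h⟩ * Real.sqrt (lam m) else 0 := by
  classical
  rw [lp.coeFn_sum, Finset.sum_apply]
  have h1 : ∀ l : headIdx p k, (u l • headVec lam k l : SeqSpace p) m
      = if (l : Idx p) = m then u l * Real.sqrt (lam l) else 0 := by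
    intro l
    rw [headVec, smul_smul, lp.coeFn_smul, Pi.smul_apply, smul_eq_mul]
    split_ifs with hlm
    · subst hlm
      rw [lp.single_apply_self, mul_one]
    · rw [lp.single_apply_ne _ _ _ (fun h => hlm h.symm), mul_zero]
  rw [Finset.sum_congr rfl fun l _ => h1 l]
  split_ifs with hm
  · rw [Finset.sum_eq_single ⟨m, hm⟩]
    · simp
    · intro l _ hl
      exact if_neg fun h => hl (Subtype.ext h)
    · simp
  · refine Finset.sum_eq_zero fun l _ => if_neg fun h => hm ?_
    rw [← h]
    exact l.2

/-- The inputs whose whitened head has squared norm at most `d` and whose tail has squared norm at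
most `s`. -/
def typicalSet (lam : Idx p → ℝ) (k : ℕ) (d s : ℝ) : Set (Idx p → ℝ) :=
  {x | headSq lam k x ≤ ENNReal.ofReal d ∧ tailSq lam 1 k x ≤ ENNReal.ofReal s}

theorem measurable_whiten (l : Idx p) : Measurable fun x : Idx p → ℝ => whiten lam x l :=
  (measurable_pi_apply l).div_const _

theorem measurable_headSq (k : ℕ) : Measurable (headSq lam k) := by
  refine Measurable.tsum fun l => ?_
  split_ifs
  · exact ((measurable_whiten l).pow_const 2).ennreal_ofReal
  · exact measurable_const

theorem measurable_tailSq (q k : ℕ) : Measurable (tailSq lam q k) := by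
  refine Measurable.tsum fun l => ?_
  split_ifs
  · exact (((measurable_whiten l).pow_const 2).const_mul _).ennreal_ofReal
  · exact measurable_const

theorem measurableSet_typicalSet (k : ℕ) (d s : ℝ) : MeasurableSet (typicalSet lam k d s) :=
  (measurableSet_le (measurable_headSq k) measurable_const).inter
    (measurableSet_le (measurable_tailSq 1 k) measurable_const)

theorem lam_mul_whiten_sq (h : IsFeatureLaw μ lam) (x : Idx p → ℝ) (l : Idx p) :
    lam l * whiten lam x l ^ 2 = x l ^ 2 := by
  rw [whiten, div_pow, Real.sq_sqrt (h.pos l).le, mul_div_cancel₀ _ (h.pos l).ne']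

theorem headSq_eq_sum (k : ℕ) (x : Idx p → ℝ) :
    headSq lam k x = ENNReal.ofReal (∑ l : headIdx p k, whiten lam x l ^ 2) := by
  classical
  rw [headSq, tsum_eq_sum (s := headIdx p k), ENNReal.ofReal_sum_of_nonneg fun _ _ => sq_nonneg _,
    ← Finset.sum_coe_sort]
  · exact Finset.sum_congr rfl fun l _ => if_pos (mem_headIdx.1 l.2)
  · intro l hl
    exact if_neg fun h => hl (mem_headIdx.2 h)

/-- The whitened head and the tail of a typical input.  The tail is finite, so the input is in `ℓ²`
and `featureVec` does not take its default value. -/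
theorem decomp_of_mem_typicalSet (h : IsFeatureLaw μ lam) {k : ℕ} {d s : ℝ} (hd : 0 ≤ d)
    (hs : 0 ≤ s) {x : Idx p → ℝ} (hx : x ∈ typicalSet lam k d s) :
    ∃ z : headIdx p k → ℝ, z ⬝ᵥ z ≤ d ∧
      ‖featureVec x - ∑ l : headIdx p k, z l • headVec lam k l‖ ^ 2 ≤ s := by
  classical
  obtain ⟨h1, h2⟩ := hx
  have hsum : Memℓp x 2 := by
    rw [memℓp_two_iff_tsum]
    have h3 : ∑' l, ENNReal.ofReal (x l ^ 2)
        ≤ (∑' l : Idx p, if l.1 < k then ENNReal.ofReal (x l ^ 2) else 0) + tailSq lam 1 k x := by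
      rw [tailSq, ← ENNReal.tsum_add]
      refine ENNReal.tsum_le_tsum fun l => ?_
      rw [pow_one, lam_mul_whiten_sq h]
      rcases lt_or_ge l.1 k with hl | hl
      · simp [hl]
      · simp [hl]
    refine h3.trans_lt (ENNReal.add_lt_top.2 ⟨?_, h2.trans_lt ENNReal.ofReal_lt_top⟩)
    rw [tsum_eq_sum (s := headIdx p k)
      (fun l hl => if_neg fun h => hl (mem_headIdx.2 h))]
    refine ENNReal.sum_lt_top.2 fun l _ => ?_
    split_ifs
    · exact ENNReal.ofReal_lt_top
    · exact ENNReal.zero_lt_top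
  refine ⟨fun l => whiten lam x l, ?_, ?_⟩
  · rw [headSq_eq_sum, ENNReal.ofReal_le_ofReal_iff hd] at h1
    simpa [dotProduct, sq] using h1
  · rw [norm_sq_seqSpace]
    have h3 : ∀ m, (featureVec x - ∑ l : headIdx p k, whiten lam x l • headVec lam k l :
        SeqSpace p) m = if k ≤ m.1 then x m else 0 := by
      intro m
      rw [lp.coeFn_sub, Pi.sub_apply, featureVec_apply hsum,
        sum_headVec_apply k (fun l : headIdx p k => whiten lam x l)]
      rcases lt_or_ge m.1 k with hm | hm
      · have hs := (Real.sqrt_pos.2 (h.pos m)).ne'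
        rw [dif_pos (mem_headIdx.2 hm), if_neg (not_le.2 hm), whiten, div_mul_cancel₀ _ hs,
          sub_self]
      · rw [dif_neg fun hh => not_lt.2 hm (mem_headIdx.1 hh), if_pos hm, sub_zero]
    have h4 := summable_seqSpace
      (featureVec x - ∑ l : headIdx p k, whiten lam x l • headVec lam k l : SeqSpace p)
    rw [← ENNReal.ofReal_le_ofReal_iff hs, ENNReal.ofReal_tsum_of_nonneg (fun _ => sq_nonneg _) h4]
    refine le_trans (ENNReal.tsum_le_tsum fun m => ?_) h2
    rw [h3, pow_one, lam_mul_whiten_sq h]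
    split_ifs <;> simp

/-- Restricting to `S` loses at most half of the second moment of any linear functional. -/
def RetainsHalf (μ : Measure (Idx p → ℝ)) (lam : Idx p → ℝ) (S : Set (Idx p → ℝ)) : Prop :=
  ∀ v : Idx p → ℝ, (Summable fun k => lam k * v k ^ 2) →
    ∫⁻ x, ENNReal.ofReal (featureDot μ v x ^ 2) ∂μ
      ≤ 2 * ∫⁻ x in S, ENNReal.ofReal (featureDot μ v x ^ 2) ∂μ

theorem RetainsHalf.tsum_le {S : Set (Idx p → ℝ)} (hhalf : RetainsHalf μ lam S)
    (h : IsFeatureLaw μ lam) {v : Idx p → ℝ} (hv : Summable fun k => lam k * v k ^ 2) :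
    ∑' k, lam k * v k ^ 2 ≤ 2 * ∫ x in S, featureDot μ v x ^ 2 ∂μ := by
  have h1 := hhalf v hv
  rw [lintegral_featureDot_sq, ← ofReal_integral_eq_lintegral_ofReal
    (memLp_featureDot v).integrable_sq.integrableOn
    (Eventually.of_forall fun _ => sq_nonneg _), ← ENNReal.ofReal_ofNat,
    ← ENNReal.ofReal_mul zero_le_two, ENNReal.ofReal_le_ofReal_iff
      (mul_nonneg zero_le_two (integral_nonneg fun _ => sq_nonneg _)),
    integral_featureDot_sq h hv] at h1
  exact h1

/-- The features of the problem fit the abstract model, with the orthogonal head directions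
`√λ_l e_l`. -/
theorem featureModel (h : IsFeatureLaw μ lam) (hs : Summable lam) {k : ℕ} {d s ρ H : ℝ}
    (hd : 0 ≤ d) (hs0 : 0 ≤ s) (hsH : s ≤ ρ * H)
    (hhalf : RetainsHalf μ lam (typicalSet lam k d s)) :
    FeatureModel μ featureVec (headVec lam k) (typicalSet lam k d s) ρ d H where
  measurableSet := measurableSet_typicalSet k d s
  measurable_kernel := by
    simp only [inner_seqSpace]
    exact Measurable.tsum fun l => ((measurable_featureVec_apply l).comp measurable_fst).mul
      ((measurable_featureVec_apply l).comp measurable_snd)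
  measurable_head l := by
    simp only [real_inner_comm (headVec lam k l), inner_headVec_left]
    exact (measurable_featureVec_apply _).const_mul _
  memLp v := (memLp_congr_ae (featureDot_ae_eq_inner h hs v)).1 (memLp_featureDot _)
  lower v := by
    have hsum := summable_lam_mul_sq h hs v
    have h1 := hhalf.tsum_le h hsum
    have h2 : ∫ x in typicalSet lam k d s, inner ℝ (featureVec x) v ^ 2 ∂μ
        = ∫ x in typicalSet lam k d s, featureDot μ (fun l => v l) x ^ 2 ∂μ := by
      refine integral_congr_ae (ae_restrict_of_ae ?_)
      filter_upwards [featureDot_ae_eq_inner h hs v] with x hx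
      rw [hx]
    have h3 : ∑ l : headIdx p k, inner ℝ (headVec lam k l) v ^ 2 ≤ ∑' l, lam l * v l ^ 2 := by
      simp only [inner_headVec_left, mul_pow, Real.sq_sqrt (h.pos _).le]
      rw [Finset.sum_coe_sort (headIdx p k) fun l => lam l * v l ^ 2]
      exact hsum.sum_le_tsum _ fun l _ => mul_nonneg (h.pos l).le (sq_nonneg _)
    rw [h2]
    linarith
  decomp x hx := by
    obtain ⟨z, hz1, hz2⟩ := decomp_of_mem_typicalSet h hd hs0 hx
    exact ⟨z, hz1, hz2.trans hsH⟩

/-! ### From kernel ridge regression to the bias -/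

theorem gram_eq {n : ℕ} {X : Fin n → Idx p → ℝ} (hX : ∀ i, Memℓp (X i) 2) (ρ : ℝ) :
    gram X + ρ • (1 : Matrix (Fin n) (Fin n) ℝ) = ridgeGram ρ (featureVec ∘ X) := by
  rw [ridgeGram]
  congr 1
  ext i j
  simp only [gram, Matrix.of_apply, Function.comp_apply, inner_seqSpace, featureVec_apply (hX _)]

/-- The prediction error is a linear functional of the fresh input, so the bias is at most twice the
squared error of kernel ridge regression over typical inputs. -/
theorem bias_le_lintegral_ridgeResid (h : IsFeatureLaw μ lam) (hs : Summable lam)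
    {θ : Idx p → ℝ} (hθ : Summable fun k => lam k * θ k ^ 2) {S : Set (Idx p → ℝ)}
    (hhalf : RetainsHalf μ lam S) {n : ℕ} (ridge : ℝ) {X : Fin n → Idx p → ℝ}
    (hX : ∀ i, Memℓp (X i) 2) :
    bias μ θ ridge X ≤ 2 * ∫⁻ x in S,
      ENNReal.ofReal (ridgeResid featureVec ((n : ℝ) * ridge) (featureDot μ θ) X x ^ 2) ∂μ := by
  set α := (ridgeGram ((n : ℝ) * ridge) (featureVec ∘ X))⁻¹ *ᵥ (featureDot μ θ ∘ X) with hα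
  set f : SeqSpace p := ∑ i, α i • featureVec (X i) with hf
  have hreg : ridgeRegressor X ridge (fun i => featureDot μ θ (X i)) = fun l => f l := by
    ext l
    rw [hf, lp.coeFn_sum, Finset.sum_apply]
    simp only [ridgeRegressor, gram_eq hX]
    refine Finset.sum_congr rfl fun i _ => ?_
    rw [lp.coeFn_smul, Pi.smul_apply, featureVec_apply (hX i), smul_eq_mul, mul_comm]
    rfl
  have hfs := summable_lam_mul_sq h hs f
  have h1 := featureDot_sub h hfs hθ
  have h2 : ∀ᵐ x ∂μ, featureDot μ ((fun l => f l) - θ) x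
      = ridgeResid featureVec ((n : ℝ) * ridge) (featureDot μ θ) X x := by
    filter_upwards [h1, featureDot_ae_eq_inner h hs f] with x hx1 hx2
    rw [hx1, hx2, hf, inner_sum, ridgeResid]
    congr 1
    exact Finset.sum_congr rfl fun i _ => by rw [inner_smul_right]
  have h3 : bias μ θ ridge X
      = ∫⁻ x, ENNReal.ofReal (featureDot μ ((fun l => f l) - θ) x ^ 2) ∂μ := by
    rw [bias, hreg]
    refine lintegral_congr_ae ?_
    filter_upwards [h1] with x hx
    rw [hx]
  rw [h3]
  refine (hhalf _ (summable_lam_mul_sub_sq h hfs hθ)).trans (le_of_eq ?_)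
  congr 1
  refine lintegral_congr_ae (ae_restrict_of_ae ?_)
  filter_upwards [h2] with x hx
  rw [hx]

/-- Finite-sample bound for the bias, with the parameters of the truncation left free. -/
theorem measure_bias_le (h : IsFeatureLaw μ lam) (hs : Summable lam)
    {θ : Idx p → ℝ} (hθ : Summable fun k => lam k * θ k ^ 2) {n : ℕ} {ridge : ℝ}
    (hρ : 0 < (n : ℝ) * ridge) {k : ℕ} {d s H : ℝ} (hd : 0 ≤ d) (hs0 : 0 ≤ s) (hH : 0 ≤ H)
    (hsH : s ≤ n * ridge * H) (hhalf : RetainsHalf μ lam (typicalSet lam k d s))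
    {δ : ℝ} (hδ : 0 < δ)
    (hS : n * μ (typicalSet lam k d s)ᶜ ≤ ENNReal.ofReal (δ / 3))
    {U V Λ τ τ₀ : ℝ} (hτ₀ : 0 < τ₀) (hτ : 0 < τ) (hV : 0 < V)
    (hUle : ∑ l ∈ headIdx p k, θ l ^ 2 / lam l ≤ U)
    (hVle : ∑' l : Idx p, (if k ≤ l.1 then lam l * θ l ^ 2 else 0) ≤ V)
    (hΛ : ∑' l, lam l ≤ Λ) {m : ℕ} (hm : 2 * k ≤ 2 ^ (m + 1))
    (hκ : (8 * ((1 + 2 * H) / τ₀ + 2 * d))⁻¹ ≤ 1)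
    (hdecay : (1 - (8 * ((1 + 2 * H) / τ₀ + 2 * d))⁻¹) ^ n * (Λ / (n * ridge)) ^ (m + 1)
        + τ₀ ^ (m + 1) ≤ δ / 3 * τ ^ (m + 1)) :
    sampleLaw μ n {X | ¬ bias μ θ ridge X ≤ ENNReal.ofReal (2 * (3 / δ *
        (2 * (1 + (2 * H + 2 * d * τ)) ^ 2 *
          ((n * ridge) ^ 2 * (τ * U) / (n + 1) + V))))} ≤ ENNReal.ofReal δ := by
  classical
  have := h.isProb
  have hM := featureModel h hs hd hs0 hsH hhalf
  set u : headIdx p k → ℝ := fun l => θ l / Real.sqrt (lam l) with hu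
  set t : SeqSpace p := ∑ l, u l • headVec lam k l with ht
  have htl : ∀ l, t l = if k ≤ l.1 then 0 else θ l := by
    intro l
    rw [ht, sum_headVec_apply]
    rcases lt_or_ge l.1 k with hl | hl
    · have hs := (Real.sqrt_pos.2 (h.pos l)).ne'
      rw [dif_pos (mem_headIdx.2 hl), if_neg (not_le.2 hl), hu]
      simp only
      rw [div_mul_cancel₀ _ hs]
    · rw [dif_neg fun hh => not_lt.2 hl (mem_headIdx.1 hh), if_pos hl]
  have huu : u ⬝ᵥ u = ∑ l ∈ headIdx p k, θ l ^ 2 / lam l := by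
    rw [← Finset.sum_coe_sort, dotProduct]
    refine Finset.sum_congr rfl fun l _ => ?_
    rw [hu]
    simp only
    rw [div_mul_div_comm, Real.mul_self_sqrt (h.pos l).le, sq]
  have hts := summable_lam_mul_sq h hs t
  have hgV : ∫⁻ x, ENNReal.ofReal ((featureDot μ θ x - inner ℝ (featureVec x) t) ^ 2) ∂μ
      ≤ ENNReal.ofReal V := by
    have h1 : ∫⁻ x, ENNReal.ofReal ((featureDot μ θ x - inner ℝ (featureVec x) t) ^ 2) ∂μ
        = ∫⁻ x, ENNReal.ofReal (featureDot μ (θ - fun l => t l) x ^ 2) ∂μ := by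
      refine lintegral_congr_ae ?_
      filter_upwards [featureDot_sub h hθ hts, featureDot_ae_eq_inner h hs t] with x hx1 hx2
      rw [hx1, hx2]
    rw [h1, lintegral_featureDot_sq, integral_featureDot_sq h (summable_lam_mul_sub_sq h hθ hts)]
    refine ENNReal.ofReal_le_ofReal (le_trans (le_of_eq (tsum_congr fun l => ?_)) hVle)
    rw [Pi.sub_apply, htl]
    split_ifs <;> simp
  have hcard : 2 * Fintype.card (headIdx p k) ≤ 2 ^ (m + 1) := by
    rw [Fintype.card_coe]
    have := card_headIdx_le p k
    omega
  have hb : ∑ l, ‖headVec lam k l‖ ^ 2 ≤ Λ := by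
    simp only [norm_sq_headVec h]
    rw [Finset.sum_coe_sort (headIdx p k) fun l => lam l]
    exact (hs.sum_le_tsum _ fun l _ => (h.pos l).le).trans hΛ
  have hφ := (hM.integral_trace_le hρ hd hH hτ₀ m hcard hκ n).trans (le_trans (by
    gcongr) hdecay)
  have hmain := hM.measure_lintegral_ridgeResid_le hρ hd hH hτ hV (measurable_featureDot θ) u hgV
    hδ hS m hφ
  have hae : ∀ᵐ X ∂(Measure.pi fun _ : Fin n => μ), ∀ i, Memℓp (X i) 2 := by
    rw [ae_all_iff]
    intro i
    exact (measurePreserving_eval (fun _ : Fin n => μ) i).quasiMeasurePreserving.ae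
      (ae_memℓp h hs)
  refine le_trans (measure_mono_ae ?_) hmain
  filter_upwards [hae] with X hX hX1 hX2
  refine hX1 ((bias_le_lintegral_ridgeResid h hs hθ hhalf ridge hX).trans ?_)
  rw [ENNReal.ofReal_mul zero_le_two, ENNReal.ofReal_ofNat]
  refine mul_le_mul_right (hX2.trans (ENNReal.ofReal_le_ofReal ?_)) 2
  rw [huu]
  gcongr

end FeatureVec

/-! ### Power sums -/

section PowerSums

/-- Telescoping bound for the summands of a convergent power series, replacing an integral test. -/
theorem rpow_neg_one_sub_le {e : ℝ} (he : 0 < e) {x : ℝ} (hx : 0 < x) :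
    (x + 1) ^ (-1 - e) ≤ (x ^ (-e) - (x + 1) ^ (-e)) / e := by
  have hx1 : 0 < x + 1 := by positivity
  have h1 : (x + 1) ^ (-1 - e) = (x + 1) ^ (-e) * (x + 1)⁻¹ := by
    rw [← Real.rpow_neg_one (x + 1), ← Real.rpow_add hx1]
    congr 1; ring
  have h2 : x ^ (-e) = (x + 1) ^ (-e) * (x / (x + 1)) ^ (-e) := by
    rw [← Real.mul_rpow hx1.le (by positivity), mul_div_cancel₀ _ hx1.ne']
  have h3 : 1 + e * (x + 1)⁻¹ ≤ (x / (x + 1)) ^ (-e) := by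
    rw [Real.rpow_def_of_pos (by positivity)]
    have h4 : Real.log (x / (x + 1)) ≤ -(x + 1)⁻¹ := by
      refine (Real.log_le_sub_one_of_pos (by positivity)).trans (le_of_eq ?_)
      field_simp
      ring
    have h5 := Real.add_one_le_exp (Real.log (x / (x + 1)) * -e)
    nlinarith
  have h6 : 0 < (x + 1) ^ (-e) := Real.rpow_pos_of_pos hx1 _
  rw [h1, h2, le_div_iff₀ he]
  nlinarith

theorem sum_range_tail_le {e : ℝ} (he : 0 < e) {k : ℕ} (hk : 1 ≤ k) (N : ℕ) :
    ∑ i ∈ Finset.range N, (if k ≤ i then ((i : ℝ) + 1) ^ (-1 - e) else 0)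
      ≤ ((k : ℝ) ^ (-e) - ((max N k : ℕ) : ℝ) ^ (-e)) / e := by
  induction N with
  | zero => simp
  | succ N ih =>
    rw [Finset.sum_range_succ]
    by_cases hN : k ≤ N
    · have h1 := rpow_neg_one_sub_le he (x := N) (by exact_mod_cast (by omega : 0 < N))
      rw [max_eq_left hN] at ih
      rw [if_pos hN, max_eq_left (by omega)]
      push_cast
      rw [div_eq_mul_inv] at *
      linarith
    · rw [if_neg hN, add_zero, max_eq_right (by omega)]
      rwa [max_eq_right (by omega)] at ih

theorem tsum_tail_le {p : ℕ∞} {e A : ℝ} (he : 0 < e) (hA : 0 ≤ A) {k : ℕ} (hk : 1 ≤ k)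
    {f : Idx p → ℝ} (hf : ∀ l, f l ≤ A * ((l.1 : ℝ) + 1) ^ (-1 - e)) :
    ∑' l : Idx p, (if k ≤ l.1 then f l else 0) ≤ A * ((k : ℝ) ^ (-e) / e) := by
  have hk0 : (0 : ℝ) ≤ (k : ℝ) ^ (-e) := Real.rpow_nonneg (Nat.cast_nonneg k) _
  refine tsum_le_of_sum_le' (by positivity) fun s => ?_
  set F : ℕ → ℝ := fun i => if k ≤ i then ((i : ℝ) + 1) ^ (-1 - e) else 0 with hF
  have hF0 : ∀ i, 0 ≤ F i := fun i => by
    simp only [hF]; split_ifs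
    · positivity
    · exact le_rfl
  obtain ⟨N, hN⟩ := Finset.exists_nat_subset_range (s.map ⟨Subtype.val, Subtype.val_injective⟩)
  have h1 : ∑ l ∈ s, F l.1 ≤ ∑ i ∈ Finset.range N, F i := by
    have := Finset.sum_le_sum_of_subset_of_nonneg (f := F) hN fun i _ _ => hF0 i
    rwa [Finset.sum_map] at this
  have h2 := h1.trans (sum_range_tail_le he hk N)
  have h3 : 0 ≤ ((max N k : ℕ) : ℝ) ^ (-e) := Real.rpow_nonneg (Nat.cast_nonneg _) _
  have h4 : ∑ l ∈ s, F l.1 ≤ (k : ℝ) ^ (-e) / e :=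
    h2.trans (div_le_div_of_nonneg_right (by linarith) he.le)
  refine le_trans ?_ (mul_le_mul_of_nonneg_left h4 hA)
  rw [Finset.mul_sum]
  refine Finset.sum_le_sum fun l _ => ?_
  simp only [hF]
  split_ifs
  · exact hf l
  · simp

theorem summable_idx_rpow (p : ℕ∞) {e : ℝ} (he : 0 < e) :
    Summable fun l : Idx p => ((l.1 : ℝ) + 1) ^ (-1 - e) := by
  have h1 : Summable fun i : ℕ => ((i : ℝ) + 1) ^ (-1 - e) := by
    have := (summable_nat_add_iff 1).2 (Real.summable_nat_rpow.2 (by linarith : -1 - e < -1))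
    simpa using this
  exact h1.comp_injective Subtype.val_injective

theorem tsum_idx_rpow_le (p : ℕ∞) {e : ℝ} (he : 0 < e) :
    ∑' l : Idx p, ((l.1 : ℝ) + 1) ^ (-1 - e) ≤ 1 + 1 / e := by
  have h1 := tsum_tail_le (p := p) (k := 1) (A := 1) he zero_le_one le_rfl
    (f := fun l => ((l.1 : ℝ) + 1) ^ (-1 - e)) (fun l => by rw [one_mul])
  have hs := summable_idx_rpow p he
  have h2 : ∑' l : Idx p, ((l.1 : ℝ) + 1) ^ (-1 - e)
      ≤ ∑' l : Idx p, ((if l.1 < 1 then 1 else 0)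
        + if 1 ≤ l.1 then ((l.1 : ℝ) + 1) ^ (-1 - e) else 0) := by
    refine hs.tsum_le_tsum (fun l => ?_) (Summable.add ?_ ?_)
    · rcases Nat.lt_or_ge l.1 1 with hl | hl
      · have : l.1 = 0 := by omega
        simp [this]
      · rw [if_pos hl, if_neg (by omega), zero_add]
    · refine summable_of_ne_finset_zero (s := headIdx p 1) fun l hl => if_neg fun h => hl ?_
      exact mem_headIdx.2 h
    · refine Summable.of_nonneg_of_le (fun l => ?_) (fun l => ?_) hs
      · split_ifs
        · positivity
        · exact le_rfl
      · split_ifs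
        · exact le_rfl
        · positivity
  have hs1 : Summable fun l : Idx p => if l.1 < 1 then (1 : ℝ) else 0 :=
    summable_of_ne_finset_zero (s := headIdx p 1) fun l hl => if_neg fun h =>
      hl (mem_headIdx.2 h)
  have hs2 : Summable fun l : Idx p => if 1 ≤ l.1 then ((l.1 : ℝ) + 1) ^ (-1 - e) else 0 := by
    refine Summable.of_nonneg_of_le (fun l => ?_) (fun l => ?_) hs
    · split_ifs
      · positivity
      · exact le_rfl
    · split_ifs
      · exact le_rfl
      · positivity
  rw [hs1.tsum_add hs2] at h2
  have h3 : ∑' l : Idx p, (if l.1 < 1 then (1 : ℝ) else 0) ≤ 1 := by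
    rw [tsum_eq_sum (s := headIdx p 1) fun l hl => if_neg fun h => hl (mem_headIdx.2 h)]
    refine (Finset.sum_le_sum fun l hl => (if_pos (mem_headIdx.1 hl)).le).trans ?_
    rw [Finset.sum_const, nsmul_eq_mul, mul_one]
    exact_mod_cast card_headIdx_le p 1
  simp only [Nat.cast_one, Real.one_rpow, one_mul] at h1
  linarith

/-- The logarithm is only attained for `e = 0`; for `e < 0` the sum is bounded. -/
theorem sum_headIdx_rpow_le (p : ℕ∞) (e : ℝ) (k : ℕ) :
    ∑ l ∈ headIdx p k, ((l.1 : ℝ) + 1) ^ (e - 1)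
      ≤ (k : ℝ) ^ (max 0 e) * (1 + Real.log k) := by
  have h1 : ∑ l ∈ headIdx p k, ((l.1 : ℝ) + 1) ^ (e - 1)
      ≤ ∑ i ∈ Finset.range k, (k : ℝ) ^ (max 0 e) * ((i : ℝ) + 1)⁻¹ := by
    have h2 : ∀ i : ℕ, i < k → ((i : ℝ) + 1) ^ (e - 1)
        ≤ (k : ℝ) ^ (max 0 e) * ((i : ℝ) + 1)⁻¹ := by
      intro i hi
      have hi0 : (0 : ℝ) < (i : ℝ) + 1 := by positivity
      rw [Real.rpow_sub_one hi0.ne', div_eq_mul_inv]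
      refine mul_le_mul_of_nonneg_right ?_ (by positivity)
      refine (Real.rpow_le_rpow_of_exponent_le (by linarith [(Nat.cast_nonneg i : (0 : ℝ) ≤ i)])
        (le_max_right 0 e)).trans ?_
      exact Real.rpow_le_rpow hi0.le (by exact_mod_cast hi) (le_max_left 0 e)
    have h3 : ∑ l ∈ headIdx p k, (k : ℝ) ^ (max 0 e) * ((l.1 : ℝ) + 1)⁻¹
        = ∑ i ∈ (headIdx p k).map ⟨Subtype.val, Subtype.val_injective⟩,
          (k : ℝ) ^ (max 0 e) * ((i : ℝ) + 1)⁻¹ := by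
      rw [Finset.sum_map]; rfl
    refine (Finset.sum_le_sum fun l hl => h2 l.1 (mem_headIdx.1 hl)).trans (h3.le.trans ?_)
    refine Finset.sum_le_sum_of_subset_of_nonneg ?_ fun i _ _ => by positivity
    intro i hi
    obtain ⟨l, hl, rfl⟩ := Finset.mem_map.1 hi
    exact Finset.mem_range.2 (mem_headIdx.1 hl)
  refine h1.trans ?_
  rw [← Finset.mul_sum]
  refine mul_le_mul_of_nonneg_left ?_ (Real.rpow_nonneg (Nat.cast_nonneg k) _)
  have h4 := harmonic_le_one_add_log k
  rw [harmonic] at h4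
  push_cast at h4
  exact h4

end PowerSums

/-! ### Choice of the truncation level and rates -/

section Rates

variable {p : ℕ∞} {μ : Measure (Idx p → ℝ)} {lam θ : Idx p → ℝ}

theorem PolyEigenDecay.summable (h : IsFeatureLaw μ lam) {a c C : ℝ} (ha : 0 < a)
    (hl : PolyEigenDecay lam a c C) : Summable lam :=
  Summable.of_nonneg_of_le (fun k => (h.pos k).le) (fun k => (hl k).2)
    ((summable_idx_rpow p ha).mul_left C)

theorem PolyTarget.sq_le {r C : ℝ} (hθ : PolyTarget θ r C) (l : Idx p) :
    θ l ^ 2 ≤ C ^ 2 * ((l.1 : ℝ) + 1) ^ (-2 * r) := by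
  have h0 : (0 : ℝ) ≤ (l.1 : ℝ) + 1 := by positivity
  have h1 := pow_le_pow_left₀ (abs_nonneg _) (hθ l) 2
  rw [sq_abs, mul_pow, ← Real.rpow_natCast (((l.1 : ℝ) + 1) ^ (-r)) 2, ← Real.rpow_mul h0] at h1
  have h2 : -2 * r = -r * ((2 : ℕ) : ℝ) := by push_cast; ring
  rwa [h2]

theorem lam_mul_sq_le (h : IsFeatureLaw μ lam) {a r c C : ℝ} (hl : PolyEigenDecay lam a c C)
    (hθ : PolyTarget θ r C) (l : Idx p) :
    lam l * θ l ^ 2 ≤ C ^ 3 * ((l.1 : ℝ) + 1) ^ (-1 - (a + 2 * r)) := by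
  have h0 : (0 : ℝ) < (l.1 : ℝ) + 1 := by positivity
  refine (mul_le_mul (hl l).2 (hθ.sq_le l) (sq_nonneg _) ((h.pos l).le.trans (hl l).2)).trans
    (le_of_eq ?_)
  have : (-1 - (a + 2 * r)) = (-1 - a) + (-2 * r) := by ring
  rw [this, Real.rpow_add h0]
  ring

theorem sq_div_lam_le {a r c C : ℝ} (hc : 0 < c)
    (hl : PolyEigenDecay lam a c C) (hθ : PolyTarget θ r C) (l : Idx p) :
    θ l ^ 2 / lam l ≤ C ^ 2 / c * ((l.1 : ℝ) + 1) ^ ((2 + a - 2 * r) - 1) := by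
  have h0 : (0 : ℝ) < (l.1 : ℝ) + 1 := by positivity
  have h1 : 0 < c * ((l.1 : ℝ) + 1) ^ (-1 - a) := by positivity
  refine (div_le_div₀ (by positivity) (hθ.sq_le l) h1 (hl l).1).trans (le_of_eq ?_)
  have : (2 + a - 2 * r) - 1 = (-2 * r) - (-1 - a) := by ring
  rw [this, Real.rpow_sub h0 (-2 * r) (-1 - a), mul_div_mul_comm]

/-- The truncation level `k ≈ n ^ (b / (1 + a))`, at which `λ_k` is of the order of the ridge; the
logarithm keeps it below `n / log⁴ n` even when `b = 1 + a`. -/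
def cutoff (a b : ℝ) (n : ℕ) : ℕ := ⌊(n : ℝ) ^ (b / (1 + a)) / Real.log n ^ 4⌋₊

theorem tailTrace_toReal_le (h : IsFeatureLaw μ lam) {a c C : ℝ} (ha : 0 < a) (hC : 0 < C)
    (hl : PolyEigenDecay lam a c C) {k : ℕ} (hk : 1 ≤ k) :
    (tailTrace lam 1 k).toReal ≤ C * ((k : ℝ) ^ (-a) / a) := by
  have hs := hl.summable h ha
  have hk0 : (0 : ℝ) ≤ (k : ℝ) ^ (-a) := Real.rpow_nonneg (Nat.cast_nonneg k) _
  refine ENNReal.toReal_le_of_le_ofReal (by positivity) ?_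
  have h1 : tailTrace lam 1 k = ENNReal.ofReal (∑' l : Idx p, if k ≤ l.1 then lam l else 0) := by
    rw [ENNReal.ofReal_tsum_of_nonneg, tailTrace]
    · refine tsum_congr fun l => ?_
      split_ifs <;> simp
    · intro l
      split_ifs
      · exact (h.pos l).le
      · exact le_rfl
    · refine Summable.of_nonneg_of_le (fun l => ?_) (fun l => ?_) hs
      · split_ifs
        · exact (h.pos l).le
        · exact le_rfl
      · split_ifs
        · exact le_rfl
        · exact (h.pos l).le
  rw [h1]
  exact ENNReal.ofReal_le_ofReal (tsum_tail_le ha hC.le hk fun l => (hl l).2)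

theorem tailTrace_ne_top (h : IsFeatureLaw μ lam) {a c C : ℝ} (ha : 0 < a)
    (hl : PolyEigenDecay lam a c C) (k : ℕ) : tailTrace lam 1 k ≠ ∞ := by
  refine ne_top_of_le_ne_top (hl.summable h ha).tsum_ofReal_ne_top
    (ENNReal.tsum_le_tsum fun l => ?_)
  split_ifs
  · rw [pow_one]
  · exact zero_le

/-- The typical inputs at sample size `n`: the squared norms of the whitened head and of the tail
are at most `T` times their means, with the number of head features replaced by its upper bound. -/
def goodSet (lam : Idx p → ℝ) (a b T : ℝ) (n : ℕ) : Set (Idx p → ℝ) :=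
  typicalSet lam (cutoff a b n) (T * cutoff a b n) (T * (tailTrace lam 1 (cutoff a b n)).toReal)

theorem eventually_log_pow_le {s : ℝ} (hs : 0 < s) (A : ℝ) (m : ℕ) :
    ∀ᶠ n : ℕ in atTop, A * Real.log n ^ m ≤ (n : ℝ) ^ s := by
  have h1 := (isLittleO_log_rpow_rpow_atTop (m : ℝ) hs).comp_tendsto tendsto_natCast_atTop_atTop
  have h2 := h1.bound (c := (|A| + 1)⁻¹) (by positivity)
  filter_upwards [h2, eventually_ge_atTop 1] with n hn hn1
  have hL : 0 ≤ Real.log n := Real.log_nonneg (by exact_mod_cast hn1)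
  simp only [Function.comp_apply, Real.rpow_natCast] at hn
  rw [Real.norm_of_nonneg (by positivity), Real.norm_of_nonneg (by positivity),
    inv_mul_eq_div, le_div_iff₀ (by positivity)] at hn
  have : 0 ≤ Real.log n ^ m := by positivity
  nlinarith [le_abs_self A]

theorem cutoff_bounds {a b : ℝ} {n : ℕ} (hL : 1 ≤ Real.log n)
    (h2 : 2 * Real.log n ^ 4 ≤ (n : ℝ) ^ (b / (1 + a))) :
    1 ≤ cutoff a b n ∧ (n : ℝ) ^ (b / (1 + a)) / (2 * Real.log n ^ 4) ≤ cutoff a b n ∧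
      (cutoff a b n : ℝ) ≤ (n : ℝ) ^ (b / (1 + a)) / Real.log n ^ 4 := by
  have hL4 : 0 < Real.log n ^ 4 := by positivity
  set x := (n : ℝ) ^ (b / (1 + a)) / Real.log n ^ 4 with hx
  have hx2 : 2 ≤ x := by rwa [hx, le_div_iff₀ hL4]
  have h3 : x < cutoff a b n + 1 := Nat.lt_floor_add_one x
  have h4 : (n : ℝ) ^ (b / (1 + a)) / (2 * Real.log n ^ 4) = x / 2 := by
    rw [hx]; field_simp
  refine ⟨Nat.le_floor (by push_cast; linarith), ?_, Nat.floor_le (by linarith)⟩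
  rw [h4]
  linarith

theorem cutoff_rpow_neg_le {a b e : ℝ} (he : 0 < e) {N : ℕ} (hN : e ≤ N) {n : ℕ} (hn : 0 < n)
    (hL : 1 ≤ Real.log n) (h2 : 2 * Real.log n ^ 4 ≤ (n : ℝ) ^ (b / (1 + a))) :
    (cutoff a b n : ℝ) ^ (-e)
      ≤ 2 ^ N * Real.log n ^ (4 * N) * (n : ℝ) ^ (-(b / (1 + a) * e)) := by
  obtain ⟨-, h3, -⟩ := cutoff_bounds hL h2
  have hn0 : (0 : ℝ) < n := by exact_mod_cast hn
  have hx : 0 < (n : ℝ) ^ (b / (1 + a)) := Real.rpow_pos_of_pos hn0 _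
  have hy : 1 ≤ 2 * Real.log n ^ 4 := by nlinarith [one_le_pow₀ hL (n := 4)]
  refine (Real.rpow_le_rpow_of_nonpos (by positivity) h3 (by linarith)).trans ?_
  rw [Real.div_rpow hx.le (by positivity), ← Real.rpow_mul hn0.le, mul_neg, div_eq_mul_inv,
    ← Real.rpow_neg (by positivity), neg_neg, mul_comm]
  refine mul_le_mul_of_nonneg_right ?_ (by positivity)
  refine (Real.rpow_le_rpow_of_exponent_le hy hN).trans (le_of_eq ?_)
  rw [Real.rpow_natCast, mul_pow, ← pow_mul]

end Rates

/-! ### The rate of the bias -/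

section MainEstimate

/-- Contraction at rate `κ ≥ L ^ 3 / (q₀ n)` over `n` steps beats a polynomial initial value, raised
to a power of order `L = log n`. -/
theorem one_sub_pow_mul_pow_le {n q : ℕ} (hn : 0 < n) {κ q₀ b x : ℝ} (hq₀ : 0 < q₀) (hb : 0 ≤ b)
    (hκ1 : κ ≤ 1) (hκ : Real.log n ^ 3 / (q₀ * n) ≤ κ) (hL : 1 ≤ Real.log n)
    (hq : (q : ℝ) ≤ 4 * Real.log n) (hx0 : 0 ≤ x) (hx : x ≤ (n : ℝ) ^ b)
    (hLb : 4 * b * q₀ ≤ Real.log n) : (1 - κ) ^ n * x ^ q ≤ 1 := by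
  have hn0 : (0 : ℝ) < n := by exact_mod_cast hn
  set L := Real.log n with hLdef
  have h1 : (1 - κ) ^ n ≤ Real.exp (-(L ^ 3 / q₀)) := by
    have h2 : (1 - κ) ≤ Real.exp (-κ) := by linarith [Real.add_one_le_exp (-κ)]
    refine (pow_le_pow_left₀ (sub_nonneg.2 hκ1) h2 n).trans ?_
    rw [← Real.exp_nat_mul]
    refine Real.exp_le_exp.2 ?_
    have h3 := mul_le_mul_of_nonneg_left hκ hn0.le
    have h4 : (n : ℝ) * (L ^ 3 / (q₀ * n)) = L ^ 3 / q₀ := by field_simp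
    linarith
  have h5 : x ^ q ≤ Real.exp (4 * b * L ^ 2) := by
    refine (pow_le_pow_left₀ hx0 hx q).trans ?_
    rw [Real.rpow_def_of_pos hn0, ← Real.exp_nat_mul]
    refine Real.exp_le_exp.2 ?_
    have h6 : 0 ≤ L * b := by positivity
    have := mul_le_mul_of_nonneg_right hq h6
    rw [← hLdef]
    nlinarith
  calc (1 - κ) ^ n * x ^ q ≤ Real.exp (-(L ^ 3 / q₀)) * Real.exp (4 * b * L ^ 2) :=
        mul_le_mul h1 h5 (by positivity) (by positivity)
    _ = Real.exp (-(L ^ 3 / q₀) + 4 * b * L ^ 2) := (Real.exp_add _ _).symm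
    _ ≤ 1 := by
        rw [Real.exp_le_one_iff]
        have : 4 * b * L ^ 2 ≤ L ^ 3 / q₀ := by
          rw [le_div_iff₀ hq₀]
          nlinarith [sq_nonneg L]
        linarith

/-- The exponent of the head term `ridge² ∑_{l ≤ k} θ_l² / λ_l`, which produces the saturation at
`2 * b`. -/
theorem rate_exponent_le {a r b : ℝ} (ha : 0 < a) (hb : 0 < b) :
    -2 * b + b / (1 + a) * max 0 (2 + a - 2 * r)
      ≤ -(min ((2 * r + a) / (1 + a)) 2 * b) := by
  have h1 : 0 < 1 + a := by linarith
  rcases le_total (2 + a - 2 * r) 0 with h | h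
  · rw [max_eq_left h]
    have := mul_le_mul_of_nonneg_right (min_le_right ((2 * r + a) / (1 + a)) 2) hb.le
    linarith
  · rw [max_eq_right h]
    have := mul_le_mul_of_nonneg_right (min_le_left ((2 * r + a) / (1 + a)) 2) hb.le
    have h2 : b / (1 + a) * (2 + a - 2 * r) = 2 * b - (2 * r + a) / (1 + a) * b := by
      field_simp; ring
    linarith

set_option maxHeartbeats 1600000 in
/-- The bound on the bias, given that atypical inputs are rare and carry at most half of the second
moment of any linear functional. -/
theorem exists_bias_bound (a r b δ c C T : ℝ) (ha : 0 < a) (hr : 0 < r) (hb : 0 < b)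
    (hb' : b ≤ 1 + a) (hδ : 0 < δ) (hδ' : δ < 1) (hc : 0 < c) (hC : 0 < C) (hT : 0 < T) :
    ∃ (K : ℝ) (γ : ℕ), ∀ᶠ n : ℕ in atTop,
      ∀ (p : ℕ∞) (μ : Measure (Idx p → ℝ)) (lam θ : Idx p → ℝ) (ridge : ℝ),
        IsFeatureLaw μ lam → PolyEigenDecay lam a c C → PolyTarget θ r C →
        PolyRidge n ridge b c C →
        RetainsHalf μ lam (goodSet lam a b (T * Real.log n) n) →
        n * μ (goodSet lam a b (T * Real.log n) n)ᶜ ≤ ENNReal.ofReal (δ / 3) →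
        sampleLaw μ n {X | ¬ bias μ θ ridge X ≤ ENNReal.ofReal (K * Real.log n ^ γ *
                  (n : ℝ) ^ (-(min ((2 * r + a) / (1 + a)) 2 * b)))} ≤ ENNReal.ofReal δ := by
  set β := b / (1 + a) with hβ
  have hβ0 : 0 < β := by positivity
  have hβ1 : β ≤ 1 := by rw [hβ, div_le_one (by positivity)]; exact hb'
  set e := a + 2 * r with he
  have he0 : 0 < e := by positivity
  set N := ⌈e⌉₊ with hN
  have heN : e ≤ N := Nat.le_ceil e
  have haN : a ≤ N := by linarith
  set M := min ((2 * r + a) / (1 + a)) 2 * b with hM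
  set h₁ := T * C * 2 ^ N / (a * c) with hh₁
  have hh₁0 : 0 < h₁ := by positivity
  set q₀ := 8 * (1 + 2 * h₁ + 2 * T) with hq₀
  have hq₀0 : 0 < q₀ := by positivity
  set v₀ := C ^ 3 * 2 ^ N / e with hv₀
  have hv₀0 : 0 < v₀ := by positivity
  set Λ := C * (1 + 1 / a) with hΛ
  have hΛ0 : 0 < Λ := by positivity
  set h₂ := 1 + 2 * h₁ + 12 * T / δ with hh₂
  refine ⟨2 * (3 / δ * (2 * h₂ ^ 2 * (12 * C ^ 4 / (c * δ) + v₀))),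
    2 * (4 * N + 1) + (4 * N + 5), ?_⟩
  have hlog : Tendsto (fun n : ℕ => Real.log n) atTop atTop :=
    Real.tendsto_log_atTop.comp tendsto_natCast_atTop_atTop
  filter_upwards [hlog.eventually_ge_atTop 1, hlog.eventually_ge_atTop (4 * (b + 1) * q₀),
    eventually_log_pow_le hβ0 2 4, eventually_log_pow_le zero_lt_one 1 (4 * N + 4),
    eventually_gt_atTop 0, tendsto_natCast_atTop_atTop.eventually_ge_atTop (Λ / c)]
    with n hL hLb hL4 hLN hn hΛn
  intro p μ lam θ ridge h hl hθ hridge hhalf hS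
  set L := Real.log n with hLdef
  have hL0 : 0 < L := by linarith
  have hn0 : (0 : ℝ) < n := by exact_mod_cast hn
  have hn1 : (1 : ℝ) ≤ n := by exact_mod_cast hn
  rw [one_mul, Real.rpow_one] at hLN
  obtain ⟨hk1, -, hku⟩ := cutoff_bounds hL hL4
  set k := cutoff a b n with hk
  have hkn : (k : ℝ) ≤ (n : ℝ) ^ β :=
    hku.trans (div_le_self (by positivity) (one_le_pow₀ hL))
  have hnβ : (n : ℝ) ^ β ≤ n := by
    simpa using Real.rpow_le_rpow_of_exponent_le hn1 hβ1
  have hk0 : (1 : ℝ) ≤ k := by exact_mod_cast hk1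
  have hr0 : 0 < ridge := lt_of_lt_of_le (by positivity) hridge.1
  have hρ : 0 < (n : ℝ) * ridge := by positivity
  have hs := hl.summable h ha
  have hθs : Summable fun k => lam k * θ k ^ 2 :=
    Summable.of_nonneg_of_le (fun l => mul_nonneg (h.pos l).le (sq_nonneg _))
      (lam_mul_sq_le h hl hθ) ((summable_idx_rpow p he0).mul_left _)
  set H := h₁ * L ^ (4 * N + 1) with hH
  have hH0 : 0 < H := by positivity
  -- `H` bounds the ratio of the tail to the ridge, `τ₀` is the level to which the trace contracts,
  -- and `τ` is the bound for the head block with the factor lost in Markov's inequality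
  set τ₀ := L ^ (4 * N + 4) / n with hτ₀
  have hτ₀0 : 0 < τ₀ := by positivity
  have hτ₀1 : τ₀ ≤ 1 := by rw [hτ₀, div_le_one hn0]; exact hLN
  set τ := 6 / δ * τ₀ with hτ
  have hτ0 : 0 < τ := by positivity
  set d := T * L * k with hd
  have hd0 : 0 ≤ d := by positivity
  -- the norm of the whitened head stays below the sample size, again as `b ≤ 1 + a`
  have hdle : d ≤ T * n / L ^ 3 := by
    have h1 : (k : ℝ) ≤ n / L ^ 4 := hku.trans (div_le_div_of_nonneg_right hnβ (by positivity))
    calc d ≤ T * L * (n / L ^ 4) := mul_le_mul_of_nonneg_left h1 (by positivity)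
      _ = T * n / L ^ 3 := by field_simp
  -- the tail at the truncation level is at most `n * ridge`, up to logarithms, as `b ≤ 1 + a`
  have htail := tailTrace_toReal_le h ha hC hl hk1
  have hsH : T * L * (tailTrace lam 1 k).toReal ≤ n * ridge * H := by
    have h1 := cutoff_rpow_neg_le ha haN hn hL hL4
    have h2 : (n : ℝ) ^ (-(b / (1 + a) * a)) ≤ n * (n : ℝ) ^ (-b) := by
      have : (n : ℝ) * (n : ℝ) ^ (-b) = (n : ℝ) ^ (1 - b) := by
        rw [sub_eq_add_neg, Real.rpow_add hn0, Real.rpow_one]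
      rw [this]
      refine Real.rpow_le_rpow_of_exponent_le hn1 ?_
      have : b = β + b / (1 + a) * a := by rw [hβ]; field_simp
      linarith
    calc T * L * (tailTrace lam 1 k).toReal
        ≤ T * L * (C * ((2 ^ N * L ^ (4 * N) * (n * (n : ℝ) ^ (-b))) / a)) := by
          refine mul_le_mul_of_nonneg_left (htail.trans ?_) (by positivity)
          refine mul_le_mul_of_nonneg_left (div_le_div_of_nonneg_right ?_ ha.le) hC.le
          exact h1.trans (mul_le_mul_of_nonneg_left h2 (by positivity))
      _ = n * (c * (n : ℝ) ^ (-b)) * H := by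
          rw [hH, hh₁, pow_succ L (4 * N)]
          field_simp
      _ ≤ n * ridge * H := by gcongr; exact hridge.1
  set U := C ^ 2 / c * (2 * L) * (n : ℝ) ^ (β * max 0 (2 + a - 2 * r)) with hU
  have hUle : ∑ l ∈ headIdx p k, θ l ^ 2 / lam l ≤ U := by
    have h1 := sum_headIdx_rpow_le p (2 + a - 2 * r) k
    have h2 : (k : ℝ) ^ (max 0 (2 + a - 2 * r)) ≤ (n : ℝ) ^ (β * max 0 (2 + a - 2 * r)) := by
      rw [Real.rpow_mul hn0.le]
      exact Real.rpow_le_rpow (by positivity) hkn (le_max_left _ _)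
    have h3 : Real.log k ≤ L := Real.log_le_log (by linarith) (hkn.trans hnβ)
    have h4 : 0 ≤ Real.log k := Real.log_nonneg hk0
    calc ∑ l ∈ headIdx p k, θ l ^ 2 / lam l
        ≤ C ^ 2 / c * ∑ l ∈ headIdx p k, ((l.1 : ℝ) + 1) ^ ((2 + a - 2 * r) - 1) := by
          rw [Finset.mul_sum]
          exact Finset.sum_le_sum fun l _ => sq_div_lam_le hc hl hθ l
      _ ≤ C ^ 2 / c * ((n : ℝ) ^ (β * max 0 (2 + a - 2 * r)) * (2 * L)) := by
          refine mul_le_mul_of_nonneg_left (h1.trans ?_) (by positivity)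
          exact mul_le_mul h2 (by linarith) (by linarith) (by positivity)
      _ = U := by rw [hU]; ring
  set V := v₀ * L ^ (4 * N) * (n : ℝ) ^ (-M) with hV
  have hV0 : 0 < V := by positivity
  have hVle : ∑' l : Idx p, (if k ≤ l.1 then lam l * θ l ^ 2 else 0) ≤ V := by
    refine (tsum_tail_le he0 (pow_nonneg hC.le 3) hk1 (lam_mul_sq_le h hl hθ)).trans ?_
    have h1 := cutoff_rpow_neg_le he0 heN hn hL hL4
    have h2 : (n : ℝ) ^ (-(b / (1 + a) * e)) ≤ (n : ℝ) ^ (-M) := by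
      refine Real.rpow_le_rpow_of_exponent_le hn1 ?_
      have h3 := mul_le_mul_of_nonneg_right (min_le_left ((2 * r + a) / (1 + a)) 2) hb.le
      have h4 : b / (1 + a) * e = (2 * r + a) / (1 + a) * b := by rw [he]; field_simp; ring
      rw [h4]
      linarith
    calc C ^ 3 * ((k : ℝ) ^ (-e) / e)
        ≤ C ^ 3 * ((2 ^ N * L ^ (4 * N) * (n : ℝ) ^ (-M)) / e) := by
          refine mul_le_mul_of_nonneg_left (div_le_div_of_nonneg_right ?_ he0.le) (by positivity)
          exact h1.trans (mul_le_mul_of_nonneg_left h2 (by positivity))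
      _ = V := by rw [hV, hv₀]; field_simp
  have hΛle : ∑' l, lam l ≤ Λ := by
    refine (hs.tsum_le_tsum (fun l => (hl l).2) ((summable_idx_rpow p ha).mul_left C)).trans ?_
    rw [tsum_mul_left]
    exact mul_le_mul_of_nonneg_left (tsum_idx_rpow_le p ha) hC.le
  -- with `2 ^ m ≥ n ≥ k` the trace of the power `m + 1` is comparable to the largest eigenvalue
  set m := ⌈2 * L⌉₊ with hm
  have hm2 : 2 * k ≤ 2 ^ (m + 1) := by
    have h1 : (k : ℝ) ≤ 2 ^ m := by
      calc (k : ℝ) ≤ n := hkn.trans hnβ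
        _ = Real.exp L := (Real.exp_log hn0).symm
        _ ≤ Real.exp (Real.log 2 * (2 * L)) :=
            Real.exp_le_exp.2 (by nlinarith [Real.log_two_gt_d9])
        _ = (2 : ℝ) ^ (2 * L) := (Real.rpow_def_of_pos two_pos _).symm
        _ ≤ (2 : ℝ) ^ (m : ℝ) :=
            Real.rpow_le_rpow_of_exponent_le one_le_two (Nat.le_ceil _)
        _ = 2 ^ m := Real.rpow_natCast 2 m
    have h2 : k ≤ 2 ^ m := by exact_mod_cast h1
    rw [pow_succ]
    omega
  have hq : ((m + 1 : ℕ) : ℝ) ≤ 4 * L := by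
    have := Nat.ceil_lt_add_one (by positivity : 0 ≤ 2 * L)
    rw [← hm] at this
    push_cast
    linarith
  have hden0 : 0 < 8 * ((1 + 2 * H) / τ₀ + 2 * d) := by positivity
  have hκ1 : (8 * ((1 + 2 * H) / τ₀ + 2 * d))⁻¹ ≤ 1 := by
    refine inv_le_one_of_one_le₀ ?_
    have : 1 ≤ (1 + 2 * H) / τ₀ := by
      rw [le_div_iff₀ hτ₀0]
      linarith
    linarith
  have hκ : L ^ 3 / (q₀ * n) ≤ (8 * ((1 + 2 * H) / τ₀ + 2 * d))⁻¹ := by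
    rw [le_inv_comm₀ (by positivity) hden0, inv_div]
    have h1 : (1 + 2 * H) / τ₀ ≤ (1 + 2 * h₁) * n / L ^ 3 := by
      have h2 : 1 + 2 * H ≤ (1 + 2 * h₁) * L ^ (4 * N + 1) := by
        have := one_le_pow₀ hL (n := 4 * N + 1)
        rw [hH]
        linarith
      calc (1 + 2 * H) / τ₀ ≤ (1 + 2 * h₁) * L ^ (4 * N + 1) / τ₀ :=
            div_le_div_of_nonneg_right h2 hτ₀0.le
        _ = (1 + 2 * h₁) * n / L ^ 3 := by
            rw [hτ₀, show 4 * N + 4 = (4 * N + 1) + 3 by ring, pow_add L (4 * N + 1) 3]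
            field_simp
    calc 8 * ((1 + 2 * H) / τ₀ + 2 * d)
        ≤ 8 * ((1 + 2 * h₁) * n / L ^ 3 + 2 * (T * n / L ^ 3)) := by linarith
      _ = q₀ * n / L ^ 3 := by rw [hq₀]; ring
  -- `n` contractions at the rate `L ^ 3 / (q₀ * n)` beat the polynomial initial value
  have hdecay : (1 - (8 * ((1 + 2 * H) / τ₀ + 2 * d))⁻¹) ^ n * (Λ / (n * ridge)) ^ (m + 1)
        + τ₀ ^ (m + 1) ≤ δ / 3 * τ ^ (m + 1) := by
    have hx : Λ / (n * ridge) / τ₀ ≤ (n : ℝ) ^ (b + 1) := by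
      calc Λ / (n * ridge) / τ₀ = Λ / (ridge * L ^ (4 * N + 4)) := by
            rw [hτ₀]; field_simp
        _ ≤ Λ / (c * (n : ℝ) ^ (-b)) := by
            refine div_le_div_of_nonneg_left hΛ0.le (by positivity) (hridge.1.trans ?_)
            exact le_mul_of_one_le_right hr0.le (one_le_pow₀ hL)
        _ = Λ / c * (n : ℝ) ^ b := by
            rw [Real.rpow_neg hn0.le]; field_simp
        _ ≤ n * (n : ℝ) ^ b := mul_le_mul_of_nonneg_right hΛn (by positivity)
        _ = (n : ℝ) ^ (b + 1) := by rw [Real.rpow_add hn0, Real.rpow_one, mul_comm]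
    have h1 := one_sub_pow_mul_pow_le hn hq₀0 (by positivity : 0 ≤ b + 1) hκ1 hκ hL hq
      (by positivity) hx hLb
    have h2 := mul_le_mul_of_nonneg_right h1 (pow_nonneg hτ₀0.le (m + 1))
    rw [mul_assoc, ← mul_pow, div_mul_cancel₀ _ hτ₀0.ne', one_mul] at h2
    have h3 : 6 / δ ≤ (6 / δ) ^ (m + 1) :=
      le_self_pow₀ (by rw [le_div_iff₀ hδ]; linarith) (Nat.succ_ne_zero m)
    have h4 : 2 * τ₀ ^ (m + 1) ≤ δ / 3 * τ ^ (m + 1) := by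
      rw [hτ, mul_pow, ← mul_assoc]
      refine mul_le_mul_of_nonneg_right ?_ (by positivity)
      calc (2 : ℝ) = δ / 3 * (6 / δ) := by field_simp; norm_num
        _ ≤ _ := mul_le_mul_of_nonneg_left h3 (by positivity)
    linarith
  have hmain := measure_bias_le h hs hθs hρ hd0 (by positivity) hH0.le hsH hhalf hδ hS hτ₀0 hτ0
    hV0 hUle hVle hΛle hm2 hκ1 hdecay
  refine le_trans (measure_mono ?_) hmain
  intro X hX hX2
  refine hX (hX2.trans (ENNReal.ofReal_le_ofReal ?_))
  have hlev : 1 + (2 * H + 2 * d * τ) ≤ h₂ * L ^ (4 * N + 1) := by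
    have h1 := one_le_pow₀ hL (n := 4 * N + 1)
    have h2 : 2 * d * τ ≤ 12 * T / δ * L ^ (4 * N + 1) := by
      calc 2 * d * τ ≤ 2 * (T * n / L ^ 3) * τ := by gcongr
        _ = 12 * T / δ * L ^ (4 * N + 1) := by
            rw [hτ, hτ₀, show 4 * N + 4 = (4 * N + 1) + 3 by ring, pow_add L (4 * N + 1) 3]
            field_simp
            norm_num
    rw [hh₂, hH]
    linarith
  have hhead : (n * ridge) ^ 2 * (τ * U) / (n + 1)
      ≤ 12 * C ^ 4 / (c * δ) * L ^ (4 * N + 5) * (n : ℝ) ^ (-M) := by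
    have hU0 : 0 ≤ U := by positivity
    have hexp : (n : ℝ) ^ (-b) * (n : ℝ) ^ (-b) * (n : ℝ) ^ (β * max 0 (2 + a - 2 * r))
        ≤ (n : ℝ) ^ (-M) := by
      rw [← Real.rpow_add hn0, ← Real.rpow_add hn0]
      refine Real.rpow_le_rpow_of_exponent_le hn1 (le_trans (le_of_eq ?_)
        (rate_exponent_le (r := r) ha hb))
      ring
    calc (n * ridge) ^ 2 * (τ * U) / (n + 1)
        ≤ (n * ridge) ^ 2 * (τ * U) / n :=
          div_le_div_of_nonneg_left (by positivity) hn0 (by linarith)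
      _ ≤ (n * (C * (n : ℝ) ^ (-b))) ^ 2 * (τ * U) / n := by gcongr; exact hridge.2
      _ = 12 * C ^ 4 / (c * δ) * L ^ (4 * N + 5) *
          ((n : ℝ) ^ (-b) * (n : ℝ) ^ (-b) * (n : ℝ) ^ (β * max 0 (2 + a - 2 * r))) := by
          rw [hτ, hτ₀, hU, show 4 * N + 5 = (4 * N + 4) + 1 by ring, pow_succ L (4 * N + 4)]
          field_simp
          norm_num
      _ ≤ _ := mul_le_mul_of_nonneg_left hexp (by positivity)
  have hVle' : V ≤ v₀ * L ^ (4 * N + 5) * (n : ℝ) ^ (-M) := by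
    rw [hV]
    gcongr
    omega
  have hlev0 : 0 ≤ 1 + (2 * H + 2 * d * τ) := by positivity
  calc 2 * (3 / δ * (2 * (1 + (2 * H + 2 * d * τ)) ^ 2 *
          ((n * ridge) ^ 2 * (τ * U) / (n + 1) + V)))
      ≤ 2 * (3 / δ * (2 * (h₂ * L ^ (4 * N + 1)) ^ 2 *
          (12 * C ^ 4 / (c * δ) * L ^ (4 * N + 5) * (n : ℝ) ^ (-M)
            + v₀ * L ^ (4 * N + 5) * (n : ℝ) ^ (-M)))) := by gcongr
    _ = _ := by
        rw [pow_add L (2 * (4 * N + 1)), mul_comm 2 (4 * N + 1), pow_mul]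
        ring

end MainEstimate

/-! ### Generic features -/

section Generic

variable {p : ℕ∞} {μ : Measure (Idx p → ℝ)} {lam : Idx p → ℝ}

theorem retainsHalf_of_measure_compl_eq_zero {S : Set (Idx p → ℝ)} (hS : μ Sᶜ = 0) :
    RetainsHalf μ lam S := by
  intro v _
  have h1 : μ.restrict S = μ := Measure.restrict_eq_self_of_ae_mem hS
  rw [h1, two_mul]
  exact le_self_add

theorem GenericFeatures.ae_le {c C : ℝ} (hg : GenericFeatures μ lam c C) {k : ℕ}
    (hk : (k : ℕ∞) < p) (hfin : tailTrace lam 1 k ≠ ∞) :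
    ∀ᵐ x ∂μ, headSq lam k x ≤ ENNReal.ofReal C * k ∧
      tailSq lam 1 k x ≤ ENNReal.ofReal C * tailTrace lam 1 k := by
  filter_upwards [ae_le_essSup (μ := μ) (f := fun x => max (headSq lam k x / (k : ℝ≥0∞))
    (max (tailSq lam 1 k x / tailTrace lam 1 k) (tailSq lam 2 k x / tailTrace lam 2 k)))] with x hx
  have h1 := hx.trans (hg k hk).2.2
  rw [max_le_iff, max_le_iff, ENNReal.div_le_iff_le_mul (Or.inr ENNReal.ofReal_ne_top)
    (Or.inl (ENNReal.natCast_ne_top k)), ENNReal.div_le_iff_le_mul (Or.inr ENNReal.ofReal_ne_top)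
    (Or.inl hfin)] at h1
  exact ⟨h1.1, h1.2.1⟩

/-- When `p = m + 1`, the level `m` of the generic feature condition also controls the last
coordinate, which is all that is left of the tail. -/
theorem headSq_le_of_le_last {m : ℕ} {lam : Idx ((m + 1 : ℕ) : ℕ∞) → ℝ} (hpos : ∀ l, 0 < lam l)
    {C : ℝ} {x : Idx ((m + 1 : ℕ) : ℕ∞) → ℝ} (h1 : headSq lam m x ≤ ENNReal.ofReal C * m)
    (h2 : tailSq lam 1 m x ≤ ENNReal.ofReal C * tailTrace lam 1 m) (k : ℕ) (hk : m + 1 ≤ k) :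
    headSq lam k x ≤ ENNReal.ofReal C * k := by
  set i : Idx ((m + 1 : ℕ) : ℕ∞) := ⟨m, by exact_mod_cast Nat.lt_succ_self m⟩ with hi
  have hlast : ∀ l : Idx ((m + 1 : ℕ) : ℕ∞), m ≤ l.1 → l = i := by
    intro l hl
    have h3 : l.1 < m + 1 := by exact_mod_cast l.2
    have h4 : l.1 = m := by omega
    exact Subtype.ext h4
  have hne : ∀ l : Idx ((m + 1 : ℕ) : ℕ∞), l ≠ i → ¬ m ≤ l.1 := fun l hl h => hl (hlast l h)
  rw [tailSq, tailTrace, tsum_eq_single i fun l hl => if_neg (hne l hl),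
    tsum_eq_single i fun l hl => if_neg (hne l hl), if_pos le_rfl, if_pos le_rfl, pow_one,
    ENNReal.ofReal_mul (hpos i).le, mul_comm (ENNReal.ofReal C)] at h2
  have hi0 : ENNReal.ofReal (lam i) ≠ 0 := (ENNReal.ofReal_pos.2 (hpos i)).ne'
  have h3 := (ENNReal.mul_le_mul_iff_right hi0 ENNReal.ofReal_ne_top).1 h2
  calc headSq lam k x
      ≤ ∑' l : Idx ((m + 1 : ℕ) : ℕ∞), ((if l.1 < m then ENNReal.ofReal (whiten lam x l ^ 2) else 0)
          + (if l = i then ENNReal.ofReal (whiten lam x l ^ 2) else 0)) := by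
        refine ENNReal.tsum_le_tsum fun l => ?_
        by_cases hl : l = i
        · rw [if_pos hl]
          refine le_add_left ?_
          split_ifs <;> simp
        · rw [if_pos (not_le.1 (hne l hl))]
          refine le_add_right ?_
          split_ifs <;> simp
    _ = headSq lam m x + ENNReal.ofReal (whiten lam x i ^ 2) := by
        rw [ENNReal.tsum_add, tsum_ite_eq, headSq]
    _ ≤ ENNReal.ofReal C * m + ENNReal.ofReal C := add_le_add h1 h3
    _ = ENNReal.ofReal C * (m + 1 : ℕ) := by push_cast; ring
    _ ≤ ENNReal.ofReal C * k := by gcongr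

theorem GenericFeatures.measure_compl_typicalSet_eq_zero (h : IsFeatureLaw μ lam) {c C T : ℝ}
    (hg : GenericFeatures μ lam c C) (hfin : ∀ k, tailTrace lam 1 k ≠ ∞) (hC : 0 ≤ C)
    (hT : C ≤ T) (k : ℕ) :
    μ (typicalSet lam k (T * k) (T * (tailTrace lam 1 k).toReal))ᶜ = 0 := by
  have hae : ∀ᵐ x ∂μ, headSq lam k x ≤ ENNReal.ofReal C * k ∧
      tailSq lam 1 k x ≤ ENNReal.ofReal C * tailTrace lam 1 k := by
    rcases lt_or_ge (k : ℕ∞) p with hk | hk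
    · exact hg.ae_le hk (hfin k)
    · lift p to ℕ using ne_top_of_le_ne_top (ENat.natCast_ne_top k) hk
      have hk' : p ≤ k := by exact_mod_cast hk
      have htail : ∀ x, tailSq lam 1 k x = 0 := by
        intro x
        rw [tailSq, ENNReal.tsum_eq_zero]
        intro l
        have h3 : l.1 < p := by exact_mod_cast l.2
        exact if_neg (by omega)
      rcases p with _ | m
      · refine Eventually.of_forall fun x => ⟨?_, by rw [htail]; exact zero_le⟩
        have : headSq lam k x = 0 := by
          rw [headSq, ENNReal.tsum_eq_zero]
          intro l
          exact absurd l.2 (by simp)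
        rw [this]
        exact zero_le
      · filter_upwards [hg.ae_le (by exact_mod_cast Nat.lt_succ_self m) (hfin m)] with x hx
        exact ⟨headSq_le_of_le_last h.pos hx.1 hx.2 k hk', by rw [htail]; exact zero_le⟩
  change ∀ᵐ x ∂μ, x ∈ typicalSet lam k (T * k) (T * (tailTrace lam 1 k).toReal)
  filter_upwards [hae] with x hx
  have hT0 : 0 ≤ T := hC.trans hT
  constructor
  · rw [ENNReal.ofReal_mul hT0, ENNReal.ofReal_natCast]
    exact hx.1.trans (by gcongr)
  · rw [ENNReal.ofReal_mul hT0, ENNReal.ofReal_toReal (hfin k)]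
    exact hx.2.trans (by gcongr)

/-- Under generic features almost every input is typical. -/
theorem exists_bias_bound_of_genericFeatures (a r b δ c C : ℝ) (ha : 0 < a) (hr : 0 < r)
    (hb : 0 < b) (hb' : b ≤ 1 + a) (hδ : 0 < δ) (hδ' : δ < 1) (hc : 0 < c) (hC : 0 < C) :
    ∃ (K : ℝ) (γ : ℕ), ∀ᶠ n : ℕ in atTop,
      ∀ (p : ℕ∞) (μ : Measure (Idx p → ℝ)) (lam θ : Idx p → ℝ) (ridge : ℝ),
        IsFeatureLaw μ lam → PolyEigenDecay lam a c C → PolyTarget θ r C →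
        PolyRidge n ridge b c C → GenericFeatures μ lam c C →
        sampleLaw μ n {X | ¬ bias μ θ ridge X ≤ ENNReal.ofReal (K * Real.log n ^ γ *
                  (n : ℝ) ^ (-(min ((2 * r + a) / (1 + a)) 2 * b)))} ≤ ENNReal.ofReal δ := by
  obtain ⟨K, γ, hK⟩ := exists_bias_bound a r b δ c C C ha hr hb hb' hδ hδ' hc hC hC
  refine ⟨K, γ, ?_⟩
  have hlog : Tendsto (fun n : ℕ => Real.log n) atTop atTop :=
    Real.tendsto_log_atTop.comp tendsto_natCast_atTop_atTop
  filter_upwards [hK, hlog.eventually_ge_atTop 1] with n hn hL p μ lam θ ridge h hl hθ hridge hg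
  have h0 : μ (goodSet lam a b (C * Real.log n) n)ᶜ = 0 :=
    hg.measure_compl_typicalSet_eq_zero h (fun k => tailTrace_ne_top h ha hl k) hC.le
      (le_mul_of_one_le_right hC.le hL) _
  refine hn p μ lam θ ridge h hl hθ hridge (retainsHalf_of_measure_compl_eq_zero h0) ?_
  rw [h0, mul_zero]
  exact zero_le

end Generic

/-! ### Sub-Gaussian random variables -/

section SubGaussian

variable {Ω : Type*} [MeasurableSpace Ω] {P : Measure Ω}

/-- The factor `2` avoids the question whether the infimum in `psiTwoNorm` is attained. -/
theorem lintegral_exp_sq_le_of_psiTwoNorm_le {Y : Ω → ℝ} {G : ℝ} (hG : 0 < G)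
    (hY : psiTwoNorm P Y ≤ ENNReal.ofReal G) :
    ∫⁻ ω, ENNReal.ofReal (Real.exp (Y ω ^ 2 / (2 * G) ^ 2)) ∂P ≤ 2 := by
  have h1 : psiTwoNorm P Y < ENNReal.ofReal (2 * G) :=
    hY.trans_lt ((ENNReal.ofReal_lt_ofReal_iff (by linarith)).2 (by linarith))
  simp only [psiTwoNorm, iInf_lt_iff] at h1
  obtain ⟨t, ht, h2, h3⟩ := h1
  have h4 : t < 2 * G := (ENNReal.ofReal_lt_ofReal_iff (by linarith)).1 h3
  refine (lintegral_mono fun ω => ENNReal.ofReal_le_ofReal (Real.exp_le_exp.2 ?_)).trans h2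
  gcongr

/-- A weighted sum of squares of sub-Gaussian variables, whatever their dependence: by convexity,
the exponential of the normalized sum is at most the average of the exponentials. -/
theorem measure_sum_mul_sq_gt_le {ι : Type*} {s : Finset ι} {w : ι → ℝ} (hw : ∀ i ∈ s, 0 ≤ w i)
    {Z : ι → Ω → ℝ} (hZm : ∀ i, Measurable (Z i)) {σ : ℝ}
    (hZ : ∀ i, ∫⁻ ω, ENNReal.ofReal (Real.exp (Z i ω ^ 2 / σ ^ 2)) ∂P ≤ 2) (hσ : 0 < σ) (t : ℝ) :
    P {ω | t * σ ^ 2 * ∑ i ∈ s, w i < ∑ i ∈ s, w i * Z i ω ^ 2}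
      ≤ ENNReal.ofReal (2 * Real.exp (-t)) := by
  set W := ∑ i ∈ s, w i with hW
  rcases (Finset.sum_nonneg hw).eq_or_lt with h0 | hpos
  · have h1 : ∀ i ∈ s, w i = 0 := (Finset.sum_eq_zero_iff_of_nonneg hw).1 h0.symm
    have h2 : {ω | t * σ ^ 2 * W < ∑ i ∈ s, w i * Z i ω ^ 2} = ∅ := by
      ext ω
      rw [hW, Finset.sum_eq_zero h1, Set.mem_ofPred_eq,
        Finset.sum_eq_zero fun i hi => by rw [h1 i hi, zero_mul]]
      simp
    rw [h2, measure_empty]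
    exact zero_le
  · rw [← hW] at hpos
    set f : Ω → ℝ := fun ω => Real.exp ((∑ i ∈ s, w i * Z i ω ^ 2) / (σ ^ 2 * W)) with hf
    have hfm : Measurable f := by
      refine Real.measurable_exp.comp (Measurable.div_const ?_ _)
      exact Finset.measurable_fun_sum s fun i _ => ((hZm i).pow_const 2).const_mul _
    have hJ : ∀ ω, f ω ≤ ∑ i ∈ s, w i / W * Real.exp (Z i ω ^ 2 / σ ^ 2) := by
      intro ω
      have h1 := convexOn_exp.map_sum_le (t := s) (w := fun i => w i / W)
        (p := fun i => Z i ω ^ 2 / σ ^ 2) (fun i hi => div_nonneg (hw i hi) hpos.le)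
        (by rw [← Finset.sum_div, ← hW, div_self hpos.ne']) (fun i _ => Set.mem_univ _)
      simp only [smul_eq_mul] at h1
      refine le_trans (le_of_eq ?_) h1
      simp only [hf]
      rw [Finset.sum_div]
      congr 1
      refine Finset.sum_congr rfl fun i _ => ?_
      field_simp
    have hint : ∫⁻ ω, ENNReal.ofReal (f ω) ∂P ≤ 2 := by
      calc ∫⁻ ω, ENNReal.ofReal (f ω) ∂P
          ≤ ∫⁻ ω, ∑ i ∈ s, ENNReal.ofReal (w i / W) *
              ENNReal.ofReal (Real.exp (Z i ω ^ 2 / σ ^ 2)) ∂P := by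
            refine lintegral_mono fun ω => (ENNReal.ofReal_le_ofReal (hJ ω)).trans ?_
            rw [ENNReal.ofReal_sum_of_nonneg fun i hi =>
              mul_nonneg (div_nonneg (hw i hi) hpos.le) (Real.exp_nonneg _)]
            exact le_of_eq (Finset.sum_congr rfl fun i hi =>
              ENNReal.ofReal_mul (div_nonneg (hw i hi) hpos.le))
        _ = ∑ i ∈ s, ENNReal.ofReal (w i / W) *
              ∫⁻ ω, ENNReal.ofReal (Real.exp (Z i ω ^ 2 / σ ^ 2)) ∂P := by
            have hm : ∀ i, Measurable fun ω => ENNReal.ofReal (Real.exp (Z i ω ^ 2 / σ ^ 2)) :=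
              fun i => (Real.measurable_exp.comp (((hZm i).pow_const 2).div_const _)).ennreal_ofReal
            rw [lintegral_finsetSum _ fun i _ => (hm i).const_mul _]
            exact Finset.sum_congr rfl fun i _ => lintegral_const_mul _ (hm i)
        _ ≤ ∑ i ∈ s, ENNReal.ofReal (w i / W) * 2 :=
            Finset.sum_le_sum fun i _ => mul_le_mul_right (hZ i) _
        _ = 2 := by
            rw [← Finset.sum_mul, ← ENNReal.ofReal_sum_of_nonneg fun i hi =>
              div_nonneg (hw i hi) hpos.le, ← Finset.sum_div, ← hW, div_self hpos.ne',
              ENNReal.ofReal_one, one_mul]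
    have hmk := (mul_meas_ge_le_lintegral (μ := P) hfm.ennreal_ofReal
      (ENNReal.ofReal (Real.exp t))).trans hint
    have hsub : {ω | t * σ ^ 2 * W < ∑ i ∈ s, w i * Z i ω ^ 2}
        ⊆ {ω | ENNReal.ofReal (Real.exp t) ≤ ENNReal.ofReal (f ω)} := by
      intro ω hω
      refine ENNReal.ofReal_le_ofReal (Real.exp_le_exp.2 ?_)
      rw [le_div_iff₀ (by positivity), ← mul_assoc]
      exact le_of_lt hω
    have he : ENNReal.ofReal (Real.exp t) ≠ 0 := (ENNReal.ofReal_pos.2 (Real.exp_pos t)).ne'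
    refine (measure_mono hsub).trans ?_
    rw [← ENNReal.mul_le_mul_iff_right he ENNReal.ofReal_ne_top]
    refine hmk.trans (le_of_eq ?_)
    rw [← ENNReal.ofReal_mul (Real.exp_nonneg t), mul_left_comm, ← Real.exp_add, add_neg_cancel,
      Real.exp_zero, mul_one, ENNReal.ofReal_ofNat]

theorem pow_four_le_exp {σ : ℝ} (hσ : 0 < σ) (x : ℝ) :
    x ^ 4 ≤ 2 * σ ^ 4 * Real.exp (x ^ 2 / σ ^ 2) := by
  have h1 := Real.quadratic_le_exp_of_nonneg (by positivity : 0 ≤ x ^ 2 / σ ^ 2)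
  have h2 : x ^ 4 = σ ^ 4 * (x ^ 2 / σ ^ 2) ^ 2 := by field_simp
  have h3 : (0 : ℝ) ≤ x ^ 2 / σ ^ 2 := by positivity
  rw [h2]
  have h4 : 0 < σ ^ 4 := by positivity
  nlinarith

theorem lintegral_pow_four_le {Y : Ω → ℝ} {σ : ℝ} (hσ : 0 < σ)
    (hY : ∫⁻ ω, ENNReal.ofReal (Real.exp (Y ω ^ 2 / σ ^ 2)) ∂P ≤ 2) :
    ∫⁻ ω, ENNReal.ofReal (Y ω ^ 4) ∂P ≤ ENNReal.ofReal (4 * σ ^ 4) := by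
  calc ∫⁻ ω, ENNReal.ofReal (Y ω ^ 4) ∂P
      ≤ ∫⁻ ω, ENNReal.ofReal (2 * σ ^ 4) * ENNReal.ofReal (Real.exp (Y ω ^ 2 / σ ^ 2)) ∂P := by
        refine lintegral_mono fun ω => ?_
        rw [← ENNReal.ofReal_mul (by positivity)]
        exact ENNReal.ofReal_le_ofReal (pow_four_le_exp hσ _)
    _ = ENNReal.ofReal (2 * σ ^ 4) * ∫⁻ ω, ENNReal.ofReal (Real.exp (Y ω ^ 2 / σ ^ 2)) ∂P :=
        lintegral_const_mul' _ _ ENNReal.ofReal_ne_top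
    _ ≤ ENNReal.ofReal (2 * σ ^ 4) * 2 := mul_le_mul_right hY _
    _ = ENNReal.ofReal (4 * σ ^ 4) := by
        rw [← ENNReal.ofReal_ofNat 2, ← ENNReal.ofReal_mul (by positivity)]
        congr 1
        ring

end SubGaussian

/-! ### Fourth moments of sums of independent variables -/

section FourthMoment

variable {Ω : Type*} [MeasurableSpace Ω] {P : Measure Ω}

theorem integrable_pow_of_memLp_four [IsFiniteMeasure P] {F : Ω → ℝ} (hF : MemLp F 4 P) {k : ℕ}
    (hk : k ≤ 4) : Integrable (fun ω => F ω ^ k) P := by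
  have h1 : MemLp F k P := hF.mono_exponent (by exact_mod_cast hk)
  refine h1.integrable_norm_pow'.mono (hF.1.pow k) (Eventually.of_forall fun ω => ?_)
  simp

theorem memLp_four_of_lintegral_lt_top {F : Ω → ℝ} (hF : AEStronglyMeasurable F P)
    (h : ∫⁻ ω, ENNReal.ofReal (F ω ^ 4) ∂P < ∞) : MemLp F 4 P := by
  refine ⟨hF, (eLpNorm_lt_top_iff_lintegral_rpow_enorm_lt_top (by norm_num) (by norm_num)).2 ?_⟩
  refine lt_of_le_of_lt (lintegral_mono fun ω => le_of_eq ?_) h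
  rw [Real.enorm_eq_ofReal_abs, ENNReal.ofReal_rpow_of_nonneg (abs_nonneg _) (by norm_num)]
  congr 1
  norm_num
  rw [← abs_pow, abs_of_nonneg (Even.pow_nonneg ⟨2, rfl⟩ _)]

/-- Adding an independent centred variable preserves the comparison of the fourth moment with the
squared second moment. -/
theorem fourth_moment_add_le [IsProbabilityMeasure P] {F Y : Ω → ℝ} (hF : MemLp F 4 P)
    (hY : MemLp Y 4 P) (hFY : F ⟂ᵢ[P] Y) (hY0 : ∫ ω, Y ω ∂P = 0) {B : ℝ} (hB : 0 ≤ B)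
    (hY4 : ∫ ω, Y ω ^ 4 ∂P ≤ B * (∫ ω, Y ω ^ 2 ∂P) ^ 2)
    (hF4 : ∫ ω, F ω ^ 4 ∂P ≤ (4 + 3 * B) * (∫ ω, F ω ^ 2 ∂P) ^ 2) :
    ∫ ω, (F ω + Y ω) ^ 4 ∂P ≤ (4 + 3 * B) * (∫ ω, (F ω + Y ω) ^ 2 ∂P) ^ 2 := by
  have hF' := fun k (hk : k ≤ 4) => integrable_pow_of_memLp_four hF hk
  have hY' := fun k (hk : k ≤ 4) => integrable_pow_of_memLp_four hY hk
  have hI : ∀ i j : ℕ, (fun ω => F ω ^ i) ⟂ᵢ[P] (fun ω => Y ω ^ j) := fun i j =>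
    hFY.comp (φ := fun x : ℝ => x ^ i) (ψ := fun x : ℝ => x ^ j)
      (measurable_id.pow_const i) (measurable_id.pow_const j)
  have hint : ∀ i j : ℕ, i ≤ 4 → j ≤ 4 → Integrable (fun ω => F ω ^ i * Y ω ^ j) P :=
    fun i j hi hj => (hI i j).integrable_mul (hF' i hi) (hY' j hj)
  have hprod : ∀ i j : ℕ, i ≤ 4 → j ≤ 4 →
      ∫ ω, F ω ^ i * Y ω ^ j ∂P = (∫ ω, F ω ^ i ∂P) * ∫ ω, Y ω ^ j ∂P := fun i j hi hj =>
    (hI i j).integral_fun_mul_eq_mul_integral (hF' i hi).1 (hY' j hj).1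
  have h2 : ∫ ω, (F ω + Y ω) ^ 2 ∂P = (∫ ω, F ω ^ 2 ∂P) + ∫ ω, Y ω ^ 2 ∂P := by
    have h1 : ∀ ω, (F ω + Y ω) ^ 2 = F ω ^ 2 + 2 * (F ω ^ 1 * Y ω ^ 1) + Y ω ^ 2 := fun ω => by ring
    simp only [h1]
    rw [integral_add ((hF' 2 (by norm_num)).fun_add
        ((hint 1 1 (by norm_num) (by norm_num)).const_mul 2))
      (hY' 2 (by norm_num)), integral_add (hF' 2 (by norm_num))
      ((hint 1 1 (by norm_num) (by norm_num)).const_mul 2), integral_const_mul,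
      hprod 1 1 (by norm_num) (by norm_num)]
    simp [hY0]
  have h4 : ∫ ω, (F ω + Y ω) ^ 4 ∂P
      ≤ (∫ ω, F ω ^ 4 ∂P) + 8 * ((∫ ω, F ω ^ 2 ∂P) * ∫ ω, Y ω ^ 2 ∂P) + 3 * ∫ ω, Y ω ^ 4 ∂P := by
    have hle : ∀ ω, (F ω + Y ω) ^ 4
        ≤ F ω ^ 4 + 4 * (F ω ^ 3 * Y ω ^ 1) + 8 * (F ω ^ 2 * Y ω ^ 2) + 3 * Y ω ^ 4 := fun ω => by
      nlinarith [sq_nonneg (F ω * Y ω - Y ω ^ 2)]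
    have hi4 := hF' 4 le_rfl
    have hi31 := (hint 3 1 (by norm_num) (by norm_num)).const_mul 4
    have hi22 := (hint 2 2 (by norm_num) (by norm_num)).const_mul 8
    have hj4 := (hY' 4 le_rfl).const_mul 3
    refine (integral_mono_of_nonneg (Eventually.of_forall fun ω => Even.pow_nonneg ⟨2, rfl⟩ _)
      (((hi4.fun_add hi31).fun_add hi22).fun_add hj4) (Eventually.of_forall hle)).trans
      (le_of_eq ?_)
    rw [integral_add ((hi4.fun_add hi31).fun_add hi22) hj4]
    rw [integral_add (hi4.fun_add hi31) hi22]
    rw [integral_add hi4 hi31, integral_const_mul, integral_const_mul, integral_const_mul,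
      hprod 3 1 (by norm_num) (by norm_num), hprod 2 2 (by norm_num) (by norm_num)]
    simp [hY0]
  rw [h2]
  refine h4.trans ?_
  have hF2 : 0 ≤ ∫ ω, F ω ^ 2 ∂P := integral_nonneg fun _ => sq_nonneg _
  have hY2 : 0 ≤ ∫ ω, Y ω ^ 2 ∂P := integral_nonneg fun _ => sq_nonneg _
  nlinarith [mul_nonneg hF2 hY2, mul_nonneg hB (mul_nonneg hF2 hY2), sq_nonneg (∫ ω, Y ω ^ 2 ∂P)]

/-- Uncorrelated independent variables are centred with at most one exception, which can be used as
the first summand. -/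
theorem fourth_moment_sum_le [IsProbabilityMeasure P] {ι : Type*} [Fintype ι] {Y : ι → Ω → ℝ}
    (hYm : ∀ i, Measurable (Y i)) (hind : iIndepFun Y P) (hY : ∀ i, MemLp (Y i) 4 P)
    (ho : ∀ i j, i ≠ j → ∫ ω, Y i ω * Y j ω ∂P = 0) {B : ℝ} (hB : 0 ≤ B)
    (hY4 : ∀ i, ∫ ω, Y i ω ^ 4 ∂P ≤ B * (∫ ω, Y i ω ^ 2 ∂P) ^ 2) :
    ∫ ω, (∑ i, Y i ω) ^ 4 ∂P ≤ (4 + 3 * B) * (∫ ω, (∑ i, Y i ω) ^ 2 ∂P) ^ 2 := by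
  classical
  rcases isEmpty_or_nonempty ι with hι | ⟨⟨j⟩⟩
  · simp
  obtain ⟨i₀, hi₀⟩ : ∃ i₀, ∀ i, i ≠ i₀ → ∫ ω, Y i ω ∂P = 0 := by
    by_cases hz : ∃ i₀, ∫ ω, Y i₀ ω ∂P ≠ 0
    · obtain ⟨i₀, hi₀⟩ := hz
      refine ⟨i₀, fun i hi => ?_⟩
      have h1 := ho i i₀ hi
      rw [(hind.indepFun hi).integral_fun_mul_eq_mul_integral (hY i).1 (hY i₀).1] at h1
      exact (mul_eq_zero.1 h1).resolve_right hi₀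
    · push Not at hz
      exact ⟨j, fun i _ => hz i⟩
  have key : ∀ s : Finset ι, i₀ ∉ s → ∫ ω, (∑ i ∈ insert i₀ s, Y i ω) ^ 4 ∂P
      ≤ (4 + 3 * B) * (∫ ω, (∑ i ∈ insert i₀ s, Y i ω) ^ 2 ∂P) ^ 2 := by
    intro s
    induction s using Finset.induction_on with
    | empty =>
      intro _
      simp only [insert_empty_eq, Finset.sum_singleton]
      refine (hY4 i₀).trans (mul_le_mul_of_nonneg_right (by linarith) (sq_nonneg _))
    | insert i s his ih =>
      intro hi
      rw [Finset.mem_insert, not_or] at hi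
      have hnot : i ∉ insert i₀ s := by
        rw [Finset.mem_insert, not_or]
        exact ⟨fun h => hi.1 h.symm, his⟩
      have hindep := hind.indepFun_finsetSum_of_notMem hYm hnot
      have hsum : (∑ l ∈ insert i₀ s, Y l) = fun ω => ∑ l ∈ insert i₀ s, Y l ω := by
        ext ω
        rw [Finset.sum_apply]
      rw [hsum] at hindep
      have h1 := fourth_moment_add_le (memLp_finsetSum _ fun l _ => hY l) (hY i) hindep
        (hi₀ i fun h => hi.1 h.symm) hB (hY4 i) (ih hi.2)
      have h2 : ∀ ω, ∑ l ∈ insert i₀ (insert i s), Y l ω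
          = (∑ l ∈ insert i₀ s, Y l ω) + Y i ω := by
        intro ω
        rw [Finset.insert_comm, Finset.sum_insert hnot, add_comm]
      simpa only [h2] using h1
  have := key (Finset.univ.erase i₀) (Finset.notMem_erase _ _)
  rwa [Finset.insert_erase (Finset.mem_univ i₀)] at this

/-- If the fourth moment is comparable to the squared second moment, then restricting to an event of
probability close to one retains half of the second moment. -/
theorem integral_sq_le_two_mul_setIntegral [IsProbabilityMeasure P] {F : Ω → ℝ} (hF : MemLp F 4 P)
    {M : ℝ} (hM : 0 < M) (hF4 : ∫ ω, F ω ^ 4 ∂P ≤ M * (∫ ω, F ω ^ 2 ∂P) ^ 2) {S : Set Ω}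
    (hS : MeasurableSet S) (hSM : M * P.real Sᶜ ≤ 1 / 4) :
    ∫ ω, F ω ^ 2 ∂P ≤ 2 * ∫ ω in S, F ω ^ 2 ∂P := by
  set A := ∫ ω, F ω ^ 2 ∂P with hA
  have hA0 : 0 ≤ A := integral_nonneg fun _ => sq_nonneg _
  rcases hA0.eq_or_lt with h0 | hpos
  · rw [← h0]
    exact mul_nonneg zero_le_two (integral_nonneg fun _ => sq_nonneg _)
  have h2 := integrable_pow_of_memLp_four hF (k := 2) (by norm_num)
  have h4 := integrable_pow_of_memLp_four hF (k := 4) le_rfl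
  have hsplit := integral_add_compl hS h2
  have hc : ∫ ω in Sᶜ, F ω ^ 2 ∂P ≤ A / 2 := by
    -- the inequality of arithmetic and geometric means in place of the Cauchy–Schwarz inequality
    have hle : ∀ ω, F ω ^ 2 ≤ F ω ^ 4 / (4 * (M * A)) + M * A := by
      intro ω
      have hMA : 0 < M * A := mul_pos hM hpos
      rw [div_add' _ _ _ (by positivity), le_div_iff₀ (by positivity)]
      nlinarith [sq_nonneg (F ω ^ 2 - 2 * (M * A))]
    calc ∫ ω in Sᶜ, F ω ^ 2 ∂P
        ≤ ∫ ω in Sᶜ, (F ω ^ 4 / (4 * (M * A)) + M * A) ∂P :=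
          integral_mono h2.integrableOn
            ((h4.div_const _).fun_add (integrable_const _)).integrableOn hle
      _ = (∫ ω in Sᶜ, F ω ^ 4 ∂P) / (4 * (M * A)) + M * A * P.real Sᶜ := by
          rw [integral_add (h4.div_const _).integrableOn (integrable_const _).integrableOn,
            integral_div, setIntegral_const, smul_eq_mul, mul_comm (M * A)]
      _ ≤ (M * A ^ 2) / (4 * (M * A)) + M * A * P.real Sᶜ := by
          refine add_le_add (div_le_div_of_nonneg_right ?_ (by positivity)) le_rfl
          exact (setIntegral_le_integral h4
            (Eventually.of_forall fun ω => Even.pow_nonneg ⟨2, rfl⟩ _)).trans hF4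
      _ = A / 4 + A * (M * P.real Sᶜ) := by
          field_simp
      _ ≤ A / 2 := by nlinarith
  linarith

end FourthMoment

/-! ### Independent features -/

section Independent

variable {p : ℕ} {μ : Measure (Idx p → ℝ)} {lam : Idx p → ℝ}

instance finite_idx (p : ℕ) : Finite (Idx p) :=
  Finite.of_injective (fun l : Idx p => (⟨l.1, by exact_mod_cast l.2⟩ : Fin p)) fun l l' h =>
    Subtype.ext (congrArg Fin.val h)

theorem featureDot_ae_eq_sum [Fintype (Idx p)] (h : IsFeatureLaw μ lam) (v : Idx p → ℝ) :
    featureDot μ v =ᵐ[μ] fun x => ∑ l, v l * x l := by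
  rw [featureDot, tsum_fintype]
  have h1 : ∀ l, (v l • coordL2 μ l : Lp ℝ 2 μ) =ᵐ[μ] fun x => v l * x l := by
    intro l
    filter_upwards [Lp.coeFn_smul (v l) (coordL2 μ l), coeFn_coordL2 h l] with x h2 h3
    rw [h2, Pi.smul_apply, h3, smul_eq_mul]
  filter_upwards [Lp.coeFn_finsetSum Finset.univ fun l => v l • coordL2 μ l,
    ae_all_iff.2 h1] with x h2 h3
  rw [h2, Finset.sum_apply]
  exact Finset.sum_congr rfl fun l _ => h3 l

/-- Linear functionals of independent features have comparable second and fourth moments. -/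
theorem IndependentFeatures.integral_featureDot_pow_four_le (h : IsFeatureLaw μ lam) {G : ℝ}
    (hG : 0 < G) (hI : IndependentFeatures μ lam G) (v : Idx p → ℝ) :
    MemLp (featureDot μ v) 4 μ ∧ ∫ x, featureDot μ v x ^ 4 ∂μ
      ≤ (4 + 3 * (4 * (2 * G) ^ 4)) * (∫ x, featureDot μ v x ^ 2 ∂μ) ^ 2 := by
  have := h.isProb
  have := Fintype.ofFinite (Idx p)
  have hz4 := fun l => lintegral_pow_four_le (by positivity : 0 < 2 * G)
    (lintegral_exp_sq_le_of_psiTwoNorm_le hG (hI.2 l))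
  have hzm : ∀ l, MemLp (fun x => whiten lam x l) 4 μ := fun l =>
    memLp_four_of_lintegral_lt_top (measurable_whiten l).aestronglyMeasurable
      ((hz4 l).trans_lt ENNReal.ofReal_lt_top)
  have hz : ∀ l, ∫ x, whiten lam x l ^ 4 ∂μ ≤ 4 * (2 * G) ^ 4 := by
    intro l
    rw [integral_eq_lintegral_of_nonneg_ae
      (Eventually.of_forall fun _ => Even.pow_nonneg ⟨2, rfl⟩ _)
      (integrable_pow_of_memLp_four (hzm l) le_rfl).1]
    exact ENNReal.toReal_le_of_le_ofReal (by positivity) (hz4 l)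
  have hx : ∀ (x : Idx p → ℝ) l, v l * x l = v l * Real.sqrt (lam l) * whiten lam x l := by
    intro x l
    have := (Real.sqrt_pos.2 (h.pos l)).ne'
    rw [whiten]
    field_simp
  have hYm : ∀ l, Measurable fun x : Idx p → ℝ => v l * x l := fun l =>
    (measurable_pi_apply l).const_mul _
  have hYL : ∀ l, MemLp (fun x : Idx p → ℝ => v l * x l) 4 μ := by
    intro l
    simp only [hx]
    exact (hzm l).const_mul _
  have hind : iIndepFun (fun l (x : Idx p → ℝ) => v l * x l) μ := by
    have h1 := hI.1.comp (fun l y => v l * Real.sqrt (lam l) * y)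
      fun l => measurable_id.const_mul _
    refine h1.congr fun l => Eventually.of_forall fun x => ?_
    exact (hx x l).symm
  have ho : ∀ l m, l ≠ m → ∫ x, v l * x l * (v m * x m) ∂μ = 0 := by
    intro l m hlm
    have h1 : ∀ x : Idx p → ℝ, v l * x l * (v m * x m) = v l * v m * (x l * x m) := fun x => by ring
    simp only [h1]
    rw [integral_const_mul, h.offDiag l m hlm, mul_zero]
  have hY4 : ∀ l, ∫ x, (v l * x l) ^ 4 ∂μ ≤ 4 * (2 * G) ^ 4 * (∫ x, (v l * x l) ^ 2 ∂μ) ^ 2 := by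
    intro l
    have h1 : ∀ x : Idx p → ℝ, (v l * x l) ^ 4 = (v l ^ 2 * lam l) ^ 2 * whiten lam x l ^ 4 := by
      intro x
      rw [mul_pow (v l), show x l ^ 4 = (x l ^ 2) ^ 2 by ring, ← lam_mul_whiten_sq h]
      ring
    have h2 : ∀ x : Idx p → ℝ, (v l * x l) ^ 2 = v l ^ 2 * (x l * x l) := fun x => by ring
    simp only [h1, h2]
    rw [integral_const_mul, integral_const_mul, h.diag, mul_comm (4 * _)]
    exact mul_le_mul_of_nonneg_left (hz l) (sq_nonneg _)
  have hmain := fourth_moment_sum_le hYm hind hYL ho (by positivity) hY4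
  have hF := featureDot_ae_eq_sum h v
  refine ⟨(memLp_congr_ae hF).2 (memLp_finsetSum _ fun l _ => hYL l), ?_⟩
  have hpow : ∀ k : ℕ, ∫ x, featureDot μ v x ^ k ∂μ = ∫ x, (∑ l, v l * x l) ^ k ∂μ := fun k =>
    integral_congr_ae (hF.mono fun x h1 => congrArg (· ^ k) h1)
  rw [hpow, hpow]
  exact hmain

theorem IndependentFeatures.retainsHalf (h : IsFeatureLaw μ lam) {G : ℝ} (hG : 0 < G)
    (hI : IndependentFeatures μ lam G) {S : Set (Idx p → ℝ)} (hS : MeasurableSet S)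
    (hSM : (4 + 3 * (4 * (2 * G) ^ 4)) * μ.real Sᶜ ≤ 1 / 4) : RetainsHalf μ lam S := by
  have := h.isProb
  intro v _
  obtain ⟨h4, hle⟩ := hI.integral_featureDot_pow_four_le h hG v
  rw [lintegral_featureDot_sq, ← ofReal_integral_eq_lintegral_ofReal
    (memLp_featureDot v).integrable_sq.integrableOn
    (Eventually.of_forall fun _ => sq_nonneg _), ← ENNReal.ofReal_ofNat,
    ← ENNReal.ofReal_mul zero_le_two]
  exact ENNReal.ofReal_le_ofReal
    (integral_sq_le_two_mul_setIntegral h4 (by positivity) hle hS hSM)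

theorem IndependentFeatures.measure_compl_typicalSet_le (h : IsFeatureLaw μ lam) {G : ℝ}
    (hG : 0 < G) (hI : IndependentFeatures μ lam G) {L : ℝ} (hL : 0 ≤ L) (k : ℕ) :
    μ (typicalSet lam k (16 * G ^ 2 * L * k) (16 * G ^ 2 * L * (tailTrace lam 1 k).toReal))ᶜ
      ≤ ENNReal.ofReal (4 * Real.exp (-(4 * L))) := by
  have := Fintype.ofFinite (Idx p)
  have hz := fun l => lintegral_exp_sq_le_of_psiTwoNorm_le hG (hI.2 l)
  have hhead := measure_sum_mul_sq_gt_le (P := μ) (s := headIdx p k) (w := fun _ => 1)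
    (fun _ _ => zero_le_one) (fun l => measurable_whiten (lam := lam) l) hz
    (by positivity : 0 < 2 * G) (4 * L)
  set w : Idx p → ℝ := fun l => if k ≤ l.1 then lam l else 0 with hw
  have hw0 : ∀ l, 0 ≤ w l := by
    intro l
    rw [hw]
    dsimp only
    split_ifs
    · exact (h.pos l).le
    · exact le_rfl
  have htail := measure_sum_mul_sq_gt_le (P := μ) (s := Finset.univ) (w := w)
    (fun l _ => hw0 l) (fun l => measurable_whiten (lam := lam) l) hz
    (by positivity : 0 < 2 * G) (4 * L)
  have htr : (tailTrace lam 1 k).toReal = ∑ l, w l := by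
    rw [tailTrace, tsum_fintype, ← ENNReal.toReal_ofReal (Finset.sum_nonneg fun l _ => hw0 l),
      ENNReal.ofReal_sum_of_nonneg fun l _ => hw0 l]
    congr 1
    refine Finset.sum_congr rfl fun l _ => ?_
    rw [hw]
    dsimp only
    split_ifs <;> simp
  have htsq : ∀ x, tailSq lam 1 k x = ENNReal.ofReal (∑ l, w l * whiten lam x l ^ 2) := by
    intro x
    rw [tailSq, tsum_fintype,
      ENNReal.ofReal_sum_of_nonneg fun l _ => mul_nonneg (hw0 l) (sq_nonneg _)]
    refine Finset.sum_congr rfl fun l _ => ?_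
    rw [hw]
    dsimp only
    split_ifs <;> simp
  refine (measure_mono ?_).trans ((measure_union_le _ _).trans (add_le_add hhead htail)) |>.trans
    (le_of_eq ?_)
  · intro x hx
    by_contra hnot
    rw [Set.mem_union, not_or, Set.mem_ofPred_eq, Set.mem_ofPred_eq, not_lt, not_lt] at hnot
    refine hx ⟨?_, ?_⟩
    · rw [headSq_eq_sum, Finset.sum_coe_sort (headIdx p k) fun l => whiten lam x l ^ 2]
      refine ENNReal.ofReal_le_ofReal ?_
      have h1 := hnot.1
      simp only [one_mul, Finset.sum_const, nsmul_eq_mul, mul_one] at h1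
      refine h1.trans ?_
      have h2 : ((headIdx p k).card : ℝ) ≤ k := by exact_mod_cast card_headIdx_le p k
      have h3 := mul_le_mul_of_nonneg_left h2 (by positivity : 0 ≤ 4 * L * (2 * G) ^ 2)
      linarith
    · rw [htsq, htr]
      refine ENNReal.ofReal_le_ofReal (hnot.2.trans (le_of_eq ?_))
      ring
  · rw [← ENNReal.ofReal_add (by positivity) (by positivity)]
    congr 1
    ring

/-- Under independent features an input is atypical with probability at most `4 * n ^ (-4)`. -/
theorem exists_bias_bound_of_independentFeatures (a r b δ c C G : ℝ) (ha : 0 < a) (hr : 0 < r)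
    (hb : 0 < b) (hb' : b ≤ 1 + a) (hδ : 0 < δ) (hδ' : δ < 1) (hc : 0 < c) (hC : 0 < C)
    (hG : 0 < G) :
    ∃ (K : ℝ) (γ : ℕ), ∀ᶠ n : ℕ in atTop,
      ∀ (p : ℕ) (μ : Measure (Idx p → ℝ)) (lam θ : Idx p → ℝ) (ridge : ℝ),
        IsFeatureLaw μ lam → PolyEigenDecay lam a c C → PolyTarget θ r C →
        PolyRidge n ridge b c C → IndependentFeatures μ lam G →
        sampleLaw μ n {X | ¬ bias μ θ ridge X ≤ ENNReal.ofReal (K * Real.log n ^ γ *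
                  (n : ℝ) ^ (-(min ((2 * r + a) / (1 + a)) 2 * b)))} ≤ ENNReal.ofReal δ := by
  obtain ⟨K, γ, hK⟩ := exists_bias_bound a r b δ c C (16 * G ^ 2) ha hr hb hb' hδ hδ' hc hC
    (by positivity)
  refine ⟨K, γ, ?_⟩
  set M := 4 + 3 * (4 * (2 * G) ^ 4) with hM
  have hM0 : 0 < M := by positivity
  filter_upwards [hK, eventually_ge_atTop 1,
    tendsto_natCast_atTop_atTop.eventually_ge_atTop (12 / δ),
    tendsto_natCast_atTop_atTop.eventually_ge_atTop (16 * M)]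
    with n hn hn1 hnδ hnM p μ lam θ ridge h hl hθ hridge hI
  have := h.isProb
  have hn1' : (1 : ℝ) ≤ n := by exact_mod_cast hn1
  have hn0 : (0 : ℝ) < n := by linarith
  have hexp : Real.exp (-(4 * Real.log n)) = ((n : ℝ) ^ 4)⁻¹ := by
    rw [Real.exp_neg, mul_comm, Real.exp_mul, Real.exp_log hn0]
    norm_cast
  have h0 : μ (goodSet lam a b (16 * G ^ 2 * Real.log n) n)ᶜ
      ≤ ENNReal.ofReal (4 * ((n : ℝ) ^ 4)⁻¹) := by
    rw [← hexp]
    exact hI.measure_compl_typicalSet_le h hG (Real.log_nonneg hn1') _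
  have h2 : (n : ℝ) ^ 2 ≤ n ^ 4 := pow_le_pow_right₀ hn1' (by norm_num)
  have h3 : (n : ℝ) ≤ n ^ 4 := le_self_pow₀ hn1' (by norm_num)
  refine hn p μ lam θ ridge h hl hθ hridge
    (hI.retainsHalf h hG (measurableSet_typicalSet _ _ _) ?_) ?_
  · have h4 : μ.real (goodSet lam a b (16 * G ^ 2 * Real.log n) n)ᶜ ≤ 4 * ((n : ℝ) ^ 4)⁻¹ :=
      ENNReal.toReal_le_of_le_ofReal (by positivity) h0
    refine (mul_le_mul_of_nonneg_left h4 hM0.le).trans ?_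
    rw [← mul_assoc, ← div_eq_mul_inv, div_le_div_iff₀ (by positivity) (by norm_num)]
    linarith
  · refine (mul_le_mul_right h0 _).trans ?_
    rw [← ENNReal.ofReal_natCast, ← ENNReal.ofReal_mul hn0.le]
    refine ENNReal.ofReal_le_ofReal ?_
    rw [← mul_assoc, ← div_eq_mul_inv, div_le_div_iff₀ (by positivity) (by norm_num)]
    rw [div_le_iff₀ hδ] at hnδ
    have h5 := mul_le_mul_of_nonneg_left h2 hδ.le
    nlinarith

end Independent

end RidgeBias

end

theorem mainTheorem2
    (a r b δ : ℝ) (ha : 0 < a) (hr : 0 < r) (hb : 0 < b) (hb' : b ≤ 1 + a)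
    (hδ : 0 < δ) (hδ' : δ < 1)
    (c C : ℝ) (hc : 0 < c) (hC : 0 < C) :
    (∃ (K : ℝ) (γ : ℕ) (ε : ℕ → ℝ),
      ε =o[atTop] (fun n : ℕ => (1 : ℝ) / (n : ℝ)) ∧
      ∀ᶠ n : ℕ in atTop,
        ∀ (p : ℕ∞) (μ : Measure (RidgeBias.Idx p → ℝ)) (lam θ : RidgeBias.Idx p → ℝ) (ridge : ℝ),
          RidgeBias.IsFeatureLaw μ lam →
          RidgeBias.PolyEigenDecay lam a c C →
          RidgeBias.PolyTarget θ r C →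
          RidgeBias.PolyRidge n ridge b c C →
          RidgeBias.GenericFeatures μ lam c C →
          RidgeBias.sampleLaw μ n
              {X | ¬ RidgeBias.bias μ θ ridge X ≤
                ENNReal.ofReal (K * Real.log n ^ γ *
                  (n : ℝ) ^ (-(min ((2 * r + a) / (1 + a)) 2 * b)))}
            ≤ ENNReal.ofReal (δ + ε n)) ∧
    (∀ G η : ℝ, 0 < G → 1 < η →
      ∃ (K : ℝ) (γ : ℕ) (c₁ : ℝ), 0 < c₁ ∧
      ∀ᶠ n : ℕ in atTop,
        ∀ (p : ℕ) (μ : Measure (RidgeBias.Idx p → ℝ)) (lam θ : RidgeBias.Idx p → ℝ) (ridge : ℝ),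
          η * (n : ℝ) < (p : ℝ) →
          RidgeBias.IsFeatureLaw μ lam →
          RidgeBias.PolyEigenDecay lam a c C →
          RidgeBias.PolyTarget θ r C →
          RidgeBias.PolyRidge n ridge b c C →
          RidgeBias.IndependentFeatures μ lam G →
          RidgeBias.sampleLaw μ n
              {X | ¬ RidgeBias.bias μ θ ridge X ≤
                ENNReal.ofReal (K * Real.log n ^ γ *
                  (n : ℝ) ^ (-(min ((2 * r + a) / (1 + a)) 2 * b)))}
            ≤ ENNReal.ofReal (δ + 3 * Real.exp (-(c₁ * n)))) := by
  constructor
  · obtain ⟨K, γ, hK⟩ :=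
      RidgeBias.exists_bias_bound_of_genericFeatures a r b δ c C ha hr hb hb' hδ hδ' hc hC
    refine ⟨K, γ, fun _ => 0, isLittleO_zero _ _, ?_⟩
    filter_upwards [hK] with n hn p μ lam θ ridge h hl hθ hridge hg
    rw [add_zero]
    exact hn p μ lam θ ridge h hl hθ hridge hg
  · intro G _ hG _
    obtain ⟨K, γ, hK⟩ :=
      RidgeBias.exists_bias_bound_of_independentFeatures a r b δ c C G ha hr hb hb' hδ hδ' hc hC hG
    refine ⟨K, γ, 1, one_pos, ?_⟩
    filter_upwards [hK] with n hn p μ lam θ ridge _ h hl hθ hridge hI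
    refine (hn p μ lam θ ridge h hl hθ hridge hI).trans (ENNReal.ofReal_le_ofReal ?_)
    linarith [Real.exp_pos (-(1 * (n : ℝ)))]
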